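/- Consider the unit-cost real RAM with floor function: it stores exact real numbers and words of $O(\log n)$ bits (natural numbers smaller than $n^{\kappa}$ for a constant $\kappa$); arithmetic operations, comparisons, memory accesses, conversion of words to reals, and the floor function (if its result fits in a word) take one time unit each; a computation uses space $s$ if all its memory accesses are to cells with addresses in $\{0,\dots,s-1\}$. A rectangle is a semi-open set $(x,x']\times(y,y']$ with $x,x',y,y'\in\mathbb{R}$. For every $k\in\mathbb{N}$ there is a constant $K$ such that for every fixed $\varepsilon\in(0,1)$ there are a preprocessing program, a query program and constants $\kappa$ and $C$, such that the following holds for all $n\ge 2$. Let $P$ be a set of $n$ points picked uniformly and independently from $[0,1]^2$. Almost surely, given $P$ the preprocessing program halts and leaves in memory a data structure on which the query program, given any rectangle $\mathsf{q}$, returns a yes/no answer in at most $K/\varepsilon$ steps (that is, in $O(1)$ time for fixed $\varepsilon$), leaving the data structure unchanged. The expected running time of the preprocessing and the expected space used by the preprocessing together with all the queries are each at most $C\,n\log^{1+\varepsilon} n$. With probability at least $1-n^{-k}$ the answers are correct for all rectangles simultaneously: for every rectangle $\mathsf{q}$ the query program reports that $\mathsf{q}$ is empty if and only if $\mathsf{q}\cap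 P=\emptyset$. -/

import Mathlib

open MeasureTheory Set
open scoped ENNReal

/-!
# A real RAM with a floor function and words of bounded length

The machine has registers and memory cells of two kinds: *words* (natural numbers below a bound `W`,
which will be polynomial in the input size, so that a word has `O(log n)` bits) and exact real
numbers. Every elementary instruction and every test costs one unit of time. An instruction whose
word result would be `W` or larger, and a memory access at an address `S` or larger, make the
machine fail, so that a run with memory limit `S` uses only the memory cells `0, …, S - 1`.
The floor function is subject to the same bound on its result.
-/

namespace RealRAM

/-- The memory: one array of words and one array of real numbers. -/
structure Memory where
  word : ℕ → ℕ
  real : ℕ → ℝ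

/-- A configuration: word registers, real registers and the memory. -/
structure State where
  wreg : ℕ → ℕ
  rreg : ℕ → ℝ
  mem : Memory

/-- Operations on words (`sub` is truncated; dividing by zero gives Lean's default value). -/
inductive WordOp
  | add | sub | mul | div | mod

def WordOp.eval : WordOp → ℕ → ℕ → ℕ
  | add, a, b => a + b
  | sub, a, b => a - b
  | mul, a, b => a * b
  | div, a, b => a / b
  | mod, a, b => a % b

/-- Operations on real numbers (dividing by zero gives zero). -/
inductive RealOp
  | add | sub | mul | div

noncomputable def RealOp.eval : RealOp → ℝ → ℝ → ℝ
  | add, a, b => a + b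
  | sub, a, b => a - b
  | mul, a, b => a * b
  | div, a, b => a / b

/-- Elementary instructions. The first argument is the number of the target register, except in
`storeW a b` and `storeR a b`, which write register `b` to the cell whose address is in word
register `a`. -/
inductive Instr
  | const (d c : ℕ)
  | moveW (d a : ℕ)
  | moveR (d a : ℕ)
  | opW (o : WordOp) (d a b : ℕ)
  | opR (o : RealOp) (d a b : ℕ)
  | cast (d a : ℕ)
  | floor (d a : ℕ)
  | loadW (d a : ℕ)
  | loadR (d a : ℕ)
  | storeW (a b : ℕ)
  | storeR (a b : ℕ)

namespace State

/-- Write a value to a word register; this fails if the value is not below the word bound `W`. -/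
def setW (W : ℕ) (σ : State) (d v : ℕ) : Option State :=
  if v < W then some { σ with wreg := Function.update σ.wreg d v } else none

/-- Write a value to a real register. -/
noncomputable def setR (σ : State) (d : ℕ) (v : ℝ) : State :=
  { σ with rreg := Function.update σ.rreg d v }

end State

/-- The effect of an instruction on a machine with word bound `W` and memory limit `S`;
`none` means that the machine fails. -/
noncomputable def Instr.exec (W S : ℕ) (σ : State) : Instr → Option State
  | const d c => σ.setW W d c
  | moveW d a => σ.setW W d (σ.wreg a)
  | moveR d a => some (σ.setR d (σ.rreg a))
  | opW o d a b => σ.setW W d (o.eval (σ.wreg a) (σ.wreg b))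
  | opR o d a b => some (σ.setR d (o.eval (σ.rreg a) (σ.rreg b)))
  | cast d a => some (σ.setR d (σ.wreg a : ℝ))
  | floor d a => open Classical in
      if 0 ≤ σ.rreg a then σ.setW W d ⌊σ.rreg a⌋₊ else none
  | loadW d a => if σ.wreg a < S then σ.setW W d (σ.mem.word (σ.wreg a)) else none
  | loadR d a => if σ.wreg a < S then some (σ.setR d (σ.mem.real (σ.wreg a))) else none
  | storeW a b =>
      if σ.wreg a < S then
        some { σ with mem :=
          { σ.mem with word := Function.update σ.mem.word (σ.wreg a) (σ.wreg b) } }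
      else none
  | storeR a b =>
      if σ.wreg a < S then
        some { σ with mem :=
          { σ.mem with real := Function.update σ.mem.real (σ.wreg a) (σ.rreg b) } }
      else none

/-- Tests: comparisons of two word registers or of two real registers. -/
inductive Test
  | ltW (a b : ℕ)
  | eqW (a b : ℕ)
  | ltR (a b : ℕ)
  | leR (a b : ℕ)

def Test.Holds (σ : State) : Test → Prop
  | ltW a b => σ.wreg a < σ.wreg b
  | eqW a b => σ.wreg a = σ.wreg b
  | ltR a b => σ.rreg a < σ.rreg b
  | leR a b => σ.rreg a ≤ σ.rreg b

/-- Programs. A program is a finite object that contains no real constants. -/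
inductive Prog
  | skip
  | instr (i : Instr)
  | seq (p q : Prog)
  | cond (c : Test) (p q : Prog)
  | loop (c : Test) (p : Prog)

/-- `Exec W S p σ t σ'`: on the machine with word bound `W` and memory limit `S`, the program `p`
started in configuration `σ` halts, without failing, after exactly `t` steps in configuration `σ'`.
`loop c p` repeats `p` as long as `c` holds. -/
inductive Exec (W S : ℕ) : Prog → State → ℕ → State → Prop
  | skip (σ : State) : Exec W S .skip σ 1 σ
  | instr {i : Instr} {σ σ' : State} (h : i.exec W S σ = some σ') : Exec W S (.instr i) σ 1 σ'
  | seq {p q : Prog} {σ σ' σ'' : State} {t t' : ℕ}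
      (hp : Exec W S p σ t σ') (hq : Exec W S q σ' t' σ'') : Exec W S (.seq p q) σ (t + t') σ''
  | cond_true {c : Test} {p q : Prog} {σ σ' : State} {t : ℕ}
      (hc : c.Holds σ) (hp : Exec W S p σ t σ') : Exec W S (.cond c p q) σ (t + 1) σ'
  | cond_false {c : Test} {p q : Prog} {σ σ' : State} {t : ℕ}
      (hc : ¬ c.Holds σ) (hq : Exec W S q σ t σ') : Exec W S (.cond c p q) σ (t + 1) σ'
  | loop_true {c : Test} {p : Prog} {σ σ' σ'' : State} {t t' : ℕ}
      (hc : c.Holds σ) (hp : Exec W S p σ t σ') (hl : Exec W S (.loop c p) σ' t' σ'') :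
      Exec W S (.loop c p) σ (t + t' + 1) σ''
  | loop_false {c : Test} {p : Prog} {σ : State} (hc : ¬ c.Holds σ) : Exec W S (.loop c p) σ 1 σ

/-- The initial memory holds the points `(x₀, y₀), …, (xₙ₋₁, yₙ₋₁)` as the real numbers
`x₀, y₀, x₁, y₁, …` in the real cells `0, …, 2n - 1`; all other cells are zero. -/
noncomputable def inputMemory {n : ℕ} (P : Fin n → ℝ × ℝ) : Memory where
  word := fun _ => 0
  real := fun j =>
    if h : j / 2 < n then (if j % 2 = 0 then (P ⟨j / 2, h⟩).1 else (P ⟨j / 2, h⟩).2) else 0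

/-- The initial configuration of the preprocessing: word register `0` holds `n`, all other registers
are zero, and the memory holds the points. -/
noncomputable def inputState {n : ℕ} (P : Fin n → ℝ × ℝ) : State where
  wreg := Function.update (fun _ => 0) 0 n
  rreg := fun _ => 0
  mem := inputMemory P

/-- The initial configuration of a query with the rectangle `(x, x'] × (y, y']`: the real registers
`0, 1, 2, 3` hold `x, x', y, y'`, all other registers are zero, and the memory is `M`. -/
noncomputable def queryState (M : Memory) (x x' y y' : ℝ) : State where
  wreg := fun _ => 0
  rreg := fun i =>
    if i = 0 then x else if i = 1 then x' else if i = 2 then y else if i = 3 then y' else 0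
  mem := M

/-- Within the first `s` memory cells, the program `build`, given the points `P`, halts after `t`
steps and leaves the data structure `M` in memory. -/
def Builds (W s : ℕ) (build : Prog) {n : ℕ} (P : Fin n → ℝ × ℝ) (t : ℕ) (M : Memory) : Prop :=
  ∃ σ : State, Exec W s build (inputState P) t σ ∧ σ.mem = M

/-- Within the first `s` memory cells, the program `query`, given the data structure `M` and the
rectangle `(x, x'] × (y, y']`, halts after `t` steps with the answer `b` (`0` or `1`) in word
register `0`, and leaves the data structure as it was. -/
def Answers (W s : ℕ) (query : Prog) (M : Memory) (x x' y y' : ℝ) (t : ℕ) (b : Bool) : Prop :=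
  ∃ σ : State, Exec W s query (queryState M x x' y y') t σ ∧ σ.wreg 0 = b.toNat ∧ σ.mem = M

end RealRAM

/-- The law of `n` independent uniform random points of the unit square. -/
noncomputable def uniformPoints (n : ℕ) : Measure (Fin n → ℝ × ℝ) :=
  Measure.pi fun _ => (volume : Measure (ℝ × ℝ)).restrict (Icc 0 1 ×ˢ Icc 0 1)

/-- The semi-open rectangle `(x, x'] × (y, y']`. -/
def rectangle (x x' y y' : ℝ) : Set (ℝ × ℝ) := Ioc x x' ×ˢ Ioc y y'

/-! Let `Q = 2 ^ L` be the least power of two that is at least `n`. Level `i ≤ L` cuts the unit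
square into `2 ^ i` columns and `2 ^ (L - i)` rows. All cells, of whatever shape, have area `1 / Q ≤
1 / n`, so a cell holds at most one point on average, and there are `O(n log n)` cells in all.

Inside a cell, queries are answered by tabulation. The cell is cut into `B × B` subcells, where `B`
is the least power of two for which no subcolumn or subrow holds more than `J` points (capped at
`Q`). For each of the `B ^ 4` ranges of subcells, up to `4 * J + 1` points are listed. At most `4 *
J` points of a range lie in its boundary strips, so either the list is complete or it contains a
point strictly between the strips, which belongs to the rectangle (`exists_slot`). A crowded strip
of relative width `2 ^ (-t)` has probability at most `2 ^ (-t * (J + 1))`, hence `B ^ 5` has bounded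
expectation once `J ≥ 6` (`uniformPoints_crowded_le`, `lintegral_costBound_le`).

A query clips the rectangle to the square and picks a level on which the width is between two and
four columns, or the last level if the rectangle is too narrow (`Rect.Unit.span`). At most five
columns are involved. In each of them the first and the last row are handled by the tables of the
cells. In the rows strictly between, the vertical extent is no constraint, and in every column at
least one vertical side of the rectangle is no constraint either; so it suffices to test the
leftmost or the rightmost point of a run of cells (`midQuery_spec`, `colsQuery_spec`). These
extremal points come from a sparse table over runs of `2 ^ d` cells, `d ≤ D`. Longer runs need no
table: `2 ^ D` is at least a large multiple of `log n`, so with high probability every run of `2 ^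
D` cells contains a point, and the rectangle is reported nonempty at once (`unitQuery_spec`).

The sparse table has about `D` times `n log n` entries with `D = O(log log n)`, which is `O(n log ^
(1 + ε) n)`; this is the only place where `ε` matters (`growth`), and the programs do not depend on
it. Wrong answers occur only if some cell is not fine even for `B = Q` or some run of `2 ^ D` cells
is empty, which has probability at most `n ^ (-k)` (`uniformPoints_badEvent_le`).

The programs are written in a small structured language whose clock counts commands. A Hoare-style
calculus (`Wp`) gives their effect and cost, and `Run.exec` transfers both to the machine. -/

set_option linter.constructorNameAsVariable false

namespace RealRAM

/-! ## A small imperative language compiled to the machine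

Program variables live in the even real registers, the odd ones hold temporary values. The real
memory is read-only, and the word memory is split into arrays: cell `k` of the array with number `r`
has the address `9 * k + r`. -/

/-- Program variables. -/
inductive Var
  | x | x' | y | y' | n | Q | L | D | NC | G | i | A | R | p | c | r | g | h | h0 | px | py | sx | sy
  | a | b | kx | ky | f | B | F | e | e1 | a1 | a2 | b1 | b2 | cnt | d | w | xa | xb | mn | mx | t
  | ans | m | c1 | c2 | r1 | r2
  deriving DecidableEq

/-- The names of the arrays. -/
inductive Arr
  | par | pw | lg | head | nxt | ptr | tab | mn | mx
  deriving DecidableEq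

/-- The number of a variable. -/
def Var.idx (v : Var) : ℕ := v.ctorIdx

/-- The number of an array. -/
def Arr.idx (r : Arr) : ℕ := r.ctorIdx

theorem Var.idx_injective : Function.Injective Var.idx := by
  intro u v h
  have := congrArg Var.ofNat h
  simpa [Var.idx, Var.ofNat_ctorIdx] using this

theorem Arr.idx_injective : Function.Injective Arr.idx := by
  intro u v h
  have := congrArg Arr.ofNat h
  simpa [Arr.idx, Arr.ofNat_ctorIdx] using this

theorem Arr.idx_lt (r : Arr) : r.idx < 9 := by
  cases r <;> decide

/-- Arithmetic expressions. -/
inductive Ex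
  | lit (c : ℕ)
  | var (v : Var)
  | op (o : RealOp) (a b : Ex)

instance : Add Ex := ⟨.op .add⟩
instance : Sub Ex := ⟨.op .sub⟩
instance : Mul Ex := ⟨.op .mul⟩
instance : Div Ex := ⟨.op .div⟩
instance (c : ℕ) : OfNat Ex c := ⟨.lit c⟩

namespace Ex

/-- The value of an expression. -/
noncomputable def val (ρ : Var → ℝ) : Ex → ℝ
  | lit c => c
  | var v => ρ v
  | op o a b => o.eval (a.val ρ) (b.val ρ)

section
variable (ρ : Var → ℝ) (a b : Ex)

@[simp] theorem val_lit (c : ℕ) : (lit c).val ρ = c := rfl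
@[simp] theorem val_ofNat (c : ℕ) [c.AtLeastTwo] : (ofNat(c) : Ex).val ρ = ofNat(c) := by
  change ((c : ℕ) : ℝ) = _
  rfl
@[simp] theorem val_zero : (0 : Ex).val ρ = 0 := Nat.cast_zero
@[simp] theorem val_one : (1 : Ex).val ρ = 1 := Nat.cast_one
@[simp] theorem val_var (v : Var) : (var v).val ρ = ρ v := rfl
@[simp] theorem val_add : (a + b).val ρ = a.val ρ + b.val ρ := rfl
@[simp] theorem val_sub : (a - b).val ρ = a.val ρ - b.val ρ := rfl
@[simp] theorem val_mul : (a * b).val ρ = a.val ρ * b.val ρ := rfl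
@[simp] theorem val_div : (a / b).val ρ = a.val ρ / b.val ρ := rfl

end

/-- The largest literal. -/
def maxLit : Ex → ℕ
  | lit c => c
  | var _ => 0
  | op _ a b => max a.maxLit b.maxLit

/-- The running time of the evaluation. -/
def cost : Ex → ℕ
  | lit _ => 2
  | var _ => 1
  | op _ a b => a.cost + b.cost + 1

/-- Evaluate an expression into the temporary register number `d`. -/
def code : Ex → ℕ → Prog
  | lit c, d => .seq (.instr (.const 0 c)) (.instr (.cast (2 * d + 1) 0))
  | var v, d => .instr (.moveR (2 * d + 1) (2 * v.idx))
  | op o a b, d => .seq (a.code d)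
      (.seq (b.code (d + 1)) (.instr (.opR o (2 * d + 1) (2 * d + 1) (2 * d + 3))))

/-- Evaluation at depth `d` writes only odd registers from `2 * d + 1` on. Hence a left operand
survives the evaluation of the right operand at depth `d + 1`, and the program variables, in the
even registers, are never touched. -/
theorem exec_code {W S : ℕ} (e : Ex) (he : e.maxLit < W) (d : ℕ) (τ : State) :
    ∃ τ', Exec W S (e.code d) τ e.cost τ' ∧
      τ'.rreg (2 * d + 1) = e.val (fun v => τ.rreg (2 * v.idx)) ∧
      (∀ j, j % 2 = 0 ∨ j < 2 * d + 1 → τ'.rreg j = τ.rreg j) ∧ τ'.mem = τ.mem := by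
  induction e generalizing d τ with
  | lit c =>
    refine ⟨_, Exec.seq (t := 1) (t' := 1) (.instr (if_pos he)) (.instr rfl), ?_, ?_, rfl⟩
    · simp [State.setR]
    · intro j hj
      simp only [State.setR]
      rw [Function.update_of_ne (by omega)]
  | var v =>
    refine ⟨_, .instr rfl, ?_, ?_, rfl⟩
    · simp [State.setR]
    · intro j hj
      simp only [State.setR]
      rw [Function.update_of_ne (by omega)]
  | op o a b iha ihb =>
    simp only [maxLit, max_lt_iff] at he
    obtain ⟨τ₁, h₁, v₁, f₁, m₁⟩ := iha he.1 d τ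
    obtain ⟨τ₂, h₂, v₂, f₂, m₂⟩ := ihb he.2 (d + 1) τ₁
    have hc : a.cost + (b.cost + 1) = (op o a b).cost := by simp [cost, add_assoc]
    refine ⟨_, hc ▸ Exec.seq h₁ (Exec.seq h₂ (.instr rfl)), ?_, ?_, ?_⟩
    · simp only [State.setR, Function.update_self, val]
      rw [f₂ _ (by omega), v₁, show 2 * d + 3 = 2 * (d + 1) + 1 by ring, v₂]
      congr 2
      funext v
      exact f₁ _ (by omega)
    · intro j hj
      simp only [State.setR]
      rw [Function.update_of_ne (by omega), f₂ _ (by omega), f₁ _ hj]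
    · simp [State.setR, m₂, m₁]

end Ex

/-- The state of the language: variables, arrays and a clock that counts commands. -/
structure AS where
  v : Var → ℝ
  a : Arr → ℕ → ℕ
  clk : ℕ

namespace AS

/-- Advance the clock. -/
def tick (s : AS) : AS := { s with clk := s.clk + 1 }

/-- Assign to a variable. -/
def setv (s : AS) (u : Var) (z : ℝ) : AS :=
  { s with v := Function.update s.v u z, clk := s.clk + 1 }

/-- Assign to an array cell. -/
def seta (s : AS) (r : Arr) (k z : ℕ) : AS :=
  { s with a := Function.update s.a r (Function.update (s.a r) k z), clk := s.clk + 1 }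

variable (s : AS) (u u' : Var) (z : ℝ) (r r' : Arr) (k m : ℕ)

@[simp] theorem tick_v : s.tick.v = s.v := rfl
@[simp] theorem tick_a : s.tick.a = s.a := rfl
@[simp] theorem tick_clk : s.tick.clk = s.clk + 1 := rfl
@[simp] theorem setv_v : (s.setv u z).v u' = if u' = u then z else s.v u' := by
  simp [setv, Function.update_apply]
@[simp] theorem setv_a : (s.setv u z).a = s.a := rfl
@[simp] theorem setv_clk : (s.setv u z).clk = s.clk + 1 := rfl
@[simp] theorem seta_v : (s.seta r k m).v = s.v := rfl
@[simp] theorem seta_a :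
    (s.seta r k m).a r' = if r' = r then Function.update (s.a r) k m else s.a r' := by
  simp [seta, Function.update_apply]
@[simp] theorem seta_clk : (s.seta r k m).clk = s.clk + 1 := rfl

end AS

/-- Commands. `flr` rounds down, `ld` and `st` access an array, `pt` reads the real memory; the
tests of `ite` and `wh` are strict inequalities. -/
inductive Cmd
  | skip
  | asg (u : Var) (e : Ex)
  | flr (u : Var) (e : Ex)
  | ld (u : Var) (r : Arr) (e : Ex)
  | pt (u : Var) (e : Ex)
  | st (r : Arr) (e e' : Ex)
  | seq (p q : Cmd)
  | ite (e e' : Ex) (p q : Cmd)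
  | wh (e e' : Ex) (p : Cmd)

/-- `Run W I X c s s'`: the command `c` leads from `s` to `s'` if words are below `W`, array indices
are below `I` and the real memory is `X`. -/
inductive Run (W I : ℕ) (X : ℕ → ℝ) : Cmd → AS → AS → Prop
  | skip (s : AS) : Run W I X .skip s s.tick
  | asg (u : Var) (e : Ex) (s : AS) : Run W I X (.asg u e) s (s.setv u (e.val s.v))
  | flr (u : Var) (e : Ex) (s : AS) (h0 : 0 ≤ e.val s.v) (h : ⌊e.val s.v⌋₊ < W) :
      Run W I X (.flr u e) s (s.setv u (⌊e.val s.v⌋₊ : ℕ))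
  | ld (u : Var) (r : Arr) (e : Ex) (s : AS) (k : ℕ) (hk : e.val s.v = k) (h : k < I) :
      Run W I X (.ld u r e) s (s.setv u (s.a r k))
  | pt (u : Var) (e : Ex) (s : AS) (k : ℕ) (hk : e.val s.v = k) (h : k < I) :
      Run W I X (.pt u e) s (s.setv u (X k))
  | st (r : Arr) (e e' : Ex) (s : AS) (k m : ℕ) (hk : e.val s.v = k) (hm : e'.val s.v = m)
      (h : k < I) (h' : m < W) : Run W I X (.st r e e') s (s.seta r k m)
  | seq {p q : Cmd} {s s' s'' : AS} (hp : Run W I X p s s') (hq : Run W I X q s' s'') :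
      Run W I X (.seq p q) s s''
  | ite_true {e e' : Ex} {p q : Cmd} {s s' : AS} (h : e.val s.v < e'.val s.v)
      (hp : Run W I X p s.tick s') : Run W I X (.ite e e' p q) s s'
  | ite_false {e e' : Ex} {p q : Cmd} {s s' : AS} (h : ¬ e.val s.v < e'.val s.v)
      (hq : Run W I X q s.tick s') : Run W I X (.ite e e' p q) s s'
  | wh_true {e e' : Ex} {p : Cmd} {s s' s'' : AS} (h : e.val s.v < e'.val s.v)
      (hp : Run W I X p s.tick s') (hl : Run W I X (.wh e e' p) s' s'') :
      Run W I X (.wh e e' p) s s''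
  | wh_false {e e' : Ex} {p : Cmd} {s : AS} (h : ¬ e.val s.v < e'.val s.v) :
      Run W I X (.wh e e' p) s s.tick

namespace Cmd

/-- The largest literal. -/
def maxLit : Cmd → ℕ
  | skip => 0
  | asg _ e | flr _ e | ld _ _ e | pt _ e => e.maxLit
  | st _ e e' => max e.maxLit e'.maxLit
  | seq p q => max p.maxLit q.maxLit
  | ite e e' p q => max (max e.maxLit e'.maxLit) (max p.maxLit q.maxLit)
  | wh e e' p => max (max e.maxLit e'.maxLit) p.maxLit

/-- A bound for the running time of a single command. -/
def unit : Cmd → ℕ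
  | skip => 1
  | asg _ e | flr _ e | ld _ _ e | pt _ e => e.cost + 10
  | st _ e e' => e.cost + e'.cost + 10
  | seq p q => max p.unit q.unit
  | ite e e' p q => max (e.cost + e'.cost + 10) (max p.unit q.unit)
  | wh e e' p => max (e.cost + e'.cost + 10) p.unit

/-- Turn the index in word register `0` into an address. -/
def addr (r : Arr) : Prog :=
  .seq (.instr (.const 1 9)) (.seq (.instr (.opW .mul 0 0 1))
    (.seq (.instr (.const 1 r.idx)) (.instr (.opW .add 0 0 1))))

/-- Compilation. -/
def code : Cmd → Prog
  | skip => .skip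
  | asg u e => .seq (e.code 0) (.instr (.moveR (2 * u.idx) 1))
  | flr u e => .seq (e.code 0) (.seq (.instr (.floor 0 1)) (.instr (.cast (2 * u.idx) 0)))
  | ld u r e => .seq (e.code 0) (.seq (.instr (.floor 0 1)) (.seq (addr r)
      (.seq (.instr (.loadW 0 0)) (.instr (.cast (2 * u.idx) 0)))))
  | pt u e => .seq (e.code 0) (.seq (.instr (.floor 0 1)) (.instr (.loadR (2 * u.idx) 0)))
  | st r e e' => .seq (e.code 0) (.seq (e'.code 1) (.seq (.instr (.floor 0 1)) (.seq (addr r)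
      (.seq (.instr (.floor 1 3)) (.instr (.storeW 0 1))))))
  | seq p q => .seq p.code q.code
  | ite e e' p q => .seq (e.code 0) (.seq (e'.code 1) (.cond (.ltR 1 3) p.code q.code))
  -- Both sides of the test are evaluated before the loop and again at the end of each round; the
  -- machine test only compares the two temporaries.
  | wh e e' p => .seq (e.code 0) (.seq (e'.code 1)
      (.loop (.ltR 1 3) (.seq p.code (.seq (e.code 0) (e'.code 1)))))

/-- Whether a command assigns to a variable. -/
def writesVar (w : Var) : Cmd → Bool
  | skip => false
  | asg u _ | flr u _ | ld u _ _ | pt u _ => u == w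
  | st _ _ _ => false
  | seq p q | ite _ _ p q => p.writesVar w || q.writesVar w
  | wh _ _ p => p.writesVar w

/-- Whether a command assigns to an array. -/
def writesArr (w : Arr) : Cmd → Bool
  | skip | asg _ _ | flr _ _ | ld _ _ _ | pt _ _ => false
  | st r _ _ => r == w
  | seq p q | ite _ _ p q => p.writesArr w || q.writesArr w
  | wh _ _ p => p.writesArr w

end Cmd

section Frame
variable {W I : ℕ} {X : ℕ → ℝ} {c : Cmd} {s s' : AS}

/-- What a command may change is read off its syntax, so that for a concrete program the side
condition is proved by `rfl`. -/
theorem Run.var_eq (h : Run W I X c s s') (w : Var) (hw : c.writesVar w = false) :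
    s'.v w = s.v w := by
  induction h with
  | skip | wh_false => rfl
  | asg u | flr u | ld u | pt u =>
    simp only [Cmd.writesVar, beq_eq_false_iff_ne] at hw
    simp [hw.symm]
  | st => rfl
  | seq hp hq ihp ihq =>
    simp only [Cmd.writesVar, Bool.or_eq_false_iff] at hw
    rw [ihq hw.2, ihp hw.1]
  | ite_true h hp ih =>
    simp only [Cmd.writesVar, Bool.or_eq_false_iff] at hw
    exact ih hw.1
  | ite_false h hp ih =>
    simp only [Cmd.writesVar, Bool.or_eq_false_iff] at hw
    exact ih hw.2
  | wh_true h hp hl ihp ihl => rw [ihl hw, ihp hw]; rfl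

theorem Run.arr_eq (h : Run W I X c s s') (w : Arr) (hw : c.writesArr w = false) :
    s'.a w = s.a w := by
  induction h with
  | skip | wh_false => rfl
  | asg u | flr u | ld u | pt u => rfl
  | st =>
    simp only [Cmd.writesArr, beq_eq_false_iff_ne] at hw
    simp [hw.symm]
  | seq hp hq ihp ihq =>
    simp only [Cmd.writesArr, Bool.or_eq_false_iff] at hw
    rw [ihq hw.2, ihp hw.1]
  | ite_true h hp ih =>
    simp only [Cmd.writesArr, Bool.or_eq_false_iff] at hw
    exact ih hw.1
  | ite_false h hp ih =>
    simp only [Cmd.writesArr, Bool.or_eq_false_iff] at hw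
    exact ih hw.2
  | wh_true h hp hl ihp ihl => rw [ihl hw, ihp hw]; rfl

end Frame

/-- The machine state `τ` represents the state `s`. -/
structure Rep (W : ℕ) (X : ℕ → ℝ) (s : AS) (τ : State) : Prop where
  var : ∀ u : Var, τ.rreg (2 * u.idx) = s.v u
  real : τ.mem.real = X
  arr : ∀ (r : Arr) (k : ℕ), τ.mem.word (9 * k + r.idx) = s.a r k
  lt : ∀ k, τ.mem.word k < W

/-! ### Simulation of the language by the machine -/

section Compile
variable {W I : ℕ} {X : ℕ → ℝ} {c : Cmd} {s s' : AS}

theorem Arr.idx_ofNat {j : ℕ} (hj : j < 9) : (Arr.ofNat j).idx = j := by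
  interval_cases j <;> rfl

/-- The addresses `9 * k + r` with `r < 9` exhaust the word memory, so the arrays determine it. This
shows that a query leaves the data structure literally unchanged. -/
theorem Rep.mem_eq {τ τ' : State} (h : Rep W X s τ) (h' : Rep W X s' τ') (ha : s'.a = s.a) :
    τ'.mem = τ.mem := by
  have hw : τ'.mem.word = τ.mem.word := by
    funext k
    have hk := Arr.idx_ofNat (Nat.mod_lt k (show 0 < 9 by norm_num))
    have h₁ := h.arr (Arr.ofNat (k % 9)) (k / 9)
    have h₂ := h'.arr (Arr.ofNat (k % 9)) (k / 9)
    rw [hk, Nat.div_add_mod] at h₁ h₂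
    rw [h₁, h₂, ha]
  have hr : τ'.mem.real = τ.mem.real := h'.real.trans h.real.symm
  cases hτ : τ.mem
  cases hτ' : τ'.mem
  simp_all

theorem Rep.tick {τ : State} (h : Rep W X s τ) : Rep W X s.tick τ := ⟨h.1, h.2, h.3, h.4⟩

theorem Rep.setv {τ τ' : State} (h : Rep W X s τ) {u : Var} {z : ℝ}
    (hρ : τ'.rreg = Function.update τ.rreg (2 * u.idx) z) (hm : τ'.mem = τ.mem) :
    Rep W X (s.setv u z) τ' := by
  refine ⟨fun w => ?_, by rw [hm, h.2], by rw [hm]; exact h.3, by rw [hm]; exact h.4⟩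
  rw [AS.setv_v, hρ]
  split_ifs with hw
  · subst hw; simp
  · rw [Function.update_of_ne, h.1]
    intro h'
    exact hw (Var.idx_injective (by omega))

/-- Evaluation of an expression in a state that represents `s`. -/
theorem Rep.exec_code {τ : State} (h : Rep W X s τ) {S : ℕ} (e : Ex) (he : e.maxLit < W) (d : ℕ) :
    ∃ τ', Exec W S (e.code d) τ e.cost τ' ∧ τ'.rreg (2 * d + 1) = e.val s.v ∧
      (∀ j, j % 2 = 0 ∨ j < 2 * d + 1 → τ'.rreg j = τ.rreg j) ∧ τ'.mem = τ.mem ∧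
      Rep W X s τ' := by
  obtain ⟨τ', h₁, h₂, h₃, h₄⟩ := e.exec_code (S := S) he d τ
  refine ⟨τ', h₁, ?_, h₃, h₄, fun u => ?_, by rw [h₄, h.2], by rw [h₄]; exact h.3,
    by rw [h₄]; exact h.4⟩
  · rw [h₂]
    congr 1
    exact funext h.1
  · rw [h₃ _ (by omega), h.1]

theorem exec_test {τ : State} (h : Rep W X s τ) {S : ℕ} (e e' : Ex) (he : e.maxLit < W)
    (he' : e'.maxLit < W) :
    ∃ τ₁ τ₂, Exec W S (e.code 0) τ e.cost τ₁ ∧ Exec W S (e'.code 1) τ₁ e'.cost τ₂ ∧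
      Rep W X s τ₂ ∧ τ₂.rreg 1 = e.val s.v ∧ τ₂.rreg 3 = e'.val s.v := by
  obtain ⟨τ₁, h₁, v₁, f₁, m₁, r₁⟩ := h.exec_code (S := S) e he 0
  obtain ⟨τ₂, h₂, v₂, f₂, m₂, r₂⟩ := r₁.exec_code (S := S) e' he' 1
  exact ⟨τ₁, τ₂, h₁, h₂, r₂, by rw [f₂ _ (by omega), ← v₁], v₂⟩

theorem exec_addr {S k : ℕ} (r : Arr) (hk : 9 * k + 9 ≤ W) (hW : 9 < W) (τ : State)
    (h0 : τ.wreg 0 = k) :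
    ∃ ω : ℕ → ℕ, ω 0 = 9 * k + r.idx ∧ Exec W S (Cmd.addr r) τ 4 ⟨ω, τ.rreg, τ.mem⟩ := by
  have hr := r.idx_lt
  refine ⟨_, ?_, Exec.seq (t := 1) (t' := 3) (.instr (if_pos hW))
    (Exec.seq (t := 1) (t' := 2) (.instr (if_pos ?_))
      (Exec.seq (t := 1) (t' := 1) (.instr (if_pos (hr.trans hW))) (.instr (if_pos ?_))))⟩
  · simp [WordOp.eval, h0, mul_comm]
  · simp only [WordOp.eval, ne_eq, Nat.zero_ne_one, not_false_eq_true, Function.update_of_ne, h0,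
      Function.update_self]; omega
  · simp only [WordOp.eval, ne_eq, Nat.zero_ne_one, not_false_eq_true, Function.update_of_ne, h0,
      Function.update_self]; omega

/-- Correctness of the compilation. -/
theorem Run.exec (h : Run W I X c s s') (hI : 9 * I ≤ W) (hW : 9 < W) (hc : c.maxLit < W) {U : ℕ}
    (hU : c.unit ≤ U) (τ : State) (hτ : Rep W X s τ) :
    ∃ t τ', Exec W (9 * I) c.code τ t τ' ∧ Rep W X s' τ' ∧ t + U * s.clk ≤ U * s'.clk := by
  -- The clock acts as a potential: each tick pays for `U` machine steps. The inequality is written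
  -- additively to avoid subtraction.
  induction h generalizing τ with
  | skip s =>
    refine ⟨1, τ, .skip τ, hτ.tick, ?_⟩
    simp only [Cmd.unit] at hU
    simp only [AS.tick_clk]; nlinarith
  | asg u e s =>
    simp only [Cmd.maxLit, Cmd.unit] at hc hU
    obtain ⟨τ₁, h₁, v₁, f₁, m₁, r₁⟩ := hτ.exec_code (S := 9 * I) e hc 0
    refine ⟨_, _, .seq h₁ (.instr rfl), ?_, ?_⟩
    · exact r₁.setv (by rw [← v₁]; rfl) rfl
    · simp only [AS.setv_clk]; nlinarith
  | flr u e s h0 hb =>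
    simp only [Cmd.maxLit, Cmd.unit] at hc hU
    obtain ⟨τ₁, h₁, v₁, f₁, m₁, r₁⟩ := hτ.exec_code (S := 9 * I) e hc 0
    simp only [mul_zero, zero_add] at v₁
    refine ⟨_, _, .seq h₁ (.seq (.instr ((if_pos (v₁ ▸ h0)).trans (if_pos (v₁ ▸ hb))))
      (.instr rfl)), ?_, ?_⟩
    · exact r₁.setv (by simp [State.setR, v₁]) rfl
    · simp only [AS.setv_clk]; nlinarith
  | ld u r e s k hk hb =>
    simp only [Cmd.maxLit, Cmd.unit] at hc hU
    obtain ⟨τ₁, h₁, v₁, f₁, m₁, r₁⟩ := hτ.exec_code (S := 9 * I) e hc 0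
    simp only [mul_zero, zero_add, hk] at v₁
    have hr := r.idx_lt
    obtain ⟨ω, hω, h₂⟩ := exec_addr (W := W) (S := 9 * I) r (k := k) (by omega) hW
      { τ₁ with wreg := Function.update τ₁.wreg 0 k } (by simp)
    refine ⟨_, _, .seq h₁ (.seq (.instr (σ' := { τ₁ with wreg := Function.update τ₁.wreg 0 k })
      ?_) (.seq h₂ (.seq (.instr ((if_pos ?_).trans (if_pos ?_))) (.instr rfl)))), ?_, ?_⟩
    · simp [Instr.exec, v₁, State.setW]; omega
    · simp only [hω]; omega
    · exact r₁.4 _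
    · exact r₁.setv (by simp [State.setR, hω, r₁.3 r k]) rfl
    · simp only [AS.setv_clk]; nlinarith
  | pt u e s k hk hb =>
    simp only [Cmd.maxLit, Cmd.unit] at hc hU
    obtain ⟨τ₁, h₁, v₁, f₁, m₁, r₁⟩ := hτ.exec_code (S := 9 * I) e hc 0
    simp only [mul_zero, zero_add, hk] at v₁
    refine ⟨_, _, .seq h₁ (.seq (.instr (σ' := { τ₁ with wreg := Function.update τ₁.wreg 0 k })
      ?_) (.instr (if_pos ?_))), ?_, ?_⟩
    · simp [Instr.exec, v₁, State.setW]; omega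
    · simp; omega
    · exact r₁.setv (by simp [State.setR, r₁.2]) rfl
    · simp only [AS.setv_clk]; nlinarith
  | st r e e' s k m hk hm hb hb' =>
    simp only [Cmd.maxLit, Cmd.unit, max_lt_iff] at hc hU
    obtain ⟨τ₀, τ₁, h₀, h₁, r₁, v₁, v₂⟩ := exec_test hτ (S := 9 * I) e e' hc.1 hc.2
    have hr := r.idx_lt
    obtain ⟨ω, hω, h₂⟩ := exec_addr (W := W) (S := 9 * I) r (k := k) (by omega) hW
      { τ₁ with wreg := Function.update τ₁.wreg 0 k } (by simp)
    refine ⟨_, _, .seq h₀ (.seq h₁ (.seq (.instr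
      (σ' := { τ₁ with wreg := Function.update τ₁.wreg 0 k }) ?_) (.seq h₂ (.seq (.instr
      (σ' := { τ₁ with wreg := Function.update ω 1 m }) ?_) (.instr (if_pos ?_)))))), ?_, ?_⟩
    · simp [Instr.exec, v₁, hk, State.setW]; omega
    · simp [Instr.exec, v₂, hm, State.setW, hb']
    · simp [hω]; omega
    · refine ⟨r₁.1, r₁.2, fun r' k' => ?_, fun j => ?_⟩
      · simp only [Function.update_self, ne_eq, zero_ne_one, not_false_eq_true,
          Function.update_of_ne, hω, AS.seta_a]
        have hr' := r'.idx_lt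
        by_cases hrr : r' = r
        · subst hrr
          simp only [if_true]
          by_cases hkk : k' = k
          · subst hkk; simp
          · rw [Function.update_of_ne (by omega), Function.update_of_ne hkk, r₁.3]
        · rw [if_neg hrr, Function.update_of_ne, r₁.3]
          intro h'
          exact hrr (Arr.idx_injective (by omega))
      · simp only [Function.update_apply]
        split_ifs <;> first | exact hb' | exact r₁.4 _
    · simp only [AS.seta_clk]; nlinarith
  | seq hp hq ihp ihq =>
    simp only [Cmd.maxLit, Cmd.unit, max_lt_iff, max_le_iff] at hc hU
    obtain ⟨t₁, τ₁, h₁, r₁, c₁⟩ := ihp hc.1 hU.1 τ hτ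
    obtain ⟨t₂, τ₂, h₂, r₂, c₂⟩ := ihq hc.2 hU.2 τ₁ r₁
    exact ⟨_, _, .seq h₁ h₂, r₂, by omega⟩
  | @ite_true e e' p q s s' ht hp ih =>
    simp only [Cmd.maxLit, Cmd.unit, max_lt_iff, max_le_iff] at hc hU
    obtain ⟨τ₀, τ₁, h₀, h₁, r₁, v₁, v₂⟩ := exec_test hτ (S := 9 * I) e e' hc.1.1 hc.1.2
    obtain ⟨t₂, τ₂, h₂, r₂, c₂⟩ := ih hc.2.1 hU.2.1 τ₁ r₁.tick
    refine ⟨_, _, .seq h₀ (.seq h₁ (.cond_true ?_ h₂)), r₂, ?_⟩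
    · simpa [Test.Holds, v₁, v₂] using ht
    · simp only [AS.tick_clk] at c₂; nlinarith
  | @ite_false e e' p q s s' ht hp ih =>
    simp only [Cmd.maxLit, Cmd.unit, max_lt_iff, max_le_iff] at hc hU
    obtain ⟨τ₀, τ₁, h₀, h₁, r₁, v₁, v₂⟩ := exec_test hτ (S := 9 * I) e e' hc.1.1 hc.1.2
    obtain ⟨t₂, τ₂, h₂, r₂, c₂⟩ := ih hc.2.2 hU.2.2 τ₁ r₁.tick
    refine ⟨_, _, .seq h₀ (.seq h₁ (.cond_false ?_ h₂)), r₂, ?_⟩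
    · simpa [Test.Holds, v₁, v₂] using ht
    · simp only [AS.tick_clk] at c₂; nlinarith
  | @wh_true e e' p s s' s'' ht hp hl ihp ihl =>
    have hc' := hc
    have hU' := hU
    simp only [Cmd.maxLit, Cmd.unit, max_lt_iff, max_le_iff] at hc hU
    obtain ⟨τ₀, τ₁, h₀, h₁, r₁, v₁, v₂⟩ := exec_test hτ (S := 9 * I) e e' hc.1.1 hc.1.2
    obtain ⟨t₂, τ₂, h₂, r₂, c₂⟩ := ihp hc.2 hU.2 τ₁ r₁.tick
    obtain ⟨t₃, τ₃, h₃, r₃, c₃⟩ := ihl hc' hU' τ₂ r₂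
    -- The code of the remaining rounds begins with an evaluation of the test. It is split off and
    -- becomes the end of the current round, as the machine loop requires.
    simp only [Cmd.code] at h₃
    cases h₃ with
    | seq h₄ h₅ =>
    cases h₅ with
    | seq h₅ h₆ =>
    refine ⟨_, _, .seq h₀ (.seq h₁ (.loop_true ?_ (.seq h₂ (.seq h₄ h₅)) h₆)), r₃, ?_⟩
    · simpa [Test.Holds, v₁, v₂] using ht
    · simp only [AS.tick_clk] at c₂; nlinarith
  | @wh_false e e' p s ht =>
    simp only [Cmd.maxLit, Cmd.unit, max_lt_iff, max_le_iff] at hc hU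
    obtain ⟨τ₀, τ₁, h₀, h₁, r₁, v₁, v₂⟩ := exec_test hτ (S := 9 * I) e e' hc.1.1 hc.1.2
    refine ⟨_, _, .seq h₀ (.seq h₁ (.loop_false ?_)), r₁.tick, ?_⟩
    · simpa [Test.Holds, v₁, v₂] using ht
    · simp only [AS.tick_clk]; nlinarith

end Compile


/-! ## Reasoning about commands -/

/-- The bound for words, the bound for array indices, and the real memory. -/
structure Cfg where
  W : ℕ
  I : ℕ
  X : ℕ → ℝ

/-- The command `c` halts from `s` in a state with the property `Q`. -/
def Wp (z : Cfg) (c : Cmd) (s : AS) (Q : AS → Prop) : Prop := ∃ s₁, Run z.W z.I z.X c s s₁ ∧ Q s₁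

/-- `s` differs from `s₀` only where `c` writes. -/
structure Frame (c : Cmd) (s₀ s : AS) : Prop where
  var : ∀ u, c.writesVar u = false → s.v u = s₀.v u
  arr : ∀ r, c.writesArr r = false → s.a r = s₀.a r

theorem Frame.rfl' (c : Cmd) (s : AS) : Frame c s s := ⟨fun _ _ => rfl, fun _ _ => rfl⟩

theorem Frame.trans {c : Cmd} {s₀ s s' : AS} (h : Frame c s₀ s) (h' : Frame c s s') :
    Frame c s₀ s' :=
  ⟨fun u hu => (h'.1 u hu).trans (h.1 u hu), fun u hu => (h'.2 u hu).trans (h.2 u hu)⟩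

theorem Frame.tick {c : Cmd} {s₀ s : AS} (h : Frame c s₀ s) : Frame c s₀ s.tick := ⟨h.1, h.2⟩

section Rules
variable {z : Cfg} {c p q : Cmd} {s : AS} {P Q : AS → Prop} {e e' : Ex} {u : Var} {r : Arr}

theorem Wp.mono (h : Wp z c s P) (hPQ : ∀ s', P s' → Q s') : Wp z c s Q :=
  let ⟨s', h₁, h₂⟩ := h; ⟨s', h₁, hPQ s' h₂⟩

theorem Wp.frame (h : Wp z c s P) : Wp z c s fun s' => P s' ∧ Frame c s s' :=
  let ⟨s', h₁, h₂⟩ := h; ⟨s', h₁, h₂, h₁.var_eq, h₁.arr_eq⟩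

theorem Wp.seq (h : Wp z p s fun s' => Wp z q s' Q) : Wp z (.seq p q) s Q :=
  let ⟨_, h₁, _, h₂, h₃⟩ := h; ⟨_, .seq h₁ h₂, h₃⟩

/-- Use the specification of a command. -/
theorem Wp.use (h : Wp z c s P) (hPQ : ∀ s', P s' → Frame c s s' → Q s') : Wp z c s Q :=
  h.frame.mono fun s' h' => hPQ s' h'.1 h'.2

theorem Wp.skip (h : Q s.tick) : Wp z .skip s Q := ⟨_, .skip s, h⟩

theorem Wp.asg (x : ℝ) (hx : e.val s.v = x) (h : Q (s.setv u x)) : Wp z (.asg u e) s Q :=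
  ⟨_, .asg u e s, hx ▸ h⟩

theorem Wp.flr (k : ℕ) (h0 : 0 ≤ e.val s.v) (hk : ⌊e.val s.v⌋₊ = k) (hW : k < z.W)
    (h : Q (s.setv u k)) : Wp z (.flr u e) s Q := by
  subst hk
  exact ⟨_, .flr u e s h0 hW, h⟩

theorem Wp.ld (k m : ℕ) (hk : e.val s.v = k) (hI : k < z.I) (hm : s.a r k = m)
    (h : Q (s.setv u m)) : Wp z (.ld u r e) s Q := by
  subst hm
  exact ⟨_, .ld u r e s k hk hI, h⟩

theorem Wp.pt (k : ℕ) (hk : e.val s.v = k) (hI : k < z.I)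
    (h : Q (s.setv u (z.X k))) : Wp z (.pt u e) s Q :=
  ⟨_, .pt u e s k hk hI, h⟩

theorem Wp.st (k m : ℕ) (hk : e.val s.v = k) (hm : e'.val s.v = m) (hI : k < z.I) (hW : m < z.W)
    (h : Q (s.seta r k m)) : Wp z (.st r e e') s Q :=
  ⟨_, .st r e e' s k m hk hm hI hW, h⟩

theorem Wp.ite (h : e.val s.v < e'.val s.v → Wp z p s.tick Q)
    (h' : ¬ e.val s.v < e'.val s.v → Wp z q s.tick Q) : Wp z (.ite e e' p q) s Q := by
  by_cases hc : e.val s.v < e'.val s.v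
  · obtain ⟨s', h₁, h₂⟩ := h hc
    exact ⟨s', .ite_true hc h₁, h₂⟩
  · obtain ⟨s', h₁, h₂⟩ := h' hc
    exact ⟨s', .ite_false hc h₁, h₂⟩

/-- The rule for a loop that is repeated `N` times. -/
theorem Wp.wh (N : ℕ) (I : ℕ → AS → Prop) (h0 : I 0 s)
    (hstep : ∀ k < N, ∀ s', Frame p s s' → I k s' →
      e.val s'.v < e'.val s'.v ∧ Wp z p s'.tick (I (k + 1)))
    (hend : ∀ s', Frame p s s' → I N s' → ¬ e.val s'.v < e'.val s'.v ∧ Q s'.tick) :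
    Wp z (.wh e e' p) s Q := by
  suffices H : ∀ j k s', k + j = N → Frame p s s' → I k s' → Wp z (.wh e e' p) s' Q from
    H N 0 s (zero_add N) (Frame.rfl' p s) h0
  intro j
  induction j with
  | zero =>
    intro k s' hk hf hI
    obtain rfl : k = N := hk
    obtain ⟨h₁, h₂⟩ := hend s' hf hI
    exact ⟨_, .wh_false h₁, h₂⟩
  | succ j ih =>
    intro k s' hk hf hI
    obtain ⟨h₁, h₂⟩ := hstep k (by omega) s' hf hI
    obtain ⟨s₁, h₃, h₄, h₅⟩ := h₂.frame
    obtain ⟨s₂, h₆, h₇⟩ := ih (k + 1) s₁ (by omega) (hf.tick.trans h₅) h₄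
    exact ⟨s₂, .wh_true h₁ h₃ h₆, h₇⟩

end Rules

/-! ## Linked lists -/

/-- `h` is the head of a linked list with the entries `l`; an entry `q` is represented by `q + 1`,
and `0` marks the end. -/
def Chain (nx : ℕ → ℕ) : ℕ → List ℕ → Prop
  | h, [] => h = 0
  | h, q :: l => h = q + 1 ∧ Chain nx (nx q) l

/-- All lists share one successor array. Inserting a new node overwrites only its own successor, so
a list that does not contain the node is unaffected. -/
theorem Chain.update {nx : ℕ → ℕ} {h : ℕ} {l : List ℕ} (hl : Chain nx h l) {q m : ℕ} (hq : q ∉ l) :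
    Chain (Function.update nx q m) h l := by
  induction l generalizing h with
  | nil => exact hl
  | cons a l ih =>
    simp only [List.mem_cons, not_or] at hq
    refine ⟨hl.1, ?_⟩
    rw [Function.update_of_ne (Ne.symm hq.1)]
    exact ih hl.2 hq.2

infixr:60 ";;" => Cmd.seq
prefix:max "⇡" => Ex.var

/-- Run through the linked list that starts at `h0`. -/
def forList (body : Cmd) : Cmd :=
  .asg .h ⇡.h0 ;; .wh 0 ⇡.h (body ;; .ld .h .nxt (⇡.h - 1))

/-- After the body the cursor `h` is reloaded with the successor. The invariant must therefore hold
for every value of `h`, which is why the postcondition of the body quantifies over `h'`. -/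
theorem Wp.forList {z : Cfg} {body : Cmd} {s : AS} {Q : AS → Prop} (l : List ℕ) (h : ℕ)
    (hl : Chain (s.a .nxt) h l) (hh : s.v .h0 = h) (hb : body.writesArr .nxt = false)
    (hbv : body.writesVar .h = false) (hI : ∀ q ∈ l, q < z.I) (I : ℕ → AS → Prop)
    (h0 : I 0 (s.setv .h h))
    (hstep : ∀ (k : ℕ) (hk : k < l.length) (s' : AS), Frame (RealRAM.forList body) s s' → I k s' →
      s'.v .h = (l[k] + 1 : ℕ) → Wp z body s'.tick fun s'' => ∀ h' : ℕ, I (k + 1) (s''.setv .h h'))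
    (hend : ∀ s', Frame (RealRAM.forList body) s s' → I l.length s' → Q s'.tick) :
    Wp z (RealRAM.forList body) s Q := by
  have hfr : ∀ s', Frame (body ;; .ld .h .nxt (⇡.h - 1)) (s.setv .h h) s' →
      Frame (RealRAM.forList body) s s' := by
    intro s' hf
    refine ⟨fun u hu => ?_, fun r hr => ?_⟩
    · simp only [RealRAM.forList, Cmd.writesVar, Bool.or_eq_false_iff] at hu
      rw [hf.1 u (by simp [Cmd.writesVar, hu.1, hu.2.1])]
      have := hu.1
      rw [beq_eq_false_iff_ne] at this
      simp [this.symm]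
    · simp only [RealRAM.forList, Cmd.writesArr, Bool.false_or, Bool.or_false] at hr
      rw [hf.2 r (by simp [Cmd.writesArr, hr])]
      rfl
  refine Wp.seq (Wp.asg h (by simpa using hh) ?_)
  refine Wp.wh l.length (fun k s' => I k s' ∧ ∃ h : ℕ, s'.v .h = h ∧
    Chain (s.a .nxt) h (l.drop k)) ⟨h0, h, by simp, by simpa using hl⟩ ?_ ?_
  · rintro k hk s' hf ⟨hIk, h', hh', hc⟩
    rw [List.drop_eq_getElem_cons hk] at hc
    obtain ⟨rfl, hc⟩ := hc
    refine ⟨by simp [hh']; positivity, ?_⟩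
    have hnx : s'.a .nxt = s.a .nxt := hf.2 _ (by simp [Cmd.writesArr, hb])
    refine Wp.seq (Wp.use (hstep k hk s' (hfr s' hf) hIk hh') fun s'' h₁ hf₁ => ?_)
    have h₂ : s''.v .h = (l[k] + 1 : ℕ) := by rw [hf₁.1 _ hbv, AS.tick_v, hh']
    have h₃ : s''.a .nxt = s.a .nxt := by rw [hf₁.2 _ hb, AS.tick_a, hnx]
    refine Wp.ld l[k] (s.a .nxt l[k]) (by simp [h₂]) (hI _ (List.getElem_mem hk)) (by rw [h₃]) ?_
    exact ⟨h₁ _, _, by simp, hc⟩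
  · rintro s' hf ⟨hIk, h', hh', hc⟩
    simp only [List.drop_length, Chain] at hc
    subst hc
    exact ⟨by simp [hh'], hend s' (hfr s' hf) hIk⟩


/-! ## The data structure

There are levels `0, …, L`. On level `i` the unit square is divided into `2 ^ i` columns and
`2 ^ (L - i)` rows. The cells of all levels are numbered consecutively, with `4 * 2 ^ L` numbers for
each level. Every cell is divided into `B × B` subcells, where `B` is a power of two large enough for
each subcolumn and each subrow to contain at most `J` points. -/

/-- The input (`n` points, the coordinates of the point `p` being `X (2 * p)` and `X (2 * p + 1)`)
and the parameters of the data structure. -/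
structure Dat where
  n : ℕ
  L : ℕ
  D : ℕ
  J : ℕ
  X : ℕ → ℝ

namespace Dat

variable (δ : Dat)

/-- The number of cells of a level. -/
def Q : ℕ := 2 ^ δ.L
/-- The number of cell numbers reserved for a level. -/
def NC : ℕ := 4 * δ.Q
/-- The number of cell numbers. -/
def G : ℕ := (δ.L + 1) * δ.NC
/-- The number of points listed in a table entry. -/
def N : ℕ := 4 * δ.J + 1
def px (p : ℕ) : ℝ := δ.X (2 * p)
def py (p : ℕ) : ℝ := δ.X (2 * p + 1)
/-- The number of the cell of level `i` that contains the point `p`. -/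
noncomputable def cell (i p : ℕ) : ℕ :=
  i * δ.NC + ⌊δ.px p * (2 ^ i : ℕ)⌋₊ * 2 ^ (δ.L - i) + ⌊δ.py p * (2 ^ (δ.L - i) : ℕ)⌋₊
/-- The level of a cell. -/
def lev (g : ℕ) : ℕ := g / δ.NC
/-- The number of columns of the level of a cell. -/
def cols (g : ℕ) : ℕ := 2 ^ δ.lev g
/-- The number of rows of the level of a cell. -/
def rows (g : ℕ) : ℕ := 2 ^ (δ.L - δ.lev g)
def col (g : ℕ) : ℕ := g % δ.NC / δ.rows g
def row (g : ℕ) : ℕ := g % δ.NC % δ.rows g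

/-- The part of `[0, 1]`, divided into `B` parts, that contains `t` or is closest to it. -/
noncomputable def sub (B : ℕ) (t : ℝ) : ℕ := min ⌊t * B⌋₊ (B - 1)

/-- The subcolumn of a point. -/
noncomputable def sx (g B p : ℕ) : ℕ := sub B (δ.px p * δ.cols g - δ.col g)
/-- The subrow of a point. -/
noncomputable def sy (g B p : ℕ) : ℕ := sub B (δ.py p * δ.rows g - δ.row g)

/-- The pairs of a level `i` and a point `p` of the cell `g`, as numbers `i * n + p`, among the first
`m` such numbers. -/
noncomputable def items (m g : ℕ) : List ℕ :=
  ((List.range m).filter fun q => δ.cell (q / δ.n) (q % δ.n) = g).reverse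

/-- The points in a cell. -/
noncomputable def pts (g : ℕ) : List ℕ := (δ.items ((δ.L + 1) * δ.n) g).map (· % δ.n)

/-- Each subcolumn and each subrow of the cell contains at most `J` points. -/
def Fine (g B : ℕ) : Prop := ∀ a < B, ((δ.pts g).countP fun p => δ.sx g B p = a) ≤ δ.J ∧
  ((δ.pts g).countP fun p => δ.sy g B p = a) ≤ δ.J

/-- The alternative `δ.L ≤ j` caps the division at `Q` parts, so that the search ends for every
input; more than `J` points with a common coordinate are never separated. -/
theorem exists_fine (g : ℕ) : ∃ j, δ.Fine g (2 ^ j) ∨ δ.L ≤ j := ⟨δ.L, Or.inr le_rfl⟩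

open Classical in
/-- The logarithm of the number of subcolumns of a cell. -/
noncomputable def ex (g : ℕ) : ℕ := Nat.find (δ.exists_fine g)

/-- The number of subcolumns of a cell. -/
noncomputable def B (g : ℕ) : ℕ := 2 ^ δ.ex g

/-- The cost of the data structure up to a constant factor. -/
noncomputable def cost : ℕ := (δ.D + 2) * δ.G + ∑ g ∈ Finset.range δ.G, δ.B g ^ 5

/-- The points lie in the open unit square, and there are at most as many as cells on a level. -/
structure Good : Prop where
  two_le : 2 ≤ δ.n
  le_Q : δ.n ≤ δ.Q
  pos : ∀ p < δ.n, 0 < δ.px p ∧ δ.px p < 1 ∧ 0 < δ.py p ∧ δ.py p < 1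

theorem Q_pos : 0 < δ.Q := by simp [Q]
theorem NC_pos : 0 < δ.NC := by have := δ.Q_pos; simp [NC]; omega
theorem NC_le_G : δ.NC ≤ δ.G := Nat.le_mul_of_pos_left _ (Nat.succ_pos _)
theorem Q_le_G : 4 * δ.Q ≤ δ.G := δ.NC_le_G
theorem cols_pos (g : ℕ) : 0 < δ.cols g := by simp [cols]
theorem rows_pos (g : ℕ) : 0 < δ.rows g := by simp [rows]
theorem B_pos (g : ℕ) : 0 < δ.B g := by simp [B]
theorem L_lt_Q : δ.L < δ.Q := Nat.lt_two_pow_self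
theorem le_cost : (δ.D + 2) * δ.G ≤ δ.cost := Nat.le_add_right _ _

theorem B_le_Q (g : ℕ) : δ.B g ≤ δ.Q := by
  classical
  exact Nat.pow_le_pow_right (by norm_num) (Nat.find_le (h := δ.exists_fine g) (Or.inr le_rfl))

theorem sub_lt {B : ℕ} (hB : 0 < B) (t : ℝ) : sub B t < B := by
  have := min_le_right ⌊t * B⌋₊ (B - 1)
  unfold sub; omega

theorem sub_mono (B : ℕ) : Monotone (sub B) := fun _ _ h =>
  min_le_min_right _ (Nat.floor_mono (mul_le_mul_of_nonneg_right h (Nat.cast_nonneg B)))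

variable {δ}

theorem lev_le {g : ℕ} (hg : g < δ.G) : δ.lev g ≤ δ.L :=
  Nat.lt_succ_iff.mp (Nat.div_lt_of_lt_mul (by rw [mul_comm]; exact hg))

theorem cols_mul_rows {g : ℕ} (hg : g < δ.G) : δ.cols g * δ.rows g = δ.Q := by
  rw [cols, rows, ← pow_add, Nat.add_sub_cancel' (lev_le hg), Q]

theorem floor_mul_lt {x : ℝ} (hx : x < 1) {m : ℕ} (hm : 0 < m) : ⌊x * m⌋₊ < m := by
  rw [Nat.floor_lt' hm.ne']
  have : (0 : ℝ) < m := by exact_mod_cast hm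
  nlinarith

theorem mem_items {m g q : ℕ} :
    q ∈ δ.items m g ↔ q < m ∧ δ.cell (q / δ.n) (q % δ.n) = g := by
  simp [items]

namespace Good

theorem cell_sub_lt (hδ : δ.Good) {i p : ℕ} (hi : i ≤ δ.L) (hp : p < δ.n) :
    ⌊δ.px p * (2 ^ i : ℕ)⌋₊ * 2 ^ (δ.L - i) + ⌊δ.py p * (2 ^ (δ.L - i) : ℕ)⌋₊ < δ.Q := by
  obtain ⟨-, h₁, -, h₂⟩ := hδ.pos p hp
  have h₃ := floor_mul_lt h₁ (m := 2 ^ i) (by positivity)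
  have h₄ := floor_mul_lt h₂ (m := 2 ^ (δ.L - i)) (by positivity)
  have h₅ : δ.Q = 2 ^ i * 2 ^ (δ.L - i) := by rw [Q, ← pow_add, Nat.add_sub_cancel' hi]
  rw [h₅]
  nlinarith

theorem lev_cell (hδ : δ.Good) {i p : ℕ} (hi : i ≤ δ.L) (hp : p < δ.n) : δ.lev (δ.cell i p) = i := by
  have h := hδ.cell_sub_lt hi hp
  rw [lev, cell, add_assoc, mul_comm, Nat.mul_add_div δ.NC_pos, Nat.div_eq_of_lt]
  · rfl
  · rw [NC]; omega

theorem cell_mod (hδ : δ.Good) {i p : ℕ} (hi : i ≤ δ.L) (hp : p < δ.n) : δ.cell i p % δ.NC =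
    ⌊δ.px p * (2 ^ i : ℕ)⌋₊ * 2 ^ (δ.L - i) + ⌊δ.py p * (2 ^ (δ.L - i) : ℕ)⌋₊ := by
  have h := hδ.cell_sub_lt hi hp
  rw [cell, add_assoc, mul_comm, Nat.mul_add_mod, Nat.mod_eq_of_lt]
  rw [NC]; omega

theorem cell_lt (hδ : δ.Good) {i p : ℕ} (hi : i ≤ δ.L) (hp : p < δ.n) : δ.cell i p < δ.G := by
  have h := hδ.cell_sub_lt hi hp
  have : i * δ.NC + δ.NC ≤ δ.G := by
    rw [G, ← Nat.succ_mul]; exact Nat.mul_le_mul_right _ (by omega)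
  have h2 : δ.Q ≤ δ.NC := by rw [NC]; omega
  rw [cell]; omega

theorem col_cell (hδ : δ.Good) {i p : ℕ} (hi : i ≤ δ.L) (hp : p < δ.n) :
    δ.col (δ.cell i p) = ⌊δ.px p * (2 ^ i : ℕ)⌋₊ := by
  rw [col, rows, hδ.lev_cell hi hp, hδ.cell_mod hi hp, mul_comm, Nat.mul_add_div (by positivity),
    Nat.div_eq_of_lt (floor_mul_lt (hδ.pos p hp).2.2.2 (by positivity)), add_zero]

theorem row_cell (hδ : δ.Good) {i p : ℕ} (hi : i ≤ δ.L) (hp : p < δ.n) :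
    δ.row (δ.cell i p) = ⌊δ.py p * (2 ^ (δ.L - i) : ℕ)⌋₊ := by
  rw [row, rows, hδ.lev_cell hi hp, hδ.cell_mod hi hp, mul_comm, Nat.mul_add_mod,
    Nat.mod_eq_of_lt (floor_mul_lt (hδ.pos p hp).2.2.2 (by positivity))]

theorem div_eq_lev (hδ : δ.Good) {g q : ℕ} (h : q ∈ δ.items ((δ.L + 1) * δ.n) g) : q / δ.n = δ.lev g := by
  have hn := hδ.two_le
  obtain ⟨h₁, rfl⟩ := mem_items.1 h
  rw [hδ.lev_cell _ (Nat.mod_lt _ (by omega))]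
  exact Nat.lt_succ_iff.mp (Nat.div_lt_of_lt_mul (by rwa [mul_comm]))

theorem mem_pts (hδ : δ.Good) {g p : ℕ} (hg : g < δ.G) :
    p ∈ δ.pts g ↔ p < δ.n ∧ δ.cell (δ.lev g) p = g := by
  have hn := hδ.two_le
  rw [pts, List.mem_map]
  constructor
  · rintro ⟨q, hq, rfl⟩
    rw [← hδ.div_eq_lev hq]
    exact ⟨Nat.mod_lt _ (by omega), (mem_items.1 hq).2⟩
  · rintro ⟨hp, hc⟩
    refine ⟨δ.lev g * δ.n + p, mem_items.2 ⟨?_, ?_⟩, ?_⟩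
    · have := lev_le hg
      calc _ < δ.lev g * δ.n + δ.n := by omega
        _ = (δ.lev g + 1) * δ.n := by ring
        _ ≤ _ := Nat.mul_le_mul_right _ (by omega)
    · rw [mul_comm, Nat.mul_add_div (by omega), Nat.div_eq_of_lt hp, Nat.mul_add_mod,
        Nat.mod_eq_of_lt hp, add_zero, hc]
    · rw [mul_comm, Nat.mul_add_mod, Nat.mod_eq_of_lt hp]

/-- A cell belongs to one level, so its pairs `i * n + p` share the quotient `i` and are determined
by the remainder `p`. -/
theorem nodup_pts (hδ : δ.Good) (g : ℕ) : (δ.pts g).Nodup := by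
  have h₁ : (δ.items ((δ.L + 1) * δ.n) g).Nodup :=
    List.nodup_reverse.2 (List.nodup_range.filter _)
  refine List.Nodup.map_on (fun q hq q' hq' h => ?_) h₁
  rw [← Nat.div_add_mod q δ.n, ← Nat.div_add_mod q' δ.n, hδ.div_eq_lev hq, hδ.div_eq_lev hq', h]

theorem length_pts_le (hδ : δ.Good) {g : ℕ} (hg : g < δ.G) : (δ.pts g).length ≤ δ.n := by
  rw [← List.toFinset_card_of_nodup (hδ.nodup_pts g), ← Finset.card_range δ.n]
  refine Finset.card_le_card fun p hp => ?_
  rw [List.mem_toFinset, hδ.mem_pts hg] at hp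
  exact Finset.mem_range.2 hp.1

end Good

theorem B_spec (δ : Dat) (g : ℕ) : δ.Fine g (δ.B g) ∨ δ.B g = δ.Q := by
  classical
  rcases Nat.find_spec (δ.exists_fine g) with h | h
  · exact Or.inl h
  · right
    exact congrArg (2 ^ ·) (le_antisymm (Nat.find_le (h := δ.exists_fine g) (Or.inr le_rfl)) h)

/-- If the division is fine, count the points by subcolumns; at the cap `B = Q ≥ n` the bound is
trivial. It follows that scanning the list once for each of the `B ^ 4` table entries costs `O(B ^
5)`. -/
theorem Good.length_pts_le_B (hδ : δ.Good) {g : ℕ} (hg : g < δ.G) :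
    (δ.pts g).length ≤ (δ.J + 1) * δ.B g := by
  rcases δ.B_spec g with h | h
  · have key : ∀ (l : List ℕ), l.length ≤
        ∑ a ∈ Finset.range (δ.B g), l.countP fun p => δ.sx g (δ.B g) p = a := by
      intro l
      induction l with
      | nil => simp
      | cons p l ih =>
        have : ∀ a, (p :: l).countP (fun p => δ.sx g (δ.B g) p = a) =
            l.countP (fun p => δ.sx g (δ.B g) p = a) + if δ.sx g (δ.B g) p = a then 1 else 0 := by
          intro a; rw [List.countP_cons]; simp
        simp only [this, Finset.sum_add_distrib, Finset.sum_ite_eq, Finset.mem_range,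
          List.length_cons]
        rw [if_pos (show δ.sx g (δ.B g) p < δ.B g from sub_lt (δ.B_pos g) _)]
        omega
    refine (key _).trans ((Finset.sum_le_card_nsmul _ _ δ.J fun a ha => (h a
      (Finset.mem_range.1 ha)).1).trans ?_)
    simp only [Finset.card_range, smul_eq_mul]
    nlinarith
  · have h₁ := hδ.length_pts_le hg
    have h₂ := hδ.le_Q
    rw [h]; nlinarith

end Dat


/-! ## Parameters and small tables -/

section Programs
open Cmd Var

/-- Compute the parameters; `K` is the factor in the bound for `D`. -/
def paramProg (K : ℕ) : Cmd :=
  asg Q 1 ;; asg L 0 ;; wh ⇡Q ⇡n (asg Q (2 * ⇡Q) ;; asg L (⇡L + 1)) ;;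
  asg w 1 ;; asg D 0 ;; wh ⇡w (.lit K * ⇡L) (asg w (2 * ⇡w) ;; asg D (⇡D + 1)) ;;
  asg NC (4 * ⇡Q) ;; asg G ((⇡L + 1) * ⇡NC) ;;
  st .par 0 ⇡Q ;; st .par 1 ⇡L ;; st .par 2 ⇡D

/-- Tabulate the powers of two and the binary logarithm. -/
def smallTabProg : Cmd :=
  asg w 1 ;; asg i 0 ;; wh ⇡i (⇡L + 1) (st .pw ⇡i ⇡w ;; asg w (2 * ⇡w) ;; asg i (⇡i + 1)) ;;
  asg m 2 ;; wh ⇡m (⇡Q + 1)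
    (flr e (⇡m / 2) ;; ld e .lg ⇡e ;; st .lg ⇡m (⇡e + 1) ;; asg m (⇡m + 1))

end Programs

namespace Dat

variable (δ : Dat)

/-- The variables that hold the parameters. -/
structure Ctx (s : AS) : Prop where
  n : s.v .n = δ.n
  Q : s.v .Q = δ.Q
  L : s.v .L = δ.L
  D : s.v .D = δ.D
  NC : s.v .NC = δ.NC
  G : s.v .G = δ.G

/-- The small tables. -/
structure Small (s : AS) : Prop where
  par0 : s.a .par 0 = δ.Q
  par1 : s.a .par 1 = δ.L
  par2 : s.a .par 2 = δ.D
  pw : ∀ k ≤ δ.L, s.a .pw k = 2 ^ k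
  lg : ∀ m ≤ δ.Q, s.a .lg m = Nat.log 2 m

/-- Indices and words are large enough for the data structure. -/
structure Fits (z : Cfg) : Prop where
  X : z.X = δ.X
  I : (δ.N + 1) * δ.cost ≤ z.I
  W : 9 * z.I ≤ z.W

variable {δ}

theorem Fits.DG {z : Cfg} (h : δ.Fits z) : (δ.D + 2) * δ.G ≤ z.I :=
  (δ.le_cost.trans (Nat.le_mul_of_pos_left _ (Nat.succ_pos _))).trans h.I

theorem Fits.G {z : Cfg} (h : δ.Fits z) : 2 * δ.G ≤ z.I :=
  (Nat.mul_le_mul_right _ (by omega)).trans h.DG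

theorem Fits.I_le {z : Cfg} (h : δ.Fits z) : z.I ≤ z.W := by have := h.W; omega

theorem Fits.D {z : Cfg} (h : δ.Fits z) : δ.D < z.I := by
  have := h.DG
  have h2 := δ.Q_le_G
  have h3 := δ.Q_pos
  nlinarith

theorem paramProg_spec {z : Cfg} (hz : δ.Fits z) (hδ : δ.Good) {K : ℕ} (hL : δ.L = Nat.clog 2 δ.n)
    (hD : δ.D = Nat.clog 2 (K * δ.L)) {s : AS} (hn : s.v .n = δ.n) :
    Wp z (paramProg K) s fun s' => δ.Ctx s' ∧ s'.a .par 0 = δ.Q ∧ s'.a .par 1 = δ.L ∧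
      s'.a .par 2 = δ.D ∧ s'.clk ≤ s.clk + 3 * δ.L + 3 * δ.D + 11 := by
  have hG := hz.G
  have hQG := δ.Q_le_G
  have hQ := δ.Q_pos
  have hIW := hz.I_le
  have hLQ := δ.L_lt_Q
  have hDI := hz.D
  unfold paramProg
  refine .seq (.asg 1 (by simp) (.seq (.asg 0 (by simp) (.seq ?_))))
  refine .wh δ.L (fun k s' => s'.v .Q = (2 ^ k : ℕ) ∧ s'.v .L = k ∧ s'.clk = s.clk + 2 + 3 * k)
    (by simp) ?_ ?_
  · rintro k hk s' hf ⟨h₁, h₂, h₃⟩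
    have hn' : s'.v .n = δ.n := by rw [hf.1 _ rfl]; simp [hn]
    refine ⟨?_, ?_⟩
    · simp only [Ex.val_var, h₁, hn', Nat.cast_lt]
      exact (Nat.lt_clog_iff_pow_lt (by norm_num)).1 (hL ▸ hk)
    · refine .seq (.asg (2 ^ (k + 1) : ℕ) (by simp [h₁, pow_succ, mul_comm]) (.asg (k + 1 : ℕ)
        (by simp [h₂]) ?_))
      simp [h₃]; ring
  rintro s₁ hf₁ ⟨h₁, h₂, h₃⟩
  have hn₁ : s₁.v .n = δ.n := by rw [hf₁.1 _ rfl]; simp [hn]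
  refine ⟨?_, ?_⟩
  · simp only [Ex.val_var, h₁, hn₁, Nat.cast_lt, not_lt]
    exact hδ.le_Q
  refine .seq (.asg 1 (by simp) (.seq (.asg 0 (by simp) (.seq ?_))))
  refine .wh δ.D (fun k s' => s'.v .w = (2 ^ k : ℕ) ∧ s'.v .D = k ∧ s'.clk = s₁.clk + 3 + 3 * k)
    (by simp) ?_ ?_
  · rintro k hk s' hf ⟨h₄, h₅, h₆⟩
    have hL' : s'.v .L = δ.L := by rw [hf.1 _ rfl]; simp [h₂]
    refine ⟨?_, ?_⟩
    · simp only [Ex.val_var, Ex.val_mul, Ex.val_lit, h₄, hL']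
      exact_mod_cast (Nat.lt_clog_iff_pow_lt (by norm_num)).1 (hD ▸ hk)
    · refine .seq (.asg (2 ^ (k + 1) : ℕ) (by simp [h₄, pow_succ, mul_comm]) (.asg (k + 1 : ℕ)
        (by simp [h₅]) ?_))
      simp [h₆]; ring
  rintro s₂ hf₂ ⟨h₄, h₅, h₆⟩
  have hL₂ : s₂.v .L = δ.L := by rw [hf₂.1 _ rfl]; simp [h₂]
  have hn₂ : s₂.v .n = δ.n := by rw [hf₂.1 _ rfl]; simp [hn₁]
  have hQ₂ : s₂.v .Q = δ.Q := by rw [hf₂.1 _ rfl]; simp [h₁, Dat.Q]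
  refine ⟨?_, ?_⟩
  · simp only [Ex.val_var, Ex.val_mul, Ex.val_lit, h₄, hL₂, not_lt]
    have : K * δ.L ≤ 2 ^ δ.D := hD ▸ Nat.le_pow_clog (by norm_num) _
    exact_mod_cast this
  refine .seq (.asg δ.NC (by simp [hQ₂, Dat.NC]) (.seq (.asg δ.G (by simp [hL₂, Dat.G])
    (.seq (.st 0 δ.Q (by simp) (by simp [hQ₂]) (by omega) (by omega)
    (.seq (.st 1 δ.L (by simp) (by simp [hL₂]) (by omega) (by omega)
    (.st 2 δ.D (by simp) (by simp [h₅]) (by omega) (by omega) ?_))))))))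
  refine ⟨⟨by simp [hn₂], by simp [hQ₂], by simp [hL₂], by simp [h₅], by simp, by simp⟩, ?_, ?_,
    ?_, ?_⟩
  · simp
  · simp
  · simp
  · simp [h₆, h₃]; omega

theorem Ctx.frame {c : Cmd} {s s' : AS} (h : δ.Ctx s) (hf : Frame c s s')
    (hc : ([.n, .Q, .L, .D, .NC, .G] : List Var).all (fun u => !c.writesVar u) = true) :
    δ.Ctx s' := by
  simp only [List.all_cons, List.all_nil, Bool.and_true, Bool.and_eq_true,
    Bool.not_eq_true'] at hc
  obtain ⟨h₁, h₂, h₃, h₄, h₅, h₆⟩ := hc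
  exact ⟨by rw [hf.1 _ h₁, h.n], by rw [hf.1 _ h₂, h.Q], by rw [hf.1 _ h₃, h.L],
    by rw [hf.1 _ h₄, h.D], by rw [hf.1 _ h₅, h.NC], by rw [hf.1 _ h₆, h.G]⟩

theorem Small.frame {c : Cmd} {s s' : AS} (h : δ.Small s) (hf : Frame c s s')
    (hc : ([.par, .pw, .lg] : List Arr).all (fun u => !c.writesArr u) = true) : δ.Small s' := by
  simp only [List.all_cons, List.all_nil, Bool.and_true, Bool.and_eq_true,
    Bool.not_eq_true'] at hc
  obtain ⟨h₁, h₂, h₃⟩ := hc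
  exact ⟨by rw [hf.2 _ h₁, h.par0], by rw [hf.2 _ h₁, h.par1], by rw [hf.2 _ h₁, h.par2],
    by rw [hf.2 _ h₂]; exact h.pw, by rw [hf.2 _ h₃]; exact h.lg⟩

theorem smallTabProg_spec {z : Cfg} (hz : δ.Fits z) {s : AS} (hc : δ.Ctx s)
    (hlg : ∀ m, s.a .lg m = 0) :
    Wp z smallTabProg s fun s' => (∀ k ≤ δ.L, s'.a .pw k = 2 ^ k) ∧
      (∀ m ≤ δ.Q, s'.a .lg m = Nat.log 2 m) ∧ s'.clk ≤ s.clk + 9 * δ.Q + 5 := by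
  have hG := hz.G
  have hQG := δ.Q_le_G
  have hQ := δ.Q_pos
  have hIW := hz.I_le
  have hLQ := δ.L_lt_Q
  refine .seq (.asg 1 (by simp) (.seq (.asg 0 (by simp) (.seq ?_))))
  refine .wh (δ.L + 1) (fun k s' => s'.v .i = k ∧ s'.v .w = (2 ^ k : ℕ) ∧
    (∀ j < k, s'.a .pw j = 2 ^ j) ∧ s'.clk = s.clk + 2 + 4 * k) (by simp) ?_ ?_
  · rintro k hk s' hf ⟨h₁, h₂, h₃, h₄⟩
    have hL' : s'.v .L = δ.L := by rw [hf.1 _ rfl]; simp [hc.L]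
    refine ⟨?_, ?_⟩
    · simp only [Ex.val_var, Ex.val_add, Ex.val_one, h₁, hL']
      exact_mod_cast hk
    · have : 2 ^ k ≤ δ.Q := Nat.pow_le_pow_right (by norm_num) (by omega)
      refine .seq (.st k (2 ^ k) (by simp [h₁]) (by simp [h₂]) (by omega) (by omega)
        (.seq (.asg (2 ^ (k + 1) : ℕ) (by simp [h₂, pow_succ, mul_comm])
        (.asg (k + 1 : ℕ) (by simp [h₁]) ?_))))
      refine ⟨by simp, by simp, fun j hj => ?_, by simp [h₄]; ring⟩
      simp only [AS.setv_a, AS.seta_a, if_true, AS.tick_a]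
      rcases Nat.lt_succ_iff_lt_or_eq.1 hj with h | rfl
      · rw [Function.update_of_ne h.ne, h₃ j h]
      · simp
  rintro s₁ hf₁ ⟨h₁, h₂, h₃, h₄⟩
  have hL₁ : s₁.v .L = δ.L := by rw [hf₁.1 _ rfl]; simp [hc.L]
  have hQ₁ : s₁.v .Q = δ.Q := by rw [hf₁.1 _ rfl]; simp [hc.Q]
  have hlg₁ : ∀ m, s₁.a .lg m = 0 := by rw [hf₁.2 _ rfl]; exact hlg
  refine ⟨by simp [h₁, hL₁], ?_⟩
  refine .seq (.asg 2 (by simp) ?_)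
  -- The logarithms of `0` and `1` are both `0` by convention, which is what fresh memory holds; the
  -- loop therefore starts at `2` and makes `Q - 1` rounds.
  refine .wh (δ.Q - 1) (fun k s' => s'.v .m = (k + 2 : ℕ) ∧
    (∀ j, j < k + 2 → s'.a .lg j = Nat.log 2 j) ∧ s'.clk = s₁.clk + 2 + 5 * k) ?_ ?_ ?_
  · refine ⟨by simp, fun j hj => ?_, by simp⟩
    simp only [AS.setv_a, AS.tick_a, hlg₁]
    interval_cases j <;> simp
  · rintro k hk s' hf ⟨h₅, h₆, h₇⟩
    have hQ' : s'.v .Q = δ.Q := by rw [hf.1 _ rfl]; simp [hQ₁]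
    refine ⟨?_, ?_⟩
    · simp only [Ex.val_var, Ex.val_add, Ex.val_one, h₅, hQ']
      have : k + 2 < δ.Q + 1 := by omega
      exact_mod_cast this
    · have hlog : Nat.log 2 (k + 2) ≤ k + 2 := Nat.log_le_self _ _
      have hlog2 : Nat.log 2 ((k + 2) / 2) + 1 = Nat.log 2 (k + 2) :=
        (Nat.log_of_one_lt_of_le (by norm_num) (by omega)).symm
      refine .seq (.flr ((k + 2) / 2) (by simp [h₅]; positivity) ?_ (by omega)
        (.seq (.ld ((k + 2) / 2) (Nat.log 2 ((k + 2) / 2)) (by simp) (by omega) ?_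
        (.seq (.st (k + 2) (Nat.log 2 (k + 2)) (by simp [h₅]) ?_ (by omega) (by omega)
        (.asg (k + 1 + 2 : ℕ) (by simp [h₅]; ring) ?_))))))
      · simp only [Ex.val_var, Ex.val_div, Ex.val_ofNat, AS.tick_v, h₅]
        exact_mod_cast Nat.floor_div_eq_div (K := ℝ) (k + 2) 2
      · simp only [AS.setv_a, AS.tick_a]
        exact h₆ _ (by omega)
      · simp only [Ex.val_var, Ex.val_add, Ex.val_one, AS.setv_v, if_true]
        exact_mod_cast hlog2
      · refine ⟨by simp, fun j hj => ?_, by simp [h₇]; ring⟩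
        simp only [AS.setv_a, AS.seta_a, if_true, AS.tick_a]
        rcases Nat.lt_succ_iff_lt_or_eq.1 (show j < k + 2 + 1 by omega) with h | rfl
        · rw [Function.update_of_ne h.ne, h₆ j h]
        · simp
  · rintro s₂ hf₂ ⟨h₅, h₆, h₇⟩
    have hQ' : s₂.v .Q = δ.Q := by rw [hf₂.1 _ rfl]; simp [hQ₁]
    refine ⟨?_, ?_, ?_, ?_⟩
    · simp only [Ex.val_var, Ex.val_add, Ex.val_one, h₅, hQ', not_lt]
      have : δ.Q + 1 ≤ δ.Q - 1 + 2 := by omega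
      exact_mod_cast this
    · intro k hk
      rw [AS.tick_a, hf₂.2 _ rfl]
      simp only [AS.setv_a, AS.tick_a]
      exact h₃ k (by omega)
    · intro m hm
      exact h₆ m (by omega)
    · simp [h₇, h₄]; omega

end Dat


/-! ## Distributing the points to the cells -/

section Programs
open Cmd Var

/-- Build the linked lists of the points of each cell. -/
def listProg : Cmd :=
  asg t 0 ;; wh ⇡t ((⇡L + 1) * ⇡n)
    (flr i (⇡t / ⇡n) ;; asg p (⇡t - ⇡i * ⇡n) ;; ld A .pw ⇡i ;; ld R .pw (⇡L - ⇡i) ;;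
      pt px (2 * ⇡p) ;; pt py (2 * ⇡p + 1) ;; flr c (⇡px * ⇡A) ;; flr r (⇡py * ⇡R) ;;
      asg g (⇡i * ⇡NC + ⇡c * ⇡R + ⇡r) ;; ld h .head ⇡g ;; st .nxt ⇡t ⇡h ;;
      st .head ⇡g (⇡t + 1) ;; asg t (⇡t + 1))

end Programs

/-- The language has no remainder operation; its programs compute remainders from rounded quotients
by this identity. -/
theorem cast_sub_div_mul (a b : ℕ) : (a : ℝ) - ((a / b : ℕ) : ℝ) * b = ((a % b : ℕ) : ℝ) := by
  rw [sub_eq_iff_eq_add]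
  exact_mod_cast (Nat.mod_add_div' a b).symm

namespace Dat

variable {δ : Dat}

theorem items_succ (m g : ℕ) : δ.items (m + 1) g =
    if δ.cell (m / δ.n) (m % δ.n) = g then m :: δ.items m g else δ.items m g := by
  unfold items
  rw [List.range_succ, List.filter_append, List.reverse_append]
  by_cases h : δ.cell (m / δ.n) (m % δ.n) = g <;> simp [h]

theorem listProg_spec {z : Cfg} (hz : δ.Fits z) (hδ : δ.Good) {s : AS} (hc : δ.Ctx s)
    (hs : δ.Small s) (hh : ∀ g, s.a .head g = 0) :
    Wp z listProg s fun s' =>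
      (∀ g, Chain (s'.a .nxt) (s'.a .head g) (δ.items ((δ.L + 1) * δ.n) g)) ∧
      s'.clk ≤ s.clk + 14 * ((δ.L + 1) * δ.n) + 2 := by
  have hG := hz.G
  have hQG := δ.Q_le_G
  have hQ := δ.Q_pos
  have hIW := hz.I_le
  have hLQ := δ.L_lt_Q
  have hn2 := hδ.two_le
  have hnQ := hδ.le_Q
  have hnG : (δ.L + 1) * δ.n ≤ δ.G :=
    Nat.mul_le_mul_left _ (hnQ.trans (Nat.le_mul_of_pos_left _ (by norm_num)))
  refine .seq (.asg 0 (by simp) ?_)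
  refine .wh ((δ.L + 1) * δ.n) (fun k s' => s'.v .t = k ∧
    (∀ g, Chain (s'.a .nxt) (s'.a .head g) (δ.items k g)) ∧ s'.clk = s.clk + 1 + 14 * k) ?_ ?_ ?_
  · refine ⟨by simp, fun g => ?_, by simp⟩
    simp [items, Chain, hh]
  · rintro k hk s' hf ⟨h₁, h₂, h₃⟩
    have hc' : δ.Ctx s' := Ctx.frame (s := s.setv .t 0)
      ⟨by simp [hc.n], by simp [hc.Q], by simp [hc.L], by simp [hc.D], by simp [hc.NC],
        by simp [hc.G]⟩ hf rfl
    have hpw : ∀ j ≤ δ.L, s'.a .pw j = 2 ^ j := by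
      rw [hf.2 _ rfl]; exact hs.pw
    refine ⟨?_, ?_⟩
    · simp only [Ex.val_var, Ex.val_add, Ex.val_one, Ex.val_mul, h₁, hc'.L, hc'.n]
      exact_mod_cast hk
    have hi : k / δ.n ≤ δ.L := Nat.lt_succ_iff.mp (Nat.div_lt_of_lt_mul (by rwa [mul_comm]))
    have hp : k % δ.n < δ.n := Nat.mod_lt _ (by omega)
    obtain ⟨hp₁, hp₂, hp₃, hp₄⟩ := hδ.pos _ hp
    have hcell := hδ.cell_lt hi hp
    have hA : 2 ^ (k / δ.n) ≤ δ.Q := Nat.pow_le_pow_right (by norm_num) hi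
    have hLi : δ.L - k / δ.n ≤ δ.L := Nat.sub_le _ _
    have hR : 2 ^ (δ.L - k / δ.n) ≤ δ.Q := Nat.pow_le_pow_right (by norm_num) hLi
    have hcb := floor_mul_lt hp₂ (m := 2 ^ (k / δ.n)) (by positivity)
    have hrb := floor_mul_lt hp₄ (m := 2 ^ (δ.L - k / δ.n)) (by positivity)
    -- The head of a list is `0` or `q + 1` for a pair `q < k` inserted earlier, so it is small
    -- enough for a word.
    have hhb : s'.a .head (δ.cell (k / δ.n) (k % δ.n)) < z.W := by
      have := h₂ (δ.cell (k / δ.n) (k % δ.n))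
      rcases hl : δ.items k (δ.cell (k / δ.n) (k % δ.n)) with _ | ⟨q, l⟩
      · rw [hl] at this
        simp only [Chain] at this
        omega
      · rw [hl] at this
        have hq : q ∈ δ.items k (δ.cell (k / δ.n) (k % δ.n)) := by rw [hl]; simp
        rw [mem_items] at hq
        have := this.1
        omega
    refine .seq (.flr (k / δ.n) (by simp [h₁, hc'.n]; positivity) ?_ (by omega) ?_)
    · simp only [Ex.val_var, Ex.val_div, AS.tick_v, h₁, hc'.n]
      exact Nat.floor_div_eq_div (K := ℝ) _ _
    refine .seq (.asg (k % δ.n : ℕ) ?_ ?_)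
    · simpa [h₁, hc'.n] using cast_sub_div_mul k δ.n
    refine .seq (.ld (k / δ.n) (2 ^ (k / δ.n)) (by simp) (by omega) (hpw _ hi) ?_)
    refine .seq (.ld (δ.L - k / δ.n) (2 ^ (δ.L - k / δ.n)) (by simp [hc'.L, Nat.cast_sub hi])
      (by omega) (hpw _ hLi) ?_)
    refine .seq (.pt (2 * (k % δ.n)) (by simp) (by omega) ?_)
    refine .seq (.pt (2 * (k % δ.n) + 1) (by simp) (by omega) ?_)
    have e₁ : z.X (2 * (k % δ.n)) = δ.px (k % δ.n) := by rw [hz.X]; rfl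
    have e₂ : z.X (2 * (k % δ.n) + 1) = δ.py (k % δ.n) := by rw [hz.X]; rfl
    rw [e₁, e₂]
    refine .seq (.flr ⌊δ.px (k % δ.n) * (2 ^ (k / δ.n) : ℕ)⌋₊ ?_ (by simp) (by omega) ?_)
    · simp; positivity
    refine .seq (.flr ⌊δ.py (k % δ.n) * (2 ^ (δ.L - k / δ.n) : ℕ)⌋₊ ?_ (by simp) (by omega) ?_)
    · simp; positivity
    refine .seq (.asg (δ.cell (k / δ.n) (k % δ.n)) (by simp [hc'.NC, cell]) ?_)
    refine .seq (.ld _ _ (by simp; rfl) (by omega) rfl ?_)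
    refine .seq (.st k (s'.a .head (δ.cell (k / δ.n) (k % δ.n))) (by simp [h₁]) (by simp)
      (by omega) hhb ?_)
    refine .seq (.st (δ.cell (k / δ.n) (k % δ.n)) (k + 1) (by simp) (by simp [h₁]) (by omega)
      (by omega) ?_)
    refine .asg (k + 1 : ℕ) (by simp [h₁]) ⟨by simp, fun g => ?_, by simp [h₃]; ring⟩
    have hk' : k ∉ δ.items k g := by simp [mem_items]
    simp only [AS.setv_a, AS.seta_a, AS.tick_a, if_true, reduceCtorEq, if_false, items_succ]
    split_ifs with hg
    · rw [hg, Function.update_self]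
      refine ⟨rfl, ?_⟩
      rw [Function.update_self]
      exact (h₂ g).update hk'
    · rw [Function.update_of_ne (Ne.symm hg)]
      exact (h₂ g).update hk'
  · rintro s' hf ⟨h₁, h₂, h₃⟩
    have hc' : δ.Ctx s' := Ctx.frame (s := s.setv .t 0)
      ⟨by simp [hc.n], by simp [hc.Q], by simp [hc.L], by simp [hc.D], by simp [hc.NC],
        by simp [hc.G]⟩ hf rfl
    refine ⟨?_, h₂, by simp [h₃]; omega⟩
    simp [h₁, hc'.L, hc'.n]

end Dat


/-! ## The tables of the cells -/

section Programs
open Cmd Var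

/-- Compute `Dat.sub B` of the value of an expression. -/
def subProg (u : Var) (t : Ex) : Cmd :=
  asg u (t * ⇡B) ;; ite ⇡u 0 (asg u 0) (ite ⇡u ⇡B (flr u ⇡u) (asg u (⇡B - 1)))

/-- Read the point of the current list entry. -/
def fetchProg : Cmd :=
  asg p (⇡h - 1 - ⇡i * ⇡n) ;; pt px (2 * ⇡p) ;; pt py (2 * ⇡p + 1) ;;
  subProg sx (⇡px * ⇡A - ⇡c) ;; subProg sy (⇡py * ⇡R - ⇡r)

/-- Execute `q` if two expressions have the same value. -/
def ifEq (t t' : Ex) (q : Cmd) : Cmd := ite t t' skip (ite t' t skip q)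

/-- Count the points of the subcolumn and of the subrow with number `a`. -/
def countProg : Cmd :=
  asg kx 0 ;; asg ky 0 ;; forList (fetchProg ;; ifEq ⇡sx ⇡a (asg kx (⇡kx + 1)) ;;
    ifEq ⇡sy ⇡a (asg ky (⇡ky + 1)))

/-- Decide whether `B` has to be increased. -/
def checkProg (J : ℕ) : Cmd :=
  asg f 0 ;; ite ⇡B ⇡Q (asg a 0 ;; wh ⇡a ⇡B (countProg ;;
    ite (.lit J) ⇡kx (asg f 1) skip ;; ite (.lit J) ⇡ky (asg f 1) skip ;; asg a (⇡a + 1))) skip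

/-- Determine `B`. -/
def searchProg (J : ℕ) : Cmd :=
  asg B 1 ;; asg f 1 ;; wh 0 ⇡f (checkProg J ;; ite 0 ⇡f (asg B (2 * ⇡B)) skip)

end Programs

namespace Dat

variable (δ : Dat)

/-- The variables that describe the cell `g`, divided into `B × B` subcells. -/
structure CellCtx (g B : ℕ) (s : AS) : Prop where
  n : s.v .n = δ.n
  Q : s.v .Q = δ.Q
  i : s.v .i = δ.lev g
  A : s.v .A = δ.cols g
  R : s.v .R = δ.rows g
  c : s.v .c = δ.col g
  r : s.v .r = δ.row g
  B : s.v .B = B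
  h0 : ∃ h : ℕ, s.v .h0 = h ∧ Chain (s.a .nxt) h (δ.items ((δ.L + 1) * δ.n) g)

variable {δ}

theorem CellCtx.frame {g B : ℕ} {c : Cmd} {s s' : AS} (h : δ.CellCtx g B s) (hf : Frame c s s')
    (hc : ([.n, .Q, .i, .A, .R, .c, .r, .B, .h0] : List Var).all
      (fun u => !c.writesVar u) = true) (hc' : c.writesArr .nxt = false) : δ.CellCtx g B s' := by
  simp only [List.all_cons, List.all_nil, Bool.and_true, Bool.and_eq_true,
    Bool.not_eq_true'] at hc
  obtain ⟨h₁, h₂, h₃, h₄, h₅, h₆, h₇, h₈, h₉⟩ := hc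
  exact ⟨by rw [hf.1 _ h₁, h.n], by rw [hf.1 _ h₂, h.Q], by rw [hf.1 _ h₃, h.i],
    by rw [hf.1 _ h₄, h.A], by rw [hf.1 _ h₅, h.R], by rw [hf.1 _ h₆, h.c],
    by rw [hf.1 _ h₇, h.r], by rw [hf.1 _ h₈, h.B], by rw [hf.1 _ h₉, hf.2 _ hc']; exact h.h0⟩

/-- A side of the rectangle may miss the cell, so `t` is an arbitrary real. The value is clamped
before it is rounded, because the floor instruction fails on negative arguments and on results that
are not words. -/
theorem subProg_spec {z : Cfg} {u : Var} {e : Ex} {s : AS} {B : ℕ} {t : ℝ} (hB : s.v .B = B)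
    (hB0 : 0 < B) (hBW : B ≤ z.W) (hu : u ≠ .B) (he : e.val s.v = t) :
    Wp z (subProg u e) s fun s' => s'.v u = sub B t ∧ s'.clk ≤ s.clk + 4 := by
  refine .seq (.asg (t * B) (by simp [he, hB]) ?_)
  refine .ite (fun h => ?_) fun h => .ite (fun h' => ?_) fun h' => ?_
  · simp only [Ex.val_var, AS.setv_v, if_true, Ex.val_zero] at h
    refine .asg 0 (by simp) ⟨?_, by simp⟩
    simp [sub, Nat.floor_of_nonpos h.le]
  · simp only [Ex.val_var, AS.setv_v, if_true, Ex.val_zero, not_lt] at h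
    simp only [Ex.val_var, AS.tick_v, AS.setv_v, if_true, hu.symm, if_false, hB] at h'
    have hlt : ⌊t * B⌋₊ < B := (Nat.floor_lt h).2 h'
    refine .flr ⌊t * B⌋₊ (by simpa using h) (by simp) (by omega) ⟨?_, by simp⟩
    simp only [AS.setv_v, if_true, sub]
    rw [min_eq_left (by omega)]
  · simp only [Ex.val_var, AS.tick_v, AS.setv_v, if_true, hu.symm, if_false, hB, not_lt] at h'
    refine .asg (B - 1 : ℕ) (by simp [hu.symm, hB, Nat.cast_sub (show 1 ≤ B from hB0)])
      ⟨?_, by simp⟩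
    simp only [AS.setv_v, if_true, sub]
    rw [min_eq_right]
    have := Nat.le_floor h'
    omega

theorem fetchProg_spec {z : Cfg} (hz : δ.Fits z) (hδ : δ.Good) {g B q : ℕ} {s : AS}
    (hc : δ.CellCtx g B s) (hB : 0 < B) (hBQ : B ≤ δ.Q)
    (hq : q ∈ δ.items ((δ.L + 1) * δ.n) g) (hh : s.v .h = (q + 1 : ℕ)) :
    Wp z fetchProg s fun s' => s'.v .p = (q % δ.n : ℕ) ∧ s'.v .sx = δ.sx g B (q % δ.n) ∧
      s'.v .sy = δ.sy g B (q % δ.n) ∧ s'.clk ≤ s.clk + 11 := by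
  have hG := hz.G
  have hQG := δ.Q_le_G
  have hIW := hz.I_le
  have hn2 := hδ.two_le
  have hnQ := hδ.le_Q
  have hp : q % δ.n < δ.n := Nat.mod_lt _ (by omega)
  refine .seq (.asg (q % δ.n : ℕ) ?_ ?_)
  · rw [← cast_sub_div_mul, hδ.div_eq_lev hq]
    simp [hh, hc.i, hc.n]
  refine .seq (.pt (2 * (q % δ.n)) (by simp) (by omega) ?_)
  refine .seq (.pt (2 * (q % δ.n) + 1) (by simp) (by omega) ?_)
  have e₁ : z.X (2 * (q % δ.n)) = δ.px (q % δ.n) := by rw [hz.X]; rfl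
  have e₂ : z.X (2 * (q % δ.n) + 1) = δ.py (q % δ.n) := by rw [hz.X]; rfl
  rw [e₁, e₂]
  refine .seq (.use (subProg_spec (B := B) (t := δ.px (q % δ.n) * δ.cols g - δ.col g)
    (by simp [hc.B]) hB (by omega) (by simp) (by simp [hc.A, hc.c])) ?_)
  rintro s₁ ⟨h₁, h₂⟩ hf₁
  have hv : ∀ u, u ≠ .sx → s₁.v u = _ := fun u hu => hf₁.1 u (by
    simp [subProg, Cmd.writesVar, hu.symm])
  refine .use (subProg_spec (B := B) (t := δ.py (q % δ.n) * δ.rows g - δ.row g)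
    (by simp [hv, hc.B]) hB (by omega) (by simp) (by simp [hv, hc.R, hc.r])) ?_
  rintro s₂ ⟨h₃, h₄⟩ hf₂
  refine ⟨?_, ?_, h₃, ?_⟩
  · rw [hf₂.1 _ rfl, hf₁.1 _ rfl]; simp
  · rw [hf₂.1 _ rfl, h₁]; rfl
  · simp at h₂; omega

theorem items_lt_I {z : Cfg} (hz : δ.Fits z) (hδ : δ.Good) {g : ℕ} :
    ∀ q ∈ δ.items ((δ.L + 1) * δ.n) g, q < z.I := by
  intro q hq
  have hnG : (δ.L + 1) * δ.n ≤ δ.G :=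
    Nat.mul_le_mul_left _ (hδ.le_Q.trans (Nat.le_mul_of_pos_left _ (by norm_num)))
  have := (mem_items.1 hq).1
  have := hz.G
  omega

theorem getElem_pts {g k : ℕ} (hk : k < (δ.pts g).length)
    (hk' : k < (δ.items ((δ.L + 1) * δ.n) g).length) :
    (δ.pts g)[k] = (δ.items ((δ.L + 1) * δ.n) g)[k] % δ.n := by
  simp [pts]

theorem length_pts (g : ℕ) : (δ.pts g).length = (δ.items ((δ.L + 1) * δ.n) g).length := by
  simp [pts]

/-- Equality is tested by two strict comparisons. If it fails, this may be found out by the first or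
by the second, whence the two possible clock values. -/
theorem ifEq_spec {z : Cfg} {e e' : Ex} {q : Cmd} {s : AS} {Q : AS → Prop}
    (h : e.val s.v = e'.val s.v → Wp z q s.tick.tick Q)
    (h₁ : e.val s.v ≠ e'.val s.v → Q s.tick.tick ∧ Q s.tick.tick.tick) :
    Wp z (ifEq e e' q) s Q := by
  refine .ite (fun h' => .skip (h₁ h'.ne).1) fun h' => .ite (fun h'' => .skip ?_) fun h'' => ?_
  · exact (h₁ (by simpa using h''.ne')).2
  · exact h (le_antisymm (not_lt.1 (by simpa using h'')) (not_lt.1 h'))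

theorem countP_take_succ (l : List ℕ) (f : ℕ → Bool) {k : ℕ} (hk : k < l.length) :
    (l.take (k + 1)).countP f = (l.take k).countP f + if f l[k] then 1 else 0 := by
  rw [List.take_succ_eq_append_getElem hk, List.countP_append]
  simp [List.countP_cons]

theorem countProg_spec {z : Cfg} (hz : δ.Fits z) (hδ : δ.Good) {g B a : ℕ} {s : AS}
    (hc : δ.CellCtx g B s) (hB : 0 < B) (hBQ : B ≤ δ.Q) (ha : s.v .a = a) :
    Wp z countProg s fun s' =>
      s'.v .kx = ((δ.pts g).countP fun p => δ.sx g B p = a : ℕ) ∧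
      s'.v .ky = ((δ.pts g).countP fun p => δ.sy g B p = a : ℕ) ∧
      s'.clk ≤ s.clk + 4 + 19 * (δ.pts g).length := by
  obtain ⟨h, hh, hl⟩ := hc.h0
  refine .seq (.asg 0 (by simp) (.seq (.asg 0 (by simp) ?_)))
  refine .forList _ h hl (by simp [hh]) rfl rfl (items_lt_I hz hδ) (fun k s' =>
    s'.v .kx = (((δ.pts g).take k).countP fun p => δ.sx g B p = a : ℕ) ∧
    s'.v .ky = (((δ.pts g).take k).countP fun p => δ.sy g B p = a : ℕ) ∧
    s'.clk ≤ s.clk + 3 + 19 * k) (by simp) ?_ ?_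
  · rintro k hk s' hf ⟨h₁, h₂, h₃⟩ h₄
    have hk' : k < (δ.pts g).length := by rwa [length_pts]
    have hc' : δ.CellCtx g B s'.tick := by
      refine CellCtx.frame (s := (s.setv .kx 0).setv .ky 0) ⟨by simp [hc.n], by simp [hc.Q],
        by simp [hc.i], by simp [hc.A], by simp [hc.R], by simp [hc.c], by simp [hc.r],
        by simp [hc.B], by simpa using hc.h0⟩ hf.tick rfl rfl
    have ha' : s'.v .a = a := by rw [hf.1 _ rfl]; simp [ha]
    refine .seq (.use (fetchProg_spec hz hδ hc' hB hBQ (List.getElem_mem hk) h₄) ?_)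
    rintro s₁ ⟨-, h₅, h₆, h₇⟩ hf₁
    have hkx : s₁.v .kx = _ := hf₁.1 _ rfl
    have hky : s₁.v .ky = _ := hf₁.1 _ rfl
    have ha₁ : s₁.v .a = a := by rw [hf₁.1 _ rfl]; simp [ha']
    rw [AS.tick_v] at hkx hky
    rw [h₁] at hkx
    rw [h₂] at hky
    rw [← getElem_pts hk'] at h₅ h₆
    simp only [AS.tick_clk] at h₇
    have H₁ := countP_take_succ (δ.pts g) (fun p => δ.sx g B p = a) hk'
    have H₂ := countP_take_succ (δ.pts g) (fun p => δ.sy g B p = a) hk'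
    have hx : Wp z (ifEq ⇡.sx ⇡.a (.asg .kx (⇡.kx + 1))) s₁ fun s₂ =>
        s₂.v .kx = (((δ.pts g).take (k + 1)).countP fun p => δ.sx g B p = a : ℕ) ∧
        s₂.clk ≤ s₁.clk + 3 := by
      refine ifEq_spec (fun h => ?_) fun h => ?_
      · simp only [Ex.val_var, h₅, ha₁, Nat.cast_inj] at h
        refine .asg _ rfl ⟨?_, by simp⟩
        rw [H₁]
        simp [h, hkx]
      · simp only [Ex.val_var, h₅, ha₁, ne_eq, Nat.cast_inj] at h
        rw [H₁]
        simp [h, hkx]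
    refine .seq (.use hx ?_)
    rintro s₂ ⟨h₈, h₉⟩ hf₂
    have hky₂ : s₂.v .ky = _ := (hf₂.1 _ rfl).trans hky
    have ha₂ : s₂.v .a = a := by rw [hf₂.1 _ rfl, ha₁]
    have hsy₂ : s₂.v .sy = _ := (hf₂.1 _ rfl).trans h₆
    refine ifEq_spec (fun h => ?_) fun h => ?_
    · simp only [Ex.val_var, hsy₂, ha₂, Nat.cast_inj] at h
      refine .asg _ rfl fun h' => ⟨by simp [h₈], ?_, by simp; omega⟩
      rw [H₂]
      simp [h, hky₂]
    · simp only [Ex.val_var, hsy₂, ha₂, ne_eq, Nat.cast_inj] at h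
      constructor <;> refine fun h' => ⟨by simp [h₈], ?_, by simp; omega⟩ <;> rw [H₂] <;>
        simp [h, hky₂]
  · rintro s' hf ⟨h₁, h₂, h₃⟩
    rw [← length_pts, List.take_length] at h₁ h₂
    rw [← length_pts] at h₃
    exact ⟨h₁, h₂, by simp; omega⟩

open Classical in
theorem checkProg_spec {z : Cfg} (hz : δ.Fits z) (hδ : δ.Good) {g B : ℕ} {s : AS}
    (hc : δ.CellCtx g B s) (hB : 0 < B) (hBQ : B ≤ δ.Q) :
    Wp z (checkProg δ.J) s fun s' => s'.v .f = (if δ.Fine g B ∨ δ.Q ≤ B then 0 else 1) ∧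
      s'.clk ≤ s.clk + 4 + B * (19 * (δ.pts g).length + 10) := by
  refine .seq (.asg 0 (by simp) (.ite (fun hlt => .seq (.asg 0 (by simp) ?_)) fun hlt =>
    .skip ?_))
  · simp only [Ex.val_var, AS.setv_v, reduceCtorEq, if_false, hc.B, hc.Q, Nat.cast_lt] at hlt
    refine .wh B (fun k s' => s'.v .a = k ∧ (s'.v .f = if (∀ a < k,
      ((δ.pts g).countP fun p => δ.sx g B p = a) ≤ δ.J ∧
      ((δ.pts g).countP fun p => δ.sy g B p = a) ≤ δ.J) then 0 else 1) ∧
      s'.clk ≤ s.clk + 3 + k * (19 * (δ.pts g).length + 10)) (by simp) ?_ ?_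
    · rintro k hk s' hf ⟨h₁, h₂, h₃⟩
      have hc' : δ.CellCtx g B s'.tick := by
        refine CellCtx.frame (s := ((s.setv .f 0).tick).setv .a 0) ⟨by simp [hc.n], by simp [hc.Q],
          by simp [hc.i], by simp [hc.A], by simp [hc.R], by simp [hc.c], by simp [hc.r],
          by simp [hc.B], by simpa using hc.h0⟩ hf.tick rfl rfl
      refine ⟨by simp [h₁, show s'.v .B = B from hc'.B]; exact hk, ?_⟩
      refine .seq (.use (countProg_spec hz hδ hc' hB hBQ (a := k) h₁) ?_)
      rintro s₁ ⟨h₄, h₅, h₆⟩ hf₁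
      have ha₁ : s₁.v .a = k := by rw [hf₁.1 _ rfl]; exact h₁
      have hf' : s₁.v .f = _ := (hf₁.1 _ rfl).trans h₂
      simp only [AS.tick_clk] at h₆
      have hmul : (k + 1) * (19 * (δ.pts g).length + 10) =
        k * (19 * (δ.pts g).length + 10) + (19 * (δ.pts g).length + 10) := by ring
      have hall : ∀ P : ℕ → Prop, (∀ a < k + 1, P a) ↔ (∀ a < k, P a) ∧ P k := fun P =>
        ⟨fun h => ⟨fun a ha => h a (by omega), h k (by omega)⟩, fun h a ha => by
          rcases Nat.lt_succ_iff_lt_or_eq.1 ha with h' | rfl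
          exacts [h.1 a h', h.2]⟩
      simp only [hall]
      refine .seq (.ite (fun hx => .asg 1 (by simp) ?_) fun hx => .skip ?_) <;>
      refine .seq (.ite (fun hy => .asg 1 (by simp) ?_) fun hy => .skip ?_) <;>
      refine .asg (k + 1 : ℕ) (by simp [ha₁]) ⟨by simp, ?_, by simp; omega⟩ <;>
      simp only [Ex.val_lit, Ex.val_var, h₄, h₅, AS.tick_v, AS.setv_v, if_true, reduceCtorEq,
        if_false, Nat.cast_lt, not_lt] at hx hy ⊢
      · rw [if_neg]; omega
      · rw [if_neg]; omega
      · rw [if_neg]; omega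
      · rw [hf']; simp only [hx, hy, and_true]
    · rintro s' hf ⟨h₁, h₂, h₃⟩
      have hB' : s'.v .B = B := by rw [hf.1 _ rfl]; simp [hc.B]
      refine ⟨by simp [h₁, hB'], ?_, by simp; omega⟩
      rw [AS.tick_v, h₂]
      simp only [not_le.2 hlt, or_false]
      exact if_congr Iff.rfl rfl rfl
  · simp only [Ex.val_var, AS.setv_v, reduceCtorEq, if_false, hc.B, hc.Q, Nat.cast_lt,
      not_lt] at hlt
    exact ⟨by simp [hlt], by simp; omega⟩

/-- Checking `B = 2 ^ k` costs `O(2 ^ k)` scans of the list. Under doubling these costs form a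
geometric sum, dominated by the final value of `B`. -/
theorem searchProg_spec {z : Cfg} (hz : δ.Fits z) (hδ : δ.Good) {g : ℕ} {s : AS}
    (hc : ∀ B, δ.CellCtx g B (s.setv .B B)) :
    Wp z (searchProg δ.J) s fun s' => δ.CellCtx g (δ.B g) s' ∧
      s'.clk ≤ s.clk + 3 + 2 * δ.B g * (19 * (δ.pts g).length + 17) := by
  classical
  set E := δ.ex g with hE
  have hmin : ∀ k, k ≤ E → (δ.Fine g (2 ^ k) ∨ δ.Q ≤ 2 ^ k ↔ k = E) := by
    intro k hk
    have h₁ : δ.Q ≤ 2 ^ k ↔ δ.L ≤ k := Nat.pow_le_pow_iff_right (by norm_num)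
    rw [h₁]
    constructor
    · intro h
      exact le_antisymm hk (Nat.find_le (h := δ.exists_fine g) h)
    · rintro rfl
      exact Nat.find_spec (δ.exists_fine g)
  have hctx : ∀ s' : AS, Frame (.wh 0 ⇡.f (checkProg δ.J ;;
      .ite 0 ⇡.f (.asg .B (2 * ⇡.B)) .skip)) ((s.setv .B 1).setv .f 1) s' →
      ∀ B : ℕ, s'.v .B = B → δ.CellCtx g B s' := by
    intro s' hf B hB
    have := hc B
    refine ⟨by rw [hf.1 _ rfl]; simpa using this.n, by rw [hf.1 _ rfl]; simpa using this.Q,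
      by rw [hf.1 _ rfl]; simpa using this.i, by rw [hf.1 _ rfl]; simpa using this.A,
      by rw [hf.1 _ rfl]; simpa using this.R, by rw [hf.1 _ rfl]; simpa using this.c,
      by rw [hf.1 _ rfl]; simpa using this.r, hB, ?_⟩
    rw [hf.1 _ rfl, hf.2 _ rfl]
    simpa using this.h0
  refine .seq (.asg 1 (by simp) (.seq (.asg 1 (by simp) ?_)))
  -- The first `E` rounds double `B`; the last one confirms it and leaves it alone, which explains
  -- the minimum in the invariant.
  refine .wh (E + 1) (fun k s' => s'.v .B = (2 ^ min k E : ℕ) ∧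
    (s'.v .f = if k ≤ E then 1 else 0) ∧
    s'.clk ≤ s.clk + 2 + 2 ^ k * (19 * (δ.pts g).length + 17)) (by simp) ?_ ?_
  · rintro k hk s' hf ⟨h₁, h₂, h₃⟩
    have hkE : k ≤ E := by omega
    rw [min_eq_left hkE] at h₁
    rw [if_pos hkE] at h₂
    have hBQ : 2 ^ k ≤ δ.Q :=
      (Nat.pow_le_pow_right (by norm_num) hkE).trans (δ.B_le_Q g)
    refine ⟨by simp [h₂], ?_⟩
    refine .seq (.use (checkProg_spec hz hδ (hctx s'.tick ⟨hf.1, hf.2⟩ _ h₁) (by positivity) hBQ)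
      ?_)
    rintro s₁ ⟨h₄, h₅⟩ hf₁
    have hB₁ : s₁.v .B = (2 ^ k : ℕ) := by rw [hf₁.1 _ rfl]; exact h₁
    simp only [hmin k hkE] at h₄
    simp only [AS.tick_clk] at h₅
    have hpow : 2 ^ (k + 1) * (19 * (δ.pts g).length + 17) =
      2 ^ k * (19 * (δ.pts g).length + 17) + 2 ^ k * (19 * (δ.pts g).length + 10) +
        2 ^ k * 7 := by ring
    have hpow' : 1 ≤ 2 ^ k := Nat.one_le_two_pow
    refine .ite (fun h => ?_) fun h => .skip ?_
    · have hkE' : k ≠ E := by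
        rintro rfl
        simp [h₄] at h
      refine .asg (2 ^ (k + 1) : ℕ) (by simp [hB₁]; ring) ⟨?_, ?_, ?_⟩
      · rw [min_eq_left (by omega)]; simp
      · rw [if_pos (by omega)]; simp [h₄, hkE']
      · simp only [AS.setv_clk, AS.tick_clk]; omega
    · have hkE' : k = E := by
        by_contra hne
        simp [h₄, hne] at h
      subst hkE'
      refine ⟨?_, ?_, ?_⟩
      · simp [hB₁]
      · simp [h₄]
      · simp only [AS.tick_clk]; omega
  · rintro s' hf ⟨h₁, h₂, h₃⟩
    rw [min_eq_right (by omega)] at h₁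
    rw [if_neg (by omega)] at h₂
    refine ⟨by simp [h₂], hctx s'.tick ⟨hf.1, hf.2⟩ _ h₁, ?_⟩
    have : 2 * δ.B g * (19 * (δ.pts g).length + 17) =
      2 ^ (E + 1) * (19 * (δ.pts g).length + 17) := by rw [B, pow_succ, mul_comm 2]
    simp only [AS.tick_clk]; omega

end Dat


/-! ### Listing the points of each range of subcells -/

section Programs
open Cmd Var

/-- List the points in the subcolumns `a1, …, a2` and subrows `b1, …, b2`. -/
def entryProg (N : ℕ) : Cmd :=
  asg cnt 0 ;; forList (fetchProg ;; ite ⇡sx ⇡a1 skip (ite ⇡a2 ⇡sx skip (ite ⇡sy ⇡b1 skip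
    (ite ⇡b2 ⇡sy skip (ite ⇡cnt (.lit N)
      (st .tab (⇡F + 1 + ⇡e * .lit N + ⇡cnt) (⇡p + 1) ;; asg cnt (⇡cnt + 1)) skip)))))

/-- Build the table of a cell. -/
def tableProg (N : ℕ) : Cmd :=
  asg e 0 ;; wh ⇡e (⇡B * ⇡B * ⇡B * ⇡B)
    (flr e1 (⇡e / ⇡B) ;; asg b2 (⇡e - ⇡e1 * ⇡B) ;; flr a2 (⇡e1 / ⇡B) ;; asg b1 (⇡e1 - ⇡a2 * ⇡B) ;;
      flr a1 (⇡a2 / ⇡B) ;; asg a2 (⇡a2 - ⇡a1 * ⇡B) ;; entryProg N ;; asg e (⇡e + 1))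

end Programs

namespace Dat

variable (δ : Dat)

/-- The point `p` lies in the subcolumns `a₁, …, a₂` and subrows `b₁, …, b₂` of the cell `g`. -/
noncomputable def inRange (g B a₁ a₂ b₁ b₂ p : ℕ) : Bool :=
  decide (a₁ ≤ δ.sx g B p ∧ δ.sx g B p ≤ a₂ ∧ b₁ ≤ δ.sy g B p ∧ δ.sy g B p ≤ b₂)

/-- The entry number `t` of the list of the points in a range of subcells. -/
noncomputable def slot (g B a₁ a₂ b₁ b₂ t : ℕ) : ℕ :=
  (((δ.pts g).filter (δ.inRange g B a₁ a₂ b₁ b₂)).map (· + 1)).getD t 0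

variable {δ}

theorem getD_append_single (l : List ℕ) (a t : ℕ) :
    (l ++ [a]).getD t 0 = if t = l.length then a else l.getD t 0 := by
  simp only [List.getD_eq_getElem?_getD, List.getElem?_append]
  split_ifs with h h' h'
  · omega
  · rfl
  · simp [h']
  · rw [List.getElem?_eq_none (by simp; omega), List.getElem?_eq_none (by omega)]

/-- The counter saturates at `δ.N`, so the entry is a prefix of the filtered list, padded with the
zeros of fresh memory. `exists_slot` shows that the truncation does no harm. -/
theorem entryProg_spec {z : Cfg} (hz : δ.Fits z) (hδ : δ.Good) {g B F e a₁ a₂ b₁ b₂ : ℕ} {s : AS}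
    (hc : δ.CellCtx g B s) (hB : 0 < B) (hBQ : B ≤ δ.Q) (hF : s.v .F = F) (he : s.v .e = e)
    (ha₁ : s.v .a1 = a₁) (ha₂ : s.v .a2 = a₂) (hb₁ : s.v .b1 = b₁) (hb₂ : s.v .b2 = b₂)
    (hI : F + 1 + e * δ.N + δ.N ≤ z.I) (h0 : ∀ t < δ.N, s.a .tab (F + 1 + e * δ.N + t) = 0) :
    Wp z (entryProg δ.N) s fun s' =>
      (∀ t < δ.N, s'.a .tab (F + 1 + e * δ.N + t) = δ.slot g B a₁ a₂ b₁ b₂ t) ∧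
      (∀ j, j < F + 1 + e * δ.N ∨ F + 1 + e * δ.N + δ.N ≤ j → s'.a .tab j = s.a .tab j) ∧
      s'.clk ≤ s.clk + 3 + 20 * (δ.pts g).length := by
  obtain ⟨h, hh, hl⟩ := hc.h0
  have hn2 := hδ.two_le
  have hnQ := hδ.le_Q
  have hG := hz.G
  have hQG := δ.Q_le_G
  have hIW := hz.I_le
  set base := F + 1 + e * δ.N with hbase
  refine .seq (.asg 0 (by simp) ?_)
  set ps := fun k => ((δ.pts g).take k).filter (δ.inRange g B a₁ a₂ b₁ b₂) with hps
  refine .forList _ h hl (by simp [hh]) rfl rfl (items_lt_I hz hδ) (fun k s' =>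
    s'.v .cnt = (min δ.N (ps k).length : ℕ) ∧
    (∀ t < δ.N, s'.a .tab (base + t) = ((ps k).map (· + 1)).getD t 0) ∧
    (∀ j, j < base ∨ base + δ.N ≤ j → s'.a .tab j = s.a .tab j) ∧
    s'.clk ≤ s.clk + 2 + 20 * k) ?_ ?_ ?_
  · refine ⟨by simp [ps], fun t ht => by simpa [ps] using h0 t ht, fun _ _ => rfl, by simp⟩
  · rintro k hk s' hf ⟨h₁, h₂, h₂', h₃⟩ h₄
    have hk' : k < (δ.pts g).length := by rwa [length_pts]
    have hc' : δ.CellCtx g B s'.tick := by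
      refine CellCtx.frame (s := s.setv .cnt 0) ⟨by simp [hc.n], by simp [hc.Q],
        by simp [hc.i], by simp [hc.A], by simp [hc.R], by simp [hc.c], by simp [hc.r],
        by simp [hc.B], by simpa using hc.h0⟩ hf.tick rfl rfl
    refine .seq (.use (fetchProg_spec hz hδ hc' hB hBQ (List.getElem_mem hk) h₄) ?_)
    rintro s₁ ⟨hp, h₅, h₆, h₇⟩ hf₁
    rw [← getElem_pts hk'] at h₅ h₆ hp
    have hpn : (δ.pts g)[k] < δ.n := by rw [getElem_pts hk' hk]; exact Nat.mod_lt _ (by omega)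
    have v₁ : s₁.v .a1 = a₁ := by rw [hf₁.1 _ rfl, AS.tick_v, hf.1 _ rfl]; simpa using ha₁
    have v₂ : s₁.v .a2 = a₂ := by rw [hf₁.1 _ rfl, AS.tick_v, hf.1 _ rfl]; simpa using ha₂
    have v₃ : s₁.v .b1 = b₁ := by rw [hf₁.1 _ rfl, AS.tick_v, hf.1 _ rfl]; simpa using hb₁
    have v₄ : s₁.v .b2 = b₂ := by rw [hf₁.1 _ rfl, AS.tick_v, hf.1 _ rfl]; simpa using hb₂
    have v₅ : s₁.v .F = F := by rw [hf₁.1 _ rfl, AS.tick_v, hf.1 _ rfl]; simpa using hF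
    have v₆ : s₁.v .e = e := by rw [hf₁.1 _ rfl, AS.tick_v, hf.1 _ rfl]; simpa using he
    have v₇ : s₁.v .cnt = _ := (hf₁.1 _ rfl).trans h₁
    have v₈ : s₁.a .tab = s'.a .tab := hf₁.2 _ rfl
    simp only [AS.tick_clk] at h₇
    have hsucc : ps (k + 1) = if δ.inRange g B a₁ a₂ b₁ b₂ (δ.pts g)[k] then
        ps k ++ [(δ.pts g)[k]] else ps k := by
      simp only [ps, List.take_succ_eq_append_getElem hk', List.filter_append]
      split_ifs with h <;> simp [h]
    have hneg : ¬ (a₁ ≤ δ.sx g B (δ.pts g)[k] ∧ δ.sx g B (δ.pts g)[k] ≤ a₂ ∧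
        b₁ ≤ δ.sy g B (δ.pts g)[k] ∧ δ.sy g B (δ.pts g)[k] ≤ b₂) → ps (k + 1) = ps k := by
      intro hn
      rw [hsucc, if_neg]
      simpa [inRange] using hn
    have done : ∀ s₂ : AS, ps (k + 1) = ps k → s₂.v = s₁.v → s₂.a = s₁.a →
        s₂.clk ≤ s₁.clk + 6 → ∀ h' : ℕ, (s₂.setv .h h').v .cnt = (min δ.N (ps (k + 1)).length : ℕ) ∧
        (∀ t < δ.N, (s₂.setv .h h').a .tab (base + t) = ((ps (k + 1)).map (· + 1)).getD t 0) ∧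
        (∀ j, j < base ∨ base + δ.N ≤ j → (s₂.setv .h h').a .tab j = s.a .tab j) ∧
        (s₂.setv .h h').clk ≤ s.clk + 2 + 20 * (k + 1) := by
      intro s₂ e₁ e₂ e₃ e₄ h'
      rw [e₁]
      simp only [AS.setv_v, reduceCtorEq, if_false, AS.setv_a, AS.setv_clk, e₂, e₃, v₇, v₈]
      exact ⟨trivial, h₂, h₂', by omega⟩
    refine .ite (fun h => .skip ?_) fun g₁ => .ite (fun h => .skip ?_) fun g₂ =>
      .ite (fun h => .skip ?_) fun g₃ => .ite (fun h => .skip ?_) fun g₄ => .ite (fun h => ?_)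
        fun h => .skip ?_
    · simp only [Ex.val_var, h₅, v₁, Nat.cast_lt] at h
      exact done _ (hneg (by omega)) rfl rfl (by simp)
    · simp only [Ex.val_var, AS.tick_v, h₅, v₂, Nat.cast_lt] at h
      exact done _ (hneg (by omega)) rfl rfl (by simp)
    · simp only [Ex.val_var, AS.tick_v, h₆, v₃, Nat.cast_lt] at h
      exact done _ (hneg (by omega)) rfl rfl (by simp)
    · simp only [Ex.val_var, AS.tick_v, h₆, v₄, Nat.cast_lt] at h
      exact done _ (hneg (by omega)) rfl rfl (by simp)
    all_goals
      simp only [Ex.val_var, AS.tick_v, h₅, h₆, v₁, v₂, v₃, v₄, Nat.cast_lt, not_lt] at g₁ g₂ g₃ g₄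
      rw [if_pos (by simp [inRange, g₁, g₂, g₃, g₄])] at hsucc
      simp only [Ex.val_var, Ex.val_lit, AS.tick_v, v₇, Nat.cast_lt, not_lt] at h
    · have hlen : min δ.N (ps k).length = (ps k).length := by omega
      rw [hlen] at v₇ h
      refine .seq (.st (base + (ps k).length) ((δ.pts g)[k] + 1) (by simp [v₅, v₆, v₇, hbase])
        (by simp [hp]) (by omega) (by omega) (.asg ((ps k).length + 1 : ℕ) (by simp [v₇]) ?_))
      intro h'
      rw [hsucc]
      refine ⟨?_, fun t ht => ?_, fun j hj => ?_, by simp; omega⟩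
      · simp only [AS.setv_v, reduceCtorEq, if_false, if_true, List.length_append,
          List.length_singleton]
        rw [min_eq_right (by omega)]
      · simp only [AS.setv_a, AS.seta_a, if_true, AS.tick_a, v₈, List.map_append,
          List.map_cons, List.map_nil, getD_append_single, List.length_map]
        split_ifs with htl
        · rw [htl, Function.update_self]
        · rw [Function.update_of_ne (by omega), h₂ t ht]
      · simp only [AS.setv_a, AS.seta_a, if_true, AS.tick_a, v₈]
        rw [Function.update_of_ne (by omega), h₂' j hj]
    · have hlen : δ.N ≤ (ps k).length := by omega
      intro h'
      rw [hsucc]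
      refine ⟨?_, fun t ht => ?_, fun j hj => ?_, by simp; omega⟩
      · simp only [AS.setv_v, reduceCtorEq, if_false, AS.tick_v, v₇, List.length_append]
        rw [min_eq_left hlen, min_eq_left (by omega)]
      · simp only [AS.setv_a, AS.tick_a, v₈, List.map_append, List.map_cons, List.map_nil,
          getD_append_single, List.length_map]
        rw [if_neg (by omega), h₂ t ht]
      · simp only [AS.setv_a, AS.tick_a, v₈]
        exact h₂' j hj
  · rintro s' hf ⟨h₁, h₂, h₂', h₃⟩
    rw [← length_pts] at h₂ h₃
    simp only [ps, List.take_length] at h₂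
    exact ⟨h₂, h₂', by simp; omega⟩

/-- The number `e` of an entry is read as four digits in base `B`: the first and last subcolumn,
then the first and last subrow. Ranges with reversed bounds get entries too, which stay empty. -/
theorem tableProg_spec {z : Cfg} (hz : δ.Fits z) (hδ : δ.Good) {g B F : ℕ} {s : AS}
    (hc : δ.CellCtx g B s) (hB : 0 < B) (hBQ : B ≤ δ.Q) (hF : s.v .F = F)
    (hI : F + 1 + B ^ 4 * δ.N ≤ z.I) (h0 : ∀ j > F, s.a .tab j = 0) :
    Wp z (tableProg δ.N) s fun s' =>
      (∀ e < B ^ 4, ∀ t < δ.N, s'.a .tab (F + 1 + e * δ.N + t) =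
        δ.slot g B (e / B / B / B) (e / B / B % B) (e / B % B) (e % B) t) ∧
      (∀ j, j ≤ F ∨ F + 1 + B ^ 4 * δ.N ≤ j → s'.a .tab j = s.a .tab j) ∧
      s'.clk ≤ s.clk + 2 + B ^ 4 * (20 * (δ.pts g).length + 11) := by
  have hN : 0 < δ.N := Nat.succ_pos _
  have hIW := hz.I_le
  refine .seq (.asg 0 (by simp) ?_)
  refine .wh (B ^ 4) (fun k s' => s'.v .e = k ∧
    (∀ e < k, ∀ t < δ.N, s'.a .tab (F + 1 + e * δ.N + t) =
        δ.slot g B (e / B / B / B) (e / B / B % B) (e / B % B) (e % B) t) ∧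
    (∀ j, j ≤ F ∨ F + 1 + k * δ.N ≤ j → s'.a .tab j = s.a .tab j) ∧
    s'.clk ≤ s.clk + 1 + k * (20 * (δ.pts g).length + 11)) (by simp) ?_ ?_
  · rintro k hk s' hf ⟨h₁, h₂, h₃, h₄⟩
    have hc' : δ.CellCtx g B s' := by
      refine CellCtx.frame (s := s.setv .e 0) ⟨by simp [hc.n], by simp [hc.Q],
        by simp [hc.i], by simp [hc.A], by simp [hc.R], by simp [hc.c], by simp [hc.r],
        by simp [hc.B], by simpa using hc.h0⟩ hf rfl rfl
    have hF' : s'.v .F = F := by rw [hf.1 _ rfl]; simp [hF]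
    have hBk : B ^ 4 ≤ B ^ 4 * δ.N := Nat.le_mul_of_pos_right _ hN
    have hkN : k * δ.N + δ.N ≤ B ^ 4 * δ.N := by
      rw [← Nat.succ_mul]; exact Nat.mul_le_mul_right _ hk
    have d₁ : k / B ≤ k := Nat.div_le_self _ _
    have d₂ : k / B / B ≤ k / B := Nat.div_le_self _ _
    have d₃ : k / B / B / B ≤ k / B / B := Nat.div_le_self _ _
    refine ⟨?_, ?_⟩
    · simp only [Ex.val_var, Ex.val_mul, h₁, hc'.B]
      rw [show B ^ 4 = B * B * B * B by ring] at hk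
      exact_mod_cast hk
    refine .seq (.flr (k / B) (by simp [h₁, hc'.B]; positivity) ?_ (by omega) ?_)
    · simpa [h₁, hc'.B] using Nat.floor_div_eq_div (K := ℝ) k B
    refine .seq (.asg (k % B : ℕ) ?_ ?_)
    · simpa [h₁, hc'.B] using cast_sub_div_mul k B
    refine .seq (.flr (k / B / B) (by simp [hc'.B]; positivity) ?_ (by omega) ?_)
    · simpa [hc'.B] using Nat.floor_div_eq_div (K := ℝ) (k / B) B
    refine .seq (.asg (k / B % B : ℕ) ?_ ?_)
    · simpa [hc'.B] using cast_sub_div_mul (k / B) B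
    refine .seq (.flr (k / B / B / B) (by simp [hc'.B]; positivity) ?_ (by omega) ?_)
    · simpa [hc'.B] using Nat.floor_div_eq_div (K := ℝ) (k / B / B) B
    refine .seq (.asg (k / B / B % B : ℕ) ?_ ?_)
    · simpa [hc'.B] using cast_sub_div_mul (k / B / B) B
    refine .seq (.use (entryProg_spec hz hδ (g := g) (B := B) (F := F) (e := k)
      (a₁ := k / B / B / B) (a₂ := k / B / B % B) (b₁ := k / B % B) (b₂ := k % B)
      ⟨by simp [hc'.n], by simp [hc'.Q], by simp [hc'.i], by simp [hc'.A], by simp [hc'.R],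
        by simp [hc'.c], by simp [hc'.r], by simp [hc'.B], by simpa using hc'.h0⟩ hB hBQ
      (by simp [hF']) (by simp [h₁]) (by simp) (by simp) (by simp) (by simp) (by omega) ?_) ?_)
    · intro t ht
      simp only [AS.setv_a, AS.tick_a]
      rw [h₃ _ (by omega), h0 _ (by omega)]
    rintro s₁ ⟨h₅, h₆, h₇⟩ hf₁
    have he : s₁.v .e = k := by rw [hf₁.1 _ rfl]; simp [h₁]
    simp only [AS.setv_a, AS.tick_a] at h₆
    have hmul : (k + 1) * (20 * (δ.pts g).length + 11) =
        k * (20 * (δ.pts g).length + 11) + (20 * (δ.pts g).length + 11) := by ring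
    have hmul' : (k + 1) * δ.N = k * δ.N + δ.N := by ring
    refine .asg (k + 1 : ℕ) (by simp [he]) ⟨by simp, fun e he t ht => ?_, fun j hj => ?_, ?_⟩
    · rw [AS.setv_a]
      rcases Nat.lt_succ_iff_lt_or_eq.1 he with he' | rfl
      · have : e * δ.N + δ.N ≤ k * δ.N := by
          rw [← Nat.succ_mul]; exact Nat.mul_le_mul_right _ he'
        rw [h₆ _ (by omega), h₂ e he' t ht]
      · exact h₅ t ht
    · rw [AS.setv_a, h₆ _ (by omega), h₃ _ (by omega)]
    · simp only [AS.setv_clk, AS.tick_clk] at h₇ ⊢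
      omega
  · rintro s' hf ⟨h₁, h₂, h₃, h₄⟩
    have hB' : s'.v .B = B := by rw [hf.1 _ rfl]; simp [hc.B]
    refine ⟨?_, h₂, h₃, by simp; omega⟩
    simp only [Ex.val_var, Ex.val_mul, h₁, hB', not_lt]
    rw [show B ^ 4 = B * B * B * B by ring]
    push_cast
    exact le_rfl

end Dat


/-! ## Extremal points -/

section Programs
open Cmd Var

/-- The quantity that is minimized: the first coordinate or its negative. -/
def keyEx (sg : Bool) (u : Var) : Ex := if sg then ⇡u else 0 - ⇡u

/-- Combine the extremal points `a` and `b` of two sets of points. -/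
def pickProg (sg : Bool) : Cmd :=
  ite 0 ⇡b (ite 0 ⇡a (pt xa (2 * ⇡a - 2) ;; pt xb (2 * ⇡b - 2) ;;
    ite (keyEx sg xb) (keyEx sg xa) (asg a ⇡b) skip) (asg a ⇡b)) skip

/-- Determine the extremal point of a cell. -/
def baseProg (sg : Bool) (q : Arr) : Cmd :=
  asg a 0 ;; forList (asg b (⇡h - ⇡i * ⇡n) ;; pickProg sg) ;; st q ⇡g ⇡a

/-- Determine the extremal points of runs of `2 ^ d` consecutive cells. -/
def sparseProg (sg : Bool) (q : Arr) : Cmd :=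
  asg d 0 ;; asg w 1 ;; wh ⇡d ⇡D (asg g 0 ;; wh (⇡g + 2 * ⇡w) (⇡G + 1)
    (ld a q (⇡d * ⇡G + ⇡g) ;; ld b q (⇡d * ⇡G + ⇡g + ⇡w) ;; pickProg sg ;;
      st q ((⇡d + 1) * ⇡G + ⇡g) ⇡a ;; asg g (⇡g + 1)) ;; asg w (2 * ⇡w) ;; asg d (⇡d + 1))

end Programs

/-- `a` is `0` and `S` is empty, or `a = p + 1` where `p` minimizes `key` on `S`. -/
def IsBest (key : ℕ → ℝ) (S : ℕ → Prop) (a : ℕ) : Prop :=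
  (a = 0 ∧ ∀ p, ¬ S p) ∨ ∃ p, a = p + 1 ∧ S p ∧ ∀ p', S p' → key p ≤ key p'

theorem IsBest.congr {key : ℕ → ℝ} {S T : ℕ → Prop} {a : ℕ} (h : IsBest key S a)
    (hST : ∀ p, S p ↔ T p) : IsBest key T a := by
  have : S = T := funext fun p => propext (hST p)
  exact this ▸ h

namespace Dat

variable (δ : Dat)

/-- The quantity that is minimized. -/
def key (sg : Bool) (p : ℕ) : ℝ := if sg then δ.px p else -δ.px p

/-- The point `p` lies in one of the cells `g, …, g + m - 1`. -/
def InCells (g m p : ℕ) : Prop := ∃ g', g ≤ g' ∧ g' < g + m ∧ p ∈ δ.pts g'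

variable {δ}

theorem pickProg_spec {z : Cfg} (hz : δ.Fits z) (hδ : δ.Good) {sg : Bool} {a b : ℕ} {s : AS}
    {S T : ℕ → Prop} (ha : s.v .a = a) (hb : s.v .b = b) (hS : IsBest (δ.key sg) S a)
    (hT : IsBest (δ.key sg) T b) (hSn : ∀ p, S p → p < δ.n) (hTn : ∀ p, T p → p < δ.n) :
    Wp z (pickProg sg) s fun s' => (∃ a' : ℕ, s'.v .a = a' ∧
      IsBest (δ.key sg) (fun p => S p ∨ T p) a') ∧ s'.clk ≤ s.clk + 6 := by
  have hnQ := hδ.le_Q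
  have hG := hz.G
  have hQG := δ.Q_le_G
  refine .ite (fun h => .ite (fun h' => ?_) fun h' => ?_) fun h => .skip ?_
  · simp only [Ex.val_zero, Ex.val_var, hb, Nat.cast_pos] at h
    simp only [Ex.val_zero, Ex.val_var, AS.tick_v, ha, Nat.cast_pos] at h'
    obtain ⟨p, rfl, hp, hpm⟩ := hS.resolve_left (by omega)
    obtain ⟨q, rfl, hq, hqm⟩ := hT.resolve_left (by omega)
    have hpn := hSn p hp
    have hqn := hTn q hq
    refine .seq (.pt (2 * p) (by simp [ha]; ring) (by omega) ?_)
    refine .seq (.pt (2 * q) (by simp [hb]; ring) (by omega) ?_)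
    have e₁ : z.X (2 * p) = δ.px p := by rw [hz.X]; rfl
    have e₂ : z.X (2 * q) = δ.px q := by rw [hz.X]; rfl
    rw [e₁, e₂]
    have k₁ : ∀ s' : AS, s'.v .xa = δ.px p → (keyEx sg .xa).val s'.v = δ.key sg p := by
      intro s' hs'; cases sg <;> simp [keyEx, key, hs']
    have k₂ : ∀ s' : AS, s'.v .xb = δ.px q → (keyEx sg .xb).val s'.v = δ.key sg q := by
      intro s' hs'; cases sg <;> simp [keyEx, key, hs']
    refine .ite (fun h => ?_) fun h => ?_
    · rw [k₁ _ (by simp), k₂ _ (by simp)] at h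
      refine .asg (q + 1 : ℕ) (by simp [hb]) ⟨⟨q + 1, by simp, ?_⟩, by simp⟩
      exact Or.inr ⟨q, rfl, Or.inr hq, fun p' hp' => hp'.elim
        (fun hp' => h.le.trans (hpm p' hp')) (hqm p')⟩
    · rw [k₁ _ (by simp), k₂ _ (by simp), not_lt] at h
      refine .skip ⟨⟨p + 1, by simp [ha], ?_⟩, by simp⟩
      exact Or.inr ⟨p, rfl, Or.inl hp, fun p' hp' => hp'.elim (hpm p')
        fun hp' => h.trans (hqm p' hp')⟩
  · simp only [Ex.val_zero, Ex.val_var, AS.tick_v, ha, Nat.cast_pos, not_lt,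
      Nat.le_zero] at h'
    subst h'
    have hS' : ∀ p, ¬ S p := by
      rcases hS with h' | ⟨p, hp, -⟩
      exacts [h'.2, by omega]
    exact .asg b (by simp [hb]) ⟨⟨b, by simp, hT.congr fun p => by simp [hS' p]⟩, by simp⟩
  · simp only [Ex.val_zero, Ex.val_var, hb, Nat.cast_pos, not_lt, Nat.le_zero] at h
    subst h
    have hT' : ∀ p, ¬ T p := by
      rcases hT with h' | ⟨p, hp, -⟩
      exacts [h'.2, by omega]
    exact ⟨⟨a, by simp [ha], hS.congr fun p => by simp [hT' p]⟩, by simp⟩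

theorem IsBest_le {key : ℕ → ℝ} {S : ℕ → Prop} {a n : ℕ} (h : IsBest key S a)
    (hn : ∀ p, S p → p < n) : a ≤ n := by
  rcases h with h | ⟨p, rfl, hp, -⟩
  · omega
  · exact hn p hp

theorem baseProg_spec {z : Cfg} (hz : δ.Fits z) (hδ : δ.Good) {sg : Bool} {q : Arr} {g B : ℕ}
    {s : AS} (hg : g < δ.G) (hc : δ.CellCtx g B s) (hgv : s.v .g = g) :
    Wp z (baseProg sg q) s fun s' => (∃ a, IsBest (δ.key sg) (fun p => p ∈ δ.pts g) a ∧
        s'.a q = Function.update (s.a q) g a) ∧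
      s'.clk ≤ s.clk + 4 + 9 * (δ.pts g).length := by
  have hnQ := hδ.le_Q
  have hG := hz.G
  have hQG := δ.Q_le_G
  have hIW := hz.I_le
  obtain ⟨h, hh, hl⟩ := hc.h0
  refine .seq (.asg 0 (by simp) (.seq ?_))
  refine .use (P := fun s' => (∃ a : ℕ, s'.v .a = a ∧
      IsBest (δ.key sg) (fun p => p ∈ δ.pts g) a) ∧
      s'.clk ≤ s.clk + 3 + 9 * (δ.pts g).length) ?_ ?_
  · refine .forList _ h hl (by simp [hh]) (by cases sg <;> rfl) (by cases sg <;> rfl)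
      (items_lt_I hz hδ) (fun k s' => (∃ a : ℕ, s'.v .a = a ∧
      IsBest (δ.key sg) (fun p => p ∈ (δ.pts g).take k) a) ∧
      s'.clk ≤ s.clk + 2 + 9 * k) ?_ ?_ ?_
    · exact ⟨⟨0, by simp, Or.inl ⟨rfl, by simp⟩⟩, by simp⟩
    · rintro k hk s' hf ⟨⟨a, h₁, h₂⟩, h₃⟩ h₄
      have hk' : k < (δ.pts g).length := by rwa [length_pts]
      have hi : s'.v .i = δ.lev g := by
        rw [hf.1 _ (by cases sg <;> rfl)]; simp [hc.i]
      have hn : s'.v .n = δ.n := by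
        rw [hf.1 _ (by cases sg <;> rfl)]; simp [hc.n]
      have hmem := (hδ.mem_pts hg).1 (List.getElem_mem hk')
      refine .seq (.asg ((δ.pts g)[k] + 1 : ℕ) ?_ ?_)
      · have e₁ := hδ.div_eq_lev (List.getElem_mem hk)
        have e₂ := cast_sub_div_mul (δ.items ((δ.L + 1) * δ.n) g)[k] δ.n
        rw [e₁] at e₂
        rw [getElem_pts hk' hk]
        push_cast
        rw [← e₂]
        simp only [Ex.val_sub, Ex.val_mul, Ex.val_var, AS.tick_v, h₄, hi, hn]
        push_cast
        ring
      refine .mono (pickProg_spec hz hδ (a := a) (b := (δ.pts g)[k] + 1)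
        (T := fun p => p = (δ.pts g)[k]) (by simp [h₁]) (by simp) h₂
        (Or.inr ⟨_, rfl, rfl, fun p' hp' => by rw [hp']⟩)
        (fun p hp => ((hδ.mem_pts hg).1 (List.mem_of_mem_take hp)).1)
        (fun p hp => hp ▸ hmem.1)) ?_
      rintro s₁ ⟨⟨a', h₅, h₆⟩, h₇⟩ h'
      refine ⟨⟨a', by simp [h₅], h₆.congr fun p => ?_⟩, by simp at h₇ ⊢; omega⟩
      rw [List.take_succ_eq_append_getElem hk', List.mem_append, List.mem_singleton]
    · rintro s' hf ⟨⟨a, h₁, h₂⟩, h₃⟩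
      rw [← length_pts, List.take_length] at h₂
      rw [← length_pts] at h₃
      exact ⟨⟨a, by simp [h₁], h₂⟩, by simp; omega⟩
  · rintro s₁ ⟨⟨a, h₁, h₂⟩, h₃⟩ hf₁
    have hg₁ : s₁.v .g = g := by rw [hf₁.1 _ (by cases sg <;> rfl)]; simp [hgv]
    have hq₁ : s₁.a q = s.a q := by rw [hf₁.2 _ (by cases sg <;> rfl)]; rfl
    have := IsBest_le h₂ (fun p hp => ((hδ.mem_pts hg).1 hp).1)
    refine .st g a (by simp [hg₁]) (by simp [h₁]) (by omega) (by omega)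
      ⟨⟨a, h₂, by simp [hq₁]⟩, by simp; omega⟩

/-- A run of `2 ^ (k + 1)` cells consists of two adjacent runs of `2 ^ k` cells, so each layer
follows from the previous one with one comparison per entry. -/
theorem sparseProg_spec {z : Cfg} (hz : δ.Fits z) (hδ : δ.Good) {sg : Bool} {q : Arr} {s : AS}
    (hc : δ.Ctx s) (h0 : ∀ g < δ.G, IsBest (δ.key sg) (fun p => p ∈ δ.pts g) (s.a q g)) :
    Wp z (sparseProg sg q) s fun s' =>
      (∀ d ≤ δ.D, ∀ g, g + 2 ^ d ≤ δ.G →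
        IsBest (δ.key sg) (δ.InCells g (2 ^ d)) (s'.a q (d * δ.G + g))) ∧
      s'.clk ≤ s.clk + 3 + δ.D * (11 * δ.G + 16) := by
  have hnQ := hδ.le_Q
  have hG := hz.G
  have hQG := δ.Q_le_G
  have hQ := δ.Q_pos
  have hIW := hz.I_le
  have hDG := hz.DG
  have hpn : ∀ {g m p : ℕ}, g + m ≤ δ.G → δ.InCells g m p → p < δ.n := by
    rintro g m p hgm ⟨g', h₁, h₂, h₃⟩
    exact ((hδ.mem_pts (by omega)).1 h₃).1
  refine .seq (.asg 0 (by simp) (.seq (.asg 1 (by simp) ?_)))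
  refine .wh δ.D (fun k s' => s'.v .d = k ∧ s'.v .w = (2 ^ k : ℕ) ∧
    (∀ d ≤ k, ∀ g, g + 2 ^ d ≤ δ.G →
        IsBest (δ.key sg) (δ.InCells g (2 ^ d)) (s'.a q (d * δ.G + g))) ∧
    s'.clk ≤ s.clk + 2 + k * (11 * δ.G + 16)) ?_ ?_ ?_
  · refine ⟨by simp, by simp, fun d hd g hg => ?_, by simp⟩
    obtain rfl : d = 0 := by omega
    simp only [pow_zero, zero_mul, zero_add] at hg ⊢
    refine (h0 g (by omega)).congr fun p => ⟨fun h => ⟨g, le_rfl, by omega, h⟩, ?_⟩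
    rintro ⟨g', h₁, h₂, h₃⟩
    obtain rfl : g = g' := by omega
    exact h₃
  · rintro k hk s' hf ⟨h₁, h₂, h₃, h₄⟩
    have hc' : δ.Ctx s' := Ctx.frame (s := (s.setv .d 0).setv .w 1)
      ⟨by simp [hc.n], by simp [hc.Q], by simp [hc.L], by simp [hc.D], by simp [hc.NC],
        by simp [hc.G]⟩ hf (by cases sg <;> rfl)
    refine ⟨by simp [h₁, hc'.D]; exact hk, ?_⟩
    have hkG : (k + 1) * δ.G + δ.G ≤ z.I := by
      rw [← Nat.succ_mul]
      exact (Nat.mul_le_mul_right _ (by omega)).trans hDG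
    have hkG' : (k + 1) * δ.G = k * δ.G + δ.G := by ring
    have hp2 : 2 ^ (k + 1) = 2 * 2 ^ k := by ring
    have hp1 : 1 ≤ 2 ^ k := Nat.one_le_two_pow
    refine .seq (.asg 0 (by simp) (.seq ?_))
    -- These are the starting cells `j` with `j + 2 ^ (k + 1) ≤ G`. If the run is longer than `G`,
    -- truncated subtraction gives no rounds, as it should.
    refine .wh (δ.G + 1 - 2 ^ (k + 1)) (fun j s'' => s''.v .g = j ∧
      (∀ g < j, IsBest (δ.key sg) (δ.InCells g (2 ^ (k + 1))) (s''.a q ((k + 1) * δ.G + g))) ∧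
      (∀ m < (k + 1) * δ.G, s''.a q m = s'.a q m) ∧
      s''.clk ≤ s.clk + 4 + k * (11 * δ.G + 16) + 11 * j) ?_ ?_ ?_
    · refine ⟨by simp, by simp, fun _ _ => rfl, ?_⟩
      simp only [AS.setv_clk, AS.tick_clk]; omega
    · rintro j hj s₁ hf₁ ⟨h₅, h₆, h₇, h₈⟩
      have hG₁ : s₁.v .G = δ.G := by
        rw [hf₁.1 _ (by cases sg <;> rfl)]; simp [hc'.G]
      have hd₁ : s₁.v .d = k := by
        rw [hf₁.1 _ (by cases sg <;> rfl)]; simp [h₁]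
      have hw₁ : s₁.v .w = (2 ^ k : ℕ) := by
        rw [hf₁.1 _ (by cases sg <;> rfl)]; simp [h₂]
      refine ⟨?_, ?_⟩
      · simp only [Ex.val_add, Ex.val_mul, Ex.val_var, Ex.val_ofNat, Ex.val_one, h₅, hw₁, hG₁]
        have : j + 2 * 2 ^ k < δ.G + 1 := by omega
        exact_mod_cast this
      refine .seq (.ld (k * δ.G + j) _ (by simp [h₅, hd₁, hG₁]) (by omega) rfl ?_)
      refine .seq (.ld (k * δ.G + j + 2 ^ k) _ (by simp [h₅, hd₁, hG₁, hw₁]) (by omega) rfl ?_)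
      simp only [AS.tick_a, AS.setv_a]
      rw [h₇ _ (by omega), h₇ _ (by omega)]
      refine .seq (.use (pickProg_spec hz hδ (a := s'.a q (k * δ.G + j))
        (b := s'.a q (k * δ.G + j + 2 ^ k)) (by simp) (by simp) (h₃ k le_rfl j (by omega))
        (by rw [add_assoc]; exact h₃ k le_rfl (j + 2 ^ k) (by omega))
        (fun p => hpn (by omega)) (fun p => hpn (by omega))) ?_)
      rintro s₂ ⟨⟨a, h₉, h₁₀⟩, h₁₁⟩ hf₂
      have hv : ∀ u, u ∉ ([.a, .b, .xa, .xb] : List Var) → s₂.v u = s₁.v u := by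
        intro u hu
        simp only [List.mem_cons, List.not_mem_nil, or_false, not_or] at hu
        rw [hf₂.1 u (by cases sg <;> simp [pickProg, Cmd.writesVar, Ne.symm hu.1,
          Ne.symm hu.2.2.1, Ne.symm hu.2.2.2])]
        simp [hu]
      have ha₂ : s₂.a q = s₁.a q := by rw [hf₂.2 _ (by cases sg <;> rfl)]; rfl
      have hcomb : IsBest (δ.key sg) (δ.InCells j (2 ^ (k + 1))) a := by
        refine h₁₀.congr fun p => ⟨?_, ?_⟩
        · rintro (⟨g', e₁, e₂, e₃⟩ | ⟨g', e₁, e₂, e₃⟩)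
          exacts [⟨g', e₁, by omega, e₃⟩, ⟨g', by omega, by omega, e₃⟩]
        · rintro ⟨g', e₁, e₂, e₃⟩
          rcases lt_or_ge g' (j + 2 ^ k) with h | h
          exacts [Or.inl ⟨g', e₁, h, e₃⟩, Or.inr ⟨g', h, by omega, e₃⟩]
      have han := IsBest_le hcomb (n := δ.n) (fun p hp => hpn (by omega) hp)
      refine .seq (.st ((k + 1) * δ.G + j) a (by simp [hv, hd₁, hG₁, h₅]) (by simp [h₉])
        (by omega) (by omega) ?_)
      refine .asg (j + 1 : ℕ) (by simp [hv, h₅]) ⟨by simp, fun g hg => ?_, fun m hm => ?_, ?_⟩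
      · simp only [AS.setv_a, AS.seta_a, if_true]
        rcases Nat.lt_succ_iff_lt_or_eq.1 hg with hg' | rfl
        · rw [Function.update_of_ne (by omega), ha₂]
          exact h₆ g hg'
        · rw [Function.update_self]
          exact hcomb
      · simp only [AS.setv_a, AS.seta_a, if_true]
        rw [Function.update_of_ne (by omega), ha₂, h₇ m hm]
      · simp only [AS.setv_clk, AS.seta_clk, AS.tick_clk] at h₁₁ ⊢
        omega
    · rintro s₁ hf₁ ⟨h₅, h₆, h₇, h₈⟩
      have hG₁ : s₁.v .G = δ.G := by
        rw [hf₁.1 _ (by cases sg <;> rfl)]; simp [hc'.G]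
      have hd₁ : s₁.v .d = k := by
        rw [hf₁.1 _ (by cases sg <;> rfl)]; simp [h₁]
      have hw₁ : s₁.v .w = (2 ^ k : ℕ) := by
        rw [hf₁.1 _ (by cases sg <;> rfl)]; simp [h₂]
      refine ⟨?_, ?_⟩
      · simp only [Ex.val_add, Ex.val_mul, Ex.val_var, Ex.val_ofNat, Ex.val_one, h₅, hw₁, hG₁,
          not_lt]
        have : δ.G + 1 ≤ δ.G + 1 - 2 ^ (k + 1) + 2 * 2 ^ k := by omega
        exact_mod_cast this
      refine .seq (.asg (2 ^ (k + 1) : ℕ) (by simp [hw₁]; ring) ?_)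
      refine .asg (k + 1 : ℕ) (by simp [hd₁]) ⟨by simp, by simp, fun d hd g hg => ?_, ?_⟩
      · simp only [AS.setv_a, AS.tick_a]
        rcases Nat.le_succ_iff_eq_or_le.1 hd with rfl | hd'
        · exact h₆ g (by omega)
        · rw [h₇]
          · exact h₃ d hd' g hg
          · have : d * δ.G ≤ k * δ.G := Nat.mul_le_mul_right _ hd'
            have : 1 ≤ 2 ^ d := Nat.one_le_two_pow
            omega
      · have : (k + 1) * (11 * δ.G + 16) = k * (11 * δ.G + 16) + (11 * δ.G + 16) := by ring
        simp only [AS.setv_clk, AS.tick_clk]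
        omega
  · rintro s' hf ⟨h₁, h₂, h₃, h₄⟩
    have hD : s'.v .D = δ.D := by rw [hf.1 _ (by cases sg <;> rfl)]; simp [hc.D]
    exact ⟨by simp [h₁, hD], h₃, by simp; omega⟩

end Dat


/-! ## The preprocessing -/

section Programs
open Cmd Var

/-- Process the cell `g`. -/
def cellProg (J : ℕ) : Cmd :=
  flr i (⇡g / ⇡NC) ;; ld A .pw ⇡i ;; ld R .pw (⇡L - ⇡i) ;; asg r (⇡g - ⇡i * ⇡NC) ;;
  flr c (⇡r / ⇡R) ;; asg r (⇡r - ⇡c * ⇡R) ;; ld h0 .head ⇡g ;; searchProg J ;;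
  st .ptr ⇡g ⇡F ;; st .tab ⇡F ⇡B ;; tableProg (4 * J + 1) ;;
  asg F (⇡F + 1 + ⇡B * ⇡B * ⇡B * ⇡B * .lit (4 * J + 1)) ;;
  baseProg true .mn ;; baseProg false .mx ;; asg g (⇡g + 1)

/-- Process all cells. -/
def cellsProg (J : ℕ) : Cmd := asg F 0 ;; asg g 0 ;; wh ⇡g ⇡G (cellProg J)

/-- The preprocessing. -/
def buildProg (K J : ℕ) : Cmd :=
  paramProg K ;; smallTabProg ;; listProg ;; cellsProg J ;; sparseProg true .mn ;;
  sparseProg false .mx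

end Programs

namespace Dat

variable (δ : Dat)

/-- The position of the table of a cell. -/
noncomputable def off (g : ℕ) : ℕ := ∑ j ∈ Finset.range g, (1 + δ.B j ^ 4 * δ.N)

/-- The tables of the cells below `k`. -/
structure Tables (k : ℕ) (s : AS) : Prop where
  ptr : ∀ g < k, s.a .ptr g = δ.off g
  tabB : ∀ g < k, s.a .tab (δ.off g) = δ.B g
  slot : ∀ g < k, ∀ e < δ.B g ^ 4, ∀ t < δ.N, s.a .tab (δ.off g + 1 + e * δ.N + t) =
    δ.slot g (δ.B g) (e / δ.B g / δ.B g / δ.B g) (e / δ.B g / δ.B g % δ.B g) (e / δ.B g % δ.B g)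
      (e % δ.B g) t

/-- The data structure. -/
structure Valid (s : AS) : Prop where
  small : δ.Small s
  tables : δ.Tables δ.G s
  mn : ∀ d ≤ δ.D, ∀ g, g + 2 ^ d ≤ δ.G →
    IsBest (δ.key true) (δ.InCells g (2 ^ d)) (s.a .mn (d * δ.G + g))
  mx : ∀ d ≤ δ.D, ∀ g, g + 2 ^ d ≤ δ.G →
    IsBest (δ.key false) (δ.InCells g (2 ^ d)) (s.a .mx (d * δ.G + g))

theorem off_succ (g : ℕ) : δ.off (g + 1) = δ.off g + 1 + δ.B g ^ 4 * δ.N := by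
  rw [off, Finset.sum_range_succ, ← add_assoc]; rfl

theorem off_mono : Monotone δ.off := monotone_nat_of_le_succ fun g => by rw [off_succ]; omega

theorem off_le : δ.off δ.G ≤ (δ.N + 1) * ∑ g ∈ Finset.range δ.G, δ.B g ^ 5 := by
  rw [off, Finset.mul_sum]
  refine Finset.sum_le_sum fun g _ => ?_
  have h₁ : 1 ≤ δ.B g ^ 5 := Nat.one_le_pow _ _ (δ.B_pos g)
  have h₂ : δ.B g ^ 4 ≤ δ.B g ^ 5 := Nat.pow_le_pow_right (δ.B_pos g) (by norm_num)
  nlinarith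

variable {δ}

theorem Fits.off {z : Cfg} (hz : δ.Fits z) : δ.off δ.G + δ.G ≤ z.I := by
  refine le_trans ?_ hz.I
  have h₁ := δ.off_le
  rw [cost, mul_add]
  have : δ.G ≤ (δ.N + 1) * ((δ.D + 2) * δ.G) := by
    rw [← mul_assoc]; exact Nat.le_mul_of_pos_left _ (by positivity)
  omega

theorem cellProg_spec {z : Cfg} (hz : δ.Fits z) (hδ : δ.Good) {k : ℕ} (hk : k < δ.G) {s : AS}
    (hc : δ.Ctx s) (hs : δ.Small s)
    (hl : ∀ g, Chain (s.a .nxt) (s.a .head g) (δ.items ((δ.L + 1) * δ.n) g))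
    (hg : s.v .g = k) (hF : s.v .F = δ.off k) (hT : δ.Tables k s)
    (h0 : ∀ j ≥ δ.off k, s.a .tab j = 0)
    (hmn : ∀ g < k, IsBest (δ.key true) (fun p => p ∈ δ.pts g) (s.a .mn g))
    (hmx : ∀ g < k, IsBest (δ.key false) (fun p => p ∈ δ.pts g) (s.a .mx g)) :
    Wp z (cellProg δ.J) s fun s' => s'.v .g = (k + 1 : ℕ) ∧ s'.v .F = δ.off (k + 1) ∧
      δ.Tables (k + 1) s' ∧ (∀ j ≥ δ.off (k + 1), s'.a .tab j = 0) ∧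
      (∀ g < k + 1, IsBest (δ.key true) (fun p => p ∈ δ.pts g) (s'.a .mn g)) ∧
      (∀ g < k + 1, IsBest (δ.key false) (fun p => p ∈ δ.pts g) (s'.a .mx g)) ∧
      s'.clk + 1 ≤ s.clk + 150 * (δ.J + 1) * δ.B k ^ 5 := by
  have hG := hz.G
  have hQG := δ.Q_le_G
  have hIW := hz.I_le
  have hLQ := δ.L_lt_Q
  have hoff := hz.off
  have hlev : δ.lev k ≤ δ.L := lev_le hk
  have hLs : δ.L - δ.lev k ≤ δ.L := Nat.sub_le _ _
  have hofk := δ.off_succ k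
  have hofk' : δ.off (k + 1) ≤ δ.off δ.G := δ.off_mono hk
  have hBQ := δ.B_le_Q k
  have hB0 := δ.B_pos k
  have hdm : k / δ.NC ≤ k := Nat.div_le_self _ _
  have hmm : k % δ.NC / δ.rows k ≤ k := (Nat.div_le_self _ _).trans (Nat.mod_le _ _)
  refine .seq (.flr (δ.lev k) (by simp [hg, hc.NC]; positivity) ?_ (by omega) ?_)
  · simpa [hg, hc.NC, lev] using Nat.floor_div_eq_div (K := ℝ) k δ.NC
  refine .seq (.ld (δ.lev k) (δ.cols k) (by simp) (by omega) (hs.pw _ hlev) ?_)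
  refine .seq (.ld (δ.L - δ.lev k) (δ.rows k) (by simp [hc.L, Nat.cast_sub hlev]) (by omega)
    (hs.pw _ hLs) ?_)
  refine .seq (.asg (k % δ.NC : ℕ) (by simpa [hg, hc.NC, lev] using cast_sub_div_mul k δ.NC) ?_)
  refine .seq (.flr (δ.col k) (by simp; positivity) ?_ (hmm.trans_lt (by omega)) ?_)
  · simpa [col] using Nat.floor_div_eq_div (K := ℝ) (k % δ.NC) (δ.rows k)
  refine .seq (.asg (δ.row k : ℕ)
    (by simpa [col, row] using cast_sub_div_mul (k % δ.NC) (δ.rows k)) ?_)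
  refine .seq (.ld k _ (by simp [hg]) (by omega) rfl ?_)
  refine .seq (.use (searchProg_spec hz hδ (g := k) (fun B => ⟨by simp [hc.n], by simp [hc.Q],
    by simp, by simp, by simp, by simp, by simp, by simp, ⟨_, by simp; rfl, by simpa using hl k⟩⟩))
    ?_)
  rintro s₁ ⟨c₁, t₁⟩ f₁
  have g₁ : s₁.v .g = k := by rw [f₁.1 _ rfl]; simp [hg]
  have F₁ : s₁.v .F = δ.off k := by rw [f₁.1 _ rfl]; simp [hF]
  have a₁ : ∀ u, u ≠ .nxt → s₁.a u = s.a u := by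
    intro u hu; rw [f₁.2 _ rfl]; rfl
  have hm₁ : s₁.a .mn = s.a .mn := a₁ _ (by simp)
  have hm₂ : s₁.a .mx = s.a .mx := a₁ _ (by simp)
  simp only [AS.setv_clk] at t₁
  refine .seq (.st k (δ.off k) (by simp [g₁]) (by simp [F₁]) (by omega) (by omega) ?_)
  refine .seq (.st (δ.off k) (δ.B k) (by simp [F₁]) (by simp [c₁.B]) (by omega) (by omega) ?_)
  refine .seq (.use (tableProg_spec hz hδ (g := k) (B := δ.B k) (F := δ.off k)
    ⟨by simp [c₁.n], by simp [c₁.Q], by simp [c₁.i], by simp [c₁.A], by simp [c₁.R],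
      by simp [c₁.c], by simp [c₁.r], by simp [c₁.B], by simpa using c₁.h0⟩ hB0 hBQ
    (by simp [F₁]) (by omega) ?_) ?_)
  · intro j hj
    simp only [AS.seta_a, if_true, reduceCtorEq, if_false]
    rw [Function.update_of_ne (by omega), a₁ _ (by simp), h0 j (by omega)]
  rintro s₂ ⟨h₁, h₂, t₂⟩ f₂
  simp only [AS.seta_a, if_true, reduceCtorEq, if_false] at h₂
  have B₂ : s₂.v .B = δ.B k := by rw [f₂.1 _ rfl]; simp [c₁.B]
  have F₂ : s₂.v .F = δ.off k := by rw [f₂.1 _ rfl]; simp [F₁]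
  have c₂ : δ.CellCtx k (δ.B k) s₂ := CellCtx.frame (s := (s₁.seta .ptr k (δ.off k)).seta .tab
    (δ.off k) (δ.B k)) ⟨by simp [c₁.n], by simp [c₁.Q], by simp [c₁.i], by simp [c₁.A],
    by simp [c₁.R], by simp [c₁.c], by simp [c₁.r], by simp [c₁.B], by simpa using c₁.h0⟩ f₂ rfl
    rfl
  have g₂ : s₂.v .g = k := by rw [f₂.1 _ rfl]; simp [g₁]
  refine .seq (.asg (δ.off (k + 1)) ?_ ?_)
  · rw [hofk]
    simp only [Ex.val_add, Ex.val_mul, Ex.val_var, Ex.val_lit, Ex.val_one, B₂, F₂, Dat.N]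
    push_cast
    ring
  refine .seq (.use (baseProg_spec hz hδ (q := .mn) (sg := true) (g := k) (B := δ.B k) hk
    ⟨by simp [c₂.n], by simp [c₂.Q], by simp [c₂.i], by simp [c₂.A], by simp [c₂.R],
      by simp [c₂.c], by simp [c₂.r], by simp [c₂.B], by simpa using c₂.h0⟩ (by simp [g₂])) ?_)
  rintro s₃ ⟨⟨am, h₃, h₄⟩, t₃⟩ f₃
  have c₃ : δ.CellCtx k (δ.B k) s₃ := CellCtx.frame (s := s₂.setv .F (δ.off (k + 1)))
    ⟨by simp [c₂.n], by simp [c₂.Q], by simp [c₂.i], by simp [c₂.A],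
    by simp [c₂.R], by simp [c₂.c], by simp [c₂.r], by simp [c₂.B], by simpa using c₂.h0⟩ f₃ rfl
    rfl
  have g₃ : s₃.v .g = k := by rw [f₃.1 _ rfl]; simp [g₂]
  have F₃ : s₃.v .F = δ.off (k + 1) := by rw [f₃.1 _ rfl]; simp
  refine .seq (.use (baseProg_spec hz hδ (q := .mx) (sg := false) (g := k) (B := δ.B k) hk c₃ g₃)
    ?_)
  rintro s₄ ⟨⟨ax, h₅, h₆⟩, t₄⟩ f₄
  have g₄ : s₄.v .g = k := by rw [f₄.1 _ rfl]; simp [g₃]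
  have F₄ : s₄.v .F = δ.off (k + 1) := by rw [f₄.1 _ rfl, F₃]
  have tab₄ : s₄.a .tab = s₂.a .tab := by rw [f₄.2 _ rfl, f₃.2 _ rfl]; rfl
  have ptr₄ : s₄.a .ptr = Function.update (s.a .ptr) k (δ.off k) := by
    rw [f₄.2 _ rfl, f₃.2 _ rfl, AS.setv_a, f₂.2 _ rfl]
    simp [a₁]
  have mn₄ : s₄.a .mn = Function.update (s.a .mn) k am := by
    rw [f₄.2 _ rfl, h₄, AS.setv_a, f₂.2 _ rfl]
    simp [hm₁]
  have mx₄ : s₄.a .mx = Function.update (s.a .mx) k ax := by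
    rw [h₆, f₃.2 _ rfl, AS.setv_a, f₂.2 _ rfl]
    simp [hm₂]
  have old : ∀ j < δ.off k, s₂.a .tab j = s.a .tab j := by
    intro j hj
    rw [h₂ j (by omega), Function.update_of_ne (by omega), a₁ _ (by simp)]
  have hall : ∀ {P : ℕ → Prop}, (∀ g < k, P g) → P k → ∀ g < k + 1, P g := by
    intro P h h' g hg
    rcases Nat.lt_succ_iff_lt_or_eq.1 hg with h'' | rfl
    exacts [h g h'', h']
  refine .asg (k + 1 : ℕ) (by simp [g₄]) ⟨by simp, by simp [F₄], ⟨?_, ?_, ?_⟩, ?_, ?_, ?_, ?_⟩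
  · simp only [AS.setv_a, ptr₄]
    refine hall (fun g hg => ?_) (by simp)
    rw [Function.update_of_ne (by omega), hT.ptr g hg]
  · simp only [AS.setv_a, tab₄]
    refine hall (fun g hg => ?_) ?_
    · have : δ.off (g + 1) ≤ δ.off k := δ.off_mono hg
      rw [off_succ] at this
      rw [old _ (by omega), hT.tabB g hg]
    · rw [h₂ _ (by omega), Function.update_self]
  · simp only [AS.setv_a, tab₄]
    refine hall (fun g hg e he t ht => ?_) h₁
    have h' : δ.off (g + 1) ≤ δ.off k := δ.off_mono hg
    rw [off_succ] at h'
    have : e * δ.N + δ.N ≤ δ.B g ^ 4 * δ.N := by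
      rw [← Nat.succ_mul]; exact Nat.mul_le_mul_right _ he
    rw [old _ (by omega), hT.slot g hg e he t ht]
  · intro j hj
    simp only [AS.setv_a, tab₄]
    rw [h₂ j (by omega), Function.update_of_ne (by omega), a₁ _ (by simp), h0 j (by omega)]
  · simp only [AS.setv_a, mn₄]
    refine hall (fun g hg => ?_) (by simpa using h₃)
    rw [Function.update_of_ne (by omega)]
    exact hmn g hg
  · simp only [AS.setv_a, mx₄]
    refine hall (fun g hg => ?_) (by simpa using h₅)
    rw [Function.update_of_ne (by omega)]
    exact hmx g hg
  -- With `b` points in the cell, the search for `B` costs `O(B * b + B)`, the table `O(B ^ 4 * b +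
  -- B ^ 4)` and the extremal points `O(b + 1)`. As `b ≤ (J + 1) * B`, everything is `O((J + 1) * B
  -- ^ 5)`.
  · have hb := hδ.length_pts_le_B hk
    simp only [AS.setv_clk, AS.seta_clk] at t₁ t₂ t₃ t₄ ⊢
    set b := (δ.pts k).length
    set B := δ.B k
    set J := δ.J
    have i₁ : B ≤ B ^ 5 := Nat.le_self_pow (by norm_num) B
    have i₂ : B ^ 4 ≤ B ^ 5 := Nat.pow_le_pow_right hB0 (by norm_num)
    have i₃ : B * B ≤ B ^ 5 := by
      rw [← pow_two]; exact Nat.pow_le_pow_right hB0 (by norm_num)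
    have j₁ : b ≤ (J + 1) * B ^ 5 := hb.trans (Nat.mul_le_mul_left _ i₁)
    have j₂ : B * b ≤ (J + 1) * B ^ 5 := by
      calc B * b ≤ B * ((J + 1) * B) := Nat.mul_le_mul_left _ hb
        _ = (J + 1) * (B * B) := by ring
        _ ≤ _ := Nat.mul_le_mul_left _ i₃
    have j₃ : B ^ 4 * b ≤ (J + 1) * B ^ 5 := by
      calc B ^ 4 * b ≤ B ^ 4 * ((J + 1) * B) := Nat.mul_le_mul_left _ hb
        _ = (J + 1) * B ^ 5 := by ring
    have j₄ : B ^ 5 ≤ (J + 1) * B ^ 5 := Nat.le_mul_of_pos_left _ (Nat.succ_pos _)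
    have e₁ : 2 * B * (19 * b + 17) = 38 * (B * b) + 34 * B := by ring
    have e₂ : B ^ 4 * (20 * b + 11) = 20 * (B ^ 4 * b) + 11 * B ^ 4 := by ring
    rw [e₁] at t₁
    rw [e₂] at t₂
    rw [mul_assoc]
    omega

theorem cellsProg_spec {z : Cfg} (hz : δ.Fits z) (hδ : δ.Good) {s : AS}
    (hc : δ.Ctx s) (hs : δ.Small s)
    (hl : ∀ g, Chain (s.a .nxt) (s.a .head g) (δ.items ((δ.L + 1) * δ.n) g))
    (h0 : ∀ j, s.a .tab j = 0) :
    Wp z (cellsProg δ.J) s fun s' => δ.Tables δ.G s' ∧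
      (∀ g < δ.G, IsBest (δ.key true) (fun p => p ∈ δ.pts g) (s'.a .mn g)) ∧
      (∀ g < δ.G, IsBest (δ.key false) (fun p => p ∈ δ.pts g) (s'.a .mx g)) ∧
      s'.clk ≤ s.clk + 3 + 150 * (δ.J + 1) * ∑ g ∈ Finset.range δ.G, δ.B g ^ 5 := by
  refine .seq (.asg 0 (by simp) (.seq (.asg 0 (by simp) ?_)))
  refine .wh δ.G (fun k s' => s'.v .g = k ∧ s'.v .F = δ.off k ∧ δ.Tables k s' ∧
      (∀ j ≥ δ.off k, s'.a .tab j = 0) ∧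
      (∀ g < k, IsBest (δ.key true) (fun p => p ∈ δ.pts g) (s'.a .mn g)) ∧
      (∀ g < k, IsBest (δ.key false) (fun p => p ∈ δ.pts g) (s'.a .mx g)) ∧
      s'.clk ≤ s.clk + 2 + 150 * (δ.J + 1) * ∑ g ∈ Finset.range k, δ.B g ^ 5) ?_ ?_ ?_
  · exact ⟨by simp, by simp [off], ⟨by simp, by simp, by simp⟩, fun j _ => h0 j, by simp, by simp,
      by simp⟩
  · rintro k hk s' hf ⟨h₁, h₂, h₃, h₄, h₅, h₆, h₇⟩
    have hc' : δ.Ctx s' := Ctx.frame (s := (s.setv .F 0).setv .g 0)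
      ⟨by simp [hc.n], by simp [hc.Q], by simp [hc.L], by simp [hc.D], by simp [hc.NC],
        by simp [hc.G]⟩ hf rfl
    have hs' : δ.Small s' := Small.frame (s := (s.setv .F 0).setv .g 0)
      ⟨hs.1, hs.2, hs.3, hs.4, hs.5⟩ hf rfl
    have hl' : ∀ g, Chain (s'.a .nxt) (s'.a .head g) (δ.items ((δ.L + 1) * δ.n) g) := by
      rw [hf.2 _ rfl, hf.2 _ rfl]; exact hl
    refine ⟨by simp [h₁, hc'.G]; exact hk, ?_⟩
    refine .mono (cellProg_spec hz hδ hk (s := s'.tick) ⟨hc'.1, hc'.2, hc'.3, hc'.4, hc'.5, hc'.6⟩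
      ⟨hs'.1, hs'.2, hs'.3, hs'.4, hs'.5⟩ hl' h₁ h₂ ⟨h₃.1, h₃.2, h₃.3⟩ h₄ h₅ h₆) ?_
    rintro s₁ ⟨e₁, e₂, e₃, e₄, e₅, e₆, e₇⟩
    refine ⟨e₁, e₂, e₃, e₄, e₅, e₆, ?_⟩
    rw [Finset.sum_range_succ, mul_add]
    simp only [AS.tick_clk] at e₇
    omega
  · rintro s' hf ⟨h₁, h₂, h₃, h₄, h₅, h₆, h₇⟩
    have hG : s'.v .G = δ.G := by rw [hf.1 _ rfl]; simp [hc.G]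
    exact ⟨by simp [h₁, hG], ⟨h₃.1, h₃.2, h₃.3⟩, h₅, h₆, by simp; omega⟩

theorem buildProg_spec {z : Cfg} (hz : δ.Fits z) (hδ : δ.Good) {K : ℕ}
    (hL : δ.L = Nat.clog 2 δ.n) (hD : δ.D = Nat.clog 2 (K * δ.L)) {s : AS} (hn : s.v .n = δ.n)
    (ha : ∀ u j, s.a u j = 0) :
    Wp z (buildProg K δ.J) s fun s' => δ.Valid s' ∧
      s'.clk ≤ s.clk + 200 * (δ.J + 1) * δ.cost := by
  refine .seq (.use (paramProg_spec hz hδ hL hD hn) ?_)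
  rintro s₁ ⟨c₁, p₀, p₁, p₂, t₁⟩ f₁
  refine .seq (.use (smallTabProg_spec hz c₁ (by rw [f₁.2 _ rfl]; exact ha _)) ?_)
  rintro s₂ ⟨pw₂, lg₂, t₂⟩ f₂
  have c₂ := c₁.frame f₂ rfl
  have sm₂ : δ.Small s₂ := ⟨by rw [f₂.2 _ rfl, p₀], by rw [f₂.2 _ rfl, p₁], by rw [f₂.2 _ rfl, p₂],
    pw₂, lg₂⟩
  refine .seq (.use (listProg_spec hz hδ c₂ sm₂ (by rw [f₂.2 _ rfl, f₁.2 _ rfl]; exact ha _)) ?_)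
  rintro s₃ ⟨l₃, t₃⟩ f₃
  have c₃ := c₂.frame f₃ rfl
  have sm₃ := sm₂.frame f₃ rfl
  refine .seq (.use (cellsProg_spec hz hδ c₃ sm₃ l₃
    (by rw [f₃.2 _ rfl, f₂.2 _ rfl, f₁.2 _ rfl]; exact ha _)) ?_)
  rintro s₄ ⟨T₄, mn₄, mx₄, t₄⟩ f₄
  have c₄ := c₃.frame f₄ rfl
  have sm₄ := sm₃.frame f₄ rfl
  refine .seq (.use (sparseProg_spec hz hδ c₄ mn₄) ?_)
  rintro s₅ ⟨mn₅, t₅⟩ f₅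
  have c₅ := c₄.frame f₅ rfl
  have sm₅ := sm₄.frame f₅ rfl
  refine .use (sparseProg_spec hz hδ (q := .mx) (sg := false) c₅
    (by rw [f₅.2 _ rfl]; exact mx₄)) ?_
  rintro s₆ ⟨mx₆, t₆⟩ f₆
  refine ⟨⟨sm₅.frame f₆ rfl, ⟨?_, ?_, ?_⟩, ?_, mx₆⟩, ?_⟩
  · rw [f₆.2 _ rfl, f₅.2 _ rfl]; exact T₄.ptr
  · rw [f₆.2 _ rfl, f₅.2 _ rfl]; exact T₄.tabB
  · rw [f₆.2 _ rfl, f₅.2 _ rfl]; exact T₄.slot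
  · rw [f₆.2 _ rfl]; exact mn₅
  · have hQG := δ.Q_le_G
    have hLQ := δ.L_lt_Q
    have hQ := δ.Q_pos
    have hnG : (δ.L + 1) * δ.n ≤ δ.G :=
      Nat.mul_le_mul_left _ (hδ.le_Q.trans (Nat.le_mul_of_pos_left _ (by norm_num)))
    have hDG : δ.D ≤ δ.D * δ.G := Nat.le_mul_of_pos_right _ (by omega)
    have e₁ : (δ.D + 2) * δ.G = δ.D * δ.G + 2 * δ.G := by ring
    have e₂ : δ.D * (11 * δ.G + 16) = 11 * (δ.D * δ.G) + 16 * δ.D := by ring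
    have e₃ : 200 * (δ.J + 1) * δ.cost = 200 * ((δ.J + 1) * ((δ.D + 2) * δ.G)) +
        200 * ((δ.J + 1) * ∑ g ∈ Finset.range δ.G, δ.B g ^ 5) := by rw [cost]; ring
    have e₄ : (δ.D + 2) * δ.G ≤ (δ.J + 1) * ((δ.D + 2) * δ.G) :=
      Nat.le_mul_of_pos_left _ (Nat.succ_pos _)
    rw [mul_assoc] at t₄
    rw [e₂] at t₅ t₆
    omega

end Dat


/-! ## Queries -/

section Programs
open Cmd Var

/-- Test whether the point `a - 1` lies in the rectangle. -/
def testProg : Cmd :=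
  ite 0 ⇡a (pt px (2 * ⇡a - 2) ;; pt py (2 * ⇡a - 1) ;; ite ⇡x ⇡px (ite ⇡x' ⇡px skip
    (ite ⇡y ⇡py (ite ⇡y' ⇡py skip (asg ans 0)) skip)) skip) skip

/-- Search the cell in column `c` and row `u`. -/
def cellQuery (N : ℕ) (u : Var) : Cmd :=
  asg g (⇡i * ⇡NC + ⇡c * ⇡R + ⇡u) ;; ld F .ptr ⇡g ;; ld B .tab ⇡F ;;
  subProg a1 (⇡x * ⇡A - ⇡c) ;; subProg a2 (⇡x' * ⇡A - ⇡c) ;; subProg b1 (⇡y * ⇡R - ⇡u) ;;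
  subProg b2 (⇡y' * ⇡R - ⇡u) ;; asg e (((⇡a1 * ⇡B + ⇡a2) * ⇡B + ⇡b1) * ⇡B + ⇡b2) ;; asg t 0 ;;
  wh ⇡t (.lit N) (ld a .tab (⇡F + 1 + ⇡e * .lit N + ⇡t) ;; testProg ;; asg t (⇡t + 1))

/-- Test the extremal points of the rows strictly between `r1` and `r2` of column `c`. -/
def midQuery (q : Arr) : Cmd :=
  ld a q (⇡d * ⇡G + (⇡i * ⇡NC + ⇡c * ⇡R + ⇡r1 + 1)) ;; testProg ;;
  ld a q (⇡d * ⇡G + (⇡i * ⇡NC + ⇡c * ⇡R + ⇡r2 - ⇡w)) ;; testProg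

/-- Search the columns `c1, …, c2`. -/
def colsQuery (N : ℕ) : Cmd :=
  asg c ⇡c1 ;; wh ⇡c (⇡c2 + 1) (cellQuery N r1 ;; cellQuery N r2 ;;
    ite (⇡r1 + 1) ⇡r2 (midQuery .mn ;; midQuery .mx) skip ;; asg c (⇡c + 1))

/-- Find the cells of a suitable level that meet the rectangle. -/
def levelQuery : Cmd :=
  ld Q .par 0 ;; ld L .par 1 ;; ld D .par 2 ;; asg NC (4 * ⇡Q) ;; asg G ((⇡L + 1) * ⇡NC) ;;
  flr m (⇡Q * (⇡x' - ⇡x)) ;; ld e .lg ⇡m ;; ite 1 ⇡e (asg i (⇡L + 1 - ⇡e)) (asg i ⇡L) ;;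
  ld A .pw ⇡i ;; ld R .pw (⇡L - ⇡i) ;; flr c1 (⇡x * ⇡A) ;; flr c2 (⇡x' * ⇡A) ;;
  flr r1 (⇡y * ⇡R) ;; flr r2 (⇡y' * ⇡R) ;; asg d 0 ;;
  ite (⇡r1 + 1) ⇡r2 (ld d .lg (⇡r2 - ⇡r1 - 1)) skip

/-- The query for a nonempty rectangle in the unit square. -/
def unitQuery (N : ℕ) : Cmd :=
  levelQuery ;; ite ⇡d ⇡D (ld w .pw ⇡d ;; colsQuery N) (asg ans 0)

/-- The query; `ans` becomes `1` if the rectangle is found to be empty. -/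
def queryProg (J : ℕ) : Cmd :=
  asg ans 1 ;; ite ⇡x 0 (asg x 0) skip ;; ite ⇡y 0 (asg y 0) skip ;; ite 1 ⇡x' (asg x' 1) skip ;;
  ite 1 ⇡y' (asg y' 1) skip ;; ite ⇡x ⇡x' (ite ⇡y ⇡y' (unitQuery (4 * J + 1)) skip) skip

end Programs

/-- A rectangle. -/
structure Rect where
  x : ℝ
  x' : ℝ
  y : ℝ
  y' : ℝ

namespace Dat

variable (δ : Dat)

/-- The point `p` lies in the rectangle. -/
def Inside (ρ : Rect) (p : ℕ) : Prop :=
  p < δ.n ∧ ρ.x < δ.px p ∧ δ.px p ≤ ρ.x' ∧ ρ.y < δ.py p ∧ δ.py p ≤ Rect.y' ρ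

/-- The conditions under which the queries are answered correctly: the cells are divided finely
enough, and `2 ^ D` consecutive cells of a column contain a point. -/
structure Regular : Prop where
  fine : ∀ g < δ.G, δ.Fine g (δ.B g)
  run : ∀ i ≤ δ.L, ∀ c < 2 ^ i, ∀ r, r + 2 ^ δ.D ≤ 2 ^ (δ.L - i) → ∃ p < δ.n,
    ⌊δ.px p * (2 ^ i : ℕ)⌋₊ = c ∧ r ≤ ⌊δ.py p * (2 ^ (δ.L - i) : ℕ)⌋₊ ∧
      ⌊δ.py p * (2 ^ (δ.L - i) : ℕ)⌋₊ < r + 2 ^ δ.D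

/-- The answer is correct as far as the points in `T` are concerned. -/
def Res (ρ : Rect) (T : ℕ → Prop) (s : AS) : Prop :=
  (s.v .ans = 0 ∧ (δ.Regular → ∃ p, δ.Inside ρ p)) ∨
    (s.v .ans = 1 ∧ (δ.Regular → ∀ p, T p → ¬ δ.Inside ρ p))

/-- The rectangle is stored in the variables. -/
structure RectCtx (ρ : Rect) (s : AS) : Prop where
  x : s.v .x = ρ.x
  x' : s.v .x' = ρ.x'
  y : s.v .y = ρ.y
  y' : s.v .y' = ρ.y'

variable {δ} {ρ : Rect}

theorem Valid.of_eq {s s' : AS} (h : δ.Valid s) (ha : s'.a = s.a) : δ.Valid s' := by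
  obtain ⟨⟨h₁, h₂, h₃, h₄, h₅⟩, ⟨h₆, h₇, h₈⟩, h₉, h₁₀⟩ := h
  rw [← ha] at *
  exact ⟨⟨h₁, h₂, h₃, h₄, h₅⟩, ⟨h₆, h₇, h₈⟩, h₉, h₁₀⟩

theorem RectCtx.frame {c : Cmd} {s s' : AS} (h : RectCtx ρ s) (hf : Frame c s s')
    (hc : ([.x, .x', .y, .y'] : List Var).all (fun u => !c.writesVar u) = true) :
    RectCtx ρ s' := by
  simp only [List.all_cons, List.all_nil, Bool.and_true, Bool.and_eq_true,
    Bool.not_eq_true'] at hc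
  obtain ⟨h₁, h₂, h₃, h₄⟩ := hc
  exact ⟨by rw [hf.1 _ h₁, h.x], by rw [hf.1 _ h₂, h.x'], by rw [hf.1 _ h₃, h.y],
    by rw [hf.1 _ h₄, h.y']⟩

theorem Res.mono {T T' : ℕ → Prop} {s : AS} (h : δ.Res ρ T s)
    (hT : δ.Regular → ∀ p, T' p → δ.Inside ρ p → T p) : δ.Res ρ T' s :=
  h.imp id fun h => ⟨h.1, fun hr p hp hi => h.2 hr p (hT hr p hp hi) hi⟩

theorem Res.congr {T : ℕ → Prop} {s s' : AS} (h : δ.Res ρ T s) (ha : s'.v .ans = s.v .ans) :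
    δ.Res ρ T s' := by
  unfold Res at *
  rwa [ha]

/-- A candidate changes the answer only after its coordinates have been compared with the rectangle.
Hence it does not matter whether the tables supply irrelevant points, and only the completeness of
the tested set has to be tracked in `T`. -/
theorem testProg_spec {z : Cfg} (hz : δ.Fits z) (hδ : δ.Good) {s : AS} {T : ℕ → Prop} {a : ℕ}
    (hc : RectCtx ρ s) (hT : δ.Res ρ T s) (ha : s.v .a = a) (han : a ≤ δ.n) :
    Wp z testProg s fun s' => δ.Res ρ (fun p => T p ∨ a = p + 1) s' ∧ s'.clk ≤ s.clk + 8 := by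
  have hnQ := hδ.le_Q
  have hG := hz.G
  have hQG := δ.Q_le_G
  refine .ite (fun h => ?_) fun h => .skip ?_
  · simp only [Ex.val_zero, Ex.val_var, ha, Nat.cast_pos] at h
    obtain ⟨p, rfl⟩ : ∃ p, a = p + 1 := ⟨a - 1, by omega⟩
    refine .seq (.pt (2 * p) (by simp [ha]; ring) (by omega) ?_)
    refine .seq (.pt (2 * p + 1) (by simp [ha]; ring) (by omega) ?_)
    have e₁ : z.X (2 * p) = δ.px p := by rw [hz.X]; rfl
    have e₂ : z.X (2 * p + 1) = δ.py p := by rw [hz.X]; rfl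
    rw [e₁, e₂]
    have out : ∀ s' : AS, ¬ δ.Inside ρ p → s'.v .ans = s.v .ans →
        δ.Res ρ (fun q => T q ∨ p + 1 = q + 1) s' := by
      intro s' hp hs'
      refine (hT.congr hs').mono ?_
      rintro - q (hq | hq) hi
      · exact hq
      · obtain rfl : p = q := by omega
        exact absurd hi hp
    have hx := hc.x
    have hx' := hc.x'
    have hy := hc.y
    have hy' := hc.y'
    refine .ite (fun h₁ => .ite (fun h₂ => .skip ⟨out _ ?_ (by simp), by simp⟩) fun h₂ =>
      .ite (fun h₃ => .ite (fun h₄ => .skip ⟨out _ ?_ (by simp), by simp⟩) fun h₄ =>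
        .asg 0 (by simp) ⟨Or.inl ⟨by simp, fun _ => ⟨p, ?_⟩⟩, by simp⟩)
        fun h₃ => .skip ⟨out _ ?_ (by simp), by simp⟩)
      fun h₁ => .skip ⟨out _ ?_ (by simp), by simp⟩
    · simp [hx'] at h₂
      exact fun hi => absurd hi.2.2.1 (not_le.2 h₂)
    · simp [hy'] at h₄
      exact fun hi => absurd hi.2.2.2.2 (not_le.2 h₄)
    · simp only [Ex.val_var, AS.tick_v, AS.setv_v, reduceCtorEq, if_false, if_true, hx, hx', hy,
        hy', not_lt] at h₁ h₂ h₃ h₄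
      exact ⟨by omega, h₁, h₂, h₃, h₄⟩
    · simp [hy] at h₃
      exact fun hi => absurd hi.2.2.2.1 (not_lt.2 h₃)
    · simp [hx] at h₁
      exact fun hi => absurd hi.2.1 (not_lt.2 h₁)
  · simp only [Ex.val_zero, Ex.val_var, ha, Nat.cast_pos, not_lt, Nat.le_zero] at h
    subst h
    refine ⟨(hT.congr rfl).mono ?_, by simp⟩
    rintro - q (hq | hq) -
    · exact hq
    · omega

theorem length_le_countP (l : List ℕ) (f₁ f₂ f₃ f₄ : ℕ → Bool)
    (h : ∀ q ∈ l, f₁ q ∨ f₂ q ∨ f₃ q ∨ f₄ q) :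
    l.length ≤ l.countP f₁ + l.countP f₂ + l.countP f₃ + l.countP f₄ := by
  induction l with
  | nil => simp
  | cons q l ih =>
    have := ih fun q hq => h q (List.mem_cons_of_mem _ hq)
    have hq := h q List.mem_cons_self
    simp only [List.length_cons, List.countP_cons]
    rcases hq with hq | hq | hq | hq <;> simp only [hq, if_true] <;> omega

theorem lt_of_sub_lt {B : ℕ} {t t' : ℝ} (h : sub B t < sub B t') : t < t' := by
  by_contra hle
  exact absurd (sub_mono B (not_lt.1 hle)) (not_le.2 h)

/-- A table entry lists a point of the rectangle if there is one in the cell. -/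
theorem exists_slot (hδ : δ.Good) {g B p : ℕ} (hg : g < δ.G) (hF : δ.Fine g B) (hB : 0 < B)
    (hp : p ∈ δ.pts g) (hi : δ.Inside ρ p) :
    ∃ t < δ.N, ∃ q, δ.slot g B (sub B (ρ.x * δ.cols g - δ.col g))
      (sub B (ρ.x' * δ.cols g - δ.col g)) (sub B (ρ.y * δ.rows g - δ.row g))
      (sub B (ρ.y' * δ.rows g - δ.row g)) t = q + 1 ∧ δ.Inside ρ q := by
  have hA : (0 : ℝ) < δ.cols g := by exact_mod_cast δ.cols_pos g
  have hR : (0 : ℝ) < δ.rows g := by exact_mod_cast δ.rows_pos g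
  set a₁ := sub B (ρ.x * δ.cols g - δ.col g) with ha₁
  set a₂ := sub B (ρ.x' * δ.cols g - δ.col g) with ha₂
  set b₁ := sub B (ρ.y * δ.rows g - δ.row g) with hb₁
  set b₂ := sub B (ρ.y' * δ.rows g - δ.row g) with hb₂
  obtain ⟨hpn, i₁, i₂, i₃, i₄⟩ := hi
  set fl := (δ.pts g).filter (δ.inRange g B a₁ a₂ b₁ b₂) with hfl
  have hpf : p ∈ fl := by
    rw [hfl, List.mem_filter]
    refine ⟨hp, ?_⟩
    simp only [inRange, decide_eq_true_eq]
    refine ⟨sub_mono B ?_, sub_mono B ?_, sub_mono B ?_, sub_mono B ?_⟩ <;> nlinarith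
  have hslot : ∀ (t : ℕ) (ht : t < fl.length), δ.slot g B a₁ a₂ b₁ b₂ t = fl[t] + 1 := by
    intro t ht
    simp only [slot, ← hfl]
    rw [List.getD_eq_getElem _ _ (by simpa using ht)]
    simp
  -- If the list fits into the entry, `p` itself is listed. Otherwise `N = 4 * J + 1` points are
  -- listed, while the two outer subcolumns and the two outer subrows together hold at most `4 * J`;
  -- a listed point outside them lies strictly between the sides of the rectangle.
  by_cases hlen : fl.length ≤ δ.N
  · obtain ⟨t, ht, rfl⟩ := List.getElem_of_mem hpf
    exact ⟨t, by omega, _, hslot t ht, hpn, i₁, i₂, i₃, i₄⟩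
  · by_contra hcon
    push Not at hcon
    have hsub : (fl.take δ.N).Sublist (δ.pts g) :=
      (List.take_sublist _ _).trans List.filter_sublist
    have hall : ∀ q ∈ fl.take δ.N, decide (δ.sx g B q = a₁) ∨ decide (δ.sx g B q = a₂) ∨
        decide (δ.sy g B q = b₁) ∨ decide (δ.sy g B q = b₂) := by
      intro q hq
      obtain ⟨t, ht, rfl⟩ := List.getElem_of_mem hq
      simp only [List.length_take, lt_min_iff] at ht
      have hqf : fl[t] ∈ fl := List.getElem_mem ht.2
      replace hqf := List.mem_filter.1 hqf
      have hni := hcon t ht.1 _ (hslot t ht.2)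
      have hr := hqf.2
      simp only [inRange, decide_eq_true_eq] at hr
      simp only [List.getElem_take, decide_eq_true_eq]
      by_contra hne
      push Not at hne
      obtain ⟨n₁, n₂, n₃, n₄⟩ := hne
      obtain ⟨r₁, r₂, r₃, r₄⟩ := hr
      refine hni ⟨((hδ.mem_pts hg).1 hqf.1).1, ?_, ?_, ?_, ?_⟩
      · have := lt_of_sub_lt (lt_of_le_of_ne r₁ (Ne.symm n₁)); nlinarith
      · have := lt_of_sub_lt (lt_of_le_of_ne r₂ n₂); nlinarith
      · have := lt_of_sub_lt (lt_of_le_of_ne r₃ (Ne.symm n₃)); nlinarith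
      · have := lt_of_sub_lt (lt_of_le_of_ne r₄ n₄); nlinarith
    have h₁ := length_le_countP _ _ _ _ _ hall
    have hl : ∀ t, sub B t < B := fun t => sub_lt hB t
    have k₁ := (hsub.countP_le (p := fun q => decide (δ.sx g B q = a₁))).trans (hF a₁ (hl _)).1
    have k₂ := (hsub.countP_le (p := fun q => decide (δ.sx g B q = a₂))).trans (hF a₂ (hl _)).1
    have k₃ := (hsub.countP_le (p := fun q => decide (δ.sy g B q = b₁))).trans (hF b₁ (hl _)).2
    have k₄ := (hsub.countP_le (p := fun q => decide (δ.sy g B q = b₂))).trans (hF b₂ (hl _)).2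
    rw [List.length_take, min_eq_left (by omega)] at h₁
    simp only [N] at h₁ k₁ k₂ k₃ k₄
    omega

theorem slot_le (hδ : δ.Good) {g B a₁ a₂ b₁ b₂ t : ℕ} (hg : g < δ.G) :
    δ.slot g B a₁ a₂ b₁ b₂ t ≤ δ.n := by
  unfold slot
  rw [List.getD_eq_getElem?_getD]
  rcases h : (((δ.pts g).filter (δ.inRange g B a₁ a₂ b₁ b₂)).map (· + 1))[t]? with _ | a
  · simp
  · have := List.mem_of_getElem? h
    rw [List.mem_map] at this
    obtain ⟨p, hp, rfl⟩ := this
    exact ((hδ.mem_pts hg).1 (List.mem_filter.1 hp).1).1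

theorem decode {B a b c d : ℕ} (ha : a < B) (hb : b < B) (hc : c < B) (hd : d < B) :
    let e := ((a * B + b) * B + c) * B + d
    e < B ^ 4 ∧ e / B / B / B = a ∧ e / B / B % B = b ∧ e / B % B = c ∧ e % B = d := by
  intro e
  have hB : 0 < B := by omega
  have step : ∀ u v : ℕ, v < B → (u * B + v) / B = u ∧ (u * B + v) % B = v := by
    intro u v hv
    rw [mul_comm, Nat.mul_add_div hB, Nat.div_eq_of_lt hv, Nat.mul_add_mod, Nat.mod_eq_of_lt hv]
    simp
  have up : ∀ u v m : ℕ, u < m → v < B → u * B + v < m * B := by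
    intro u v m hu hv
    calc u * B + v < u * B + B := by omega
      _ = (u + 1) * B := by ring
      _ ≤ m * B := Nat.mul_le_mul_right _ hu
  have h₁ := step ((a * B + b) * B + c) d hd
  have h₂ := step (a * B + b) c hc
  have h₃ := step a b hb
  refine ⟨?_, ?_, ?_, ?_, ?_⟩
  · have := up _ d _ (up _ c _ (up a b B ha hb) hc) hd
    calc e < B * B * B * B := this
      _ = B ^ 4 := by ring
  · rw [h₁.1, h₂.1, h₃.1]
  · rw [h₁.1, h₂.1, h₃.2]
  · rw [h₁.1, h₂.2]
  · exact h₁.2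

/-- The variables that describe the level of a query. -/
structure LevCtx (j : ℕ) (δ : Dat) (s : AS) : Prop where
  i : s.v .i = j
  A : s.v .A = (2 ^ j : ℕ)
  R : s.v .R = (2 ^ (δ.L - j) : ℕ)
  NC : s.v .NC = δ.NC
  G : s.v .G = δ.G

theorem LevCtx.frame {i : ℕ} {c : Cmd} {s s' : AS} (h : LevCtx i δ s) (hf : Frame c s s')
    (hc : ([.i, .A, .R, .NC, .G] : List Var).all (fun u => !c.writesVar u) = true) :
    LevCtx i δ s' := by
  simp only [List.all_cons, List.all_nil, Bool.and_true, Bool.and_eq_true,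
    Bool.not_eq_true'] at hc
  obtain ⟨h₁, h₂, h₃, h₄, h₅⟩ := hc
  exact ⟨by rw [hf.1 _ h₁, h.i], by rw [hf.1 _ h₂, h.A], by rw [hf.1 _ h₃, h.R],
    by rw [hf.1 _ h₄, h.NC], by rw [hf.1 _ h₅, h.G]⟩

/-- The column `2 ^ i` and the row `2 ^ (L - i)` can occur when a side of the rectangle lies on the
border of the square. The computed number then need not belong to the intended cell. The conditions
on `lev`, `col` and `row` confine the claim to genuine cells; otherwise the points met are still
tested individually. -/
theorem cellQuery_spec {z : Cfg} (hz : δ.Fits z) (hδ : δ.Good) {s : AS} {T : ℕ → Prop}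
    {i c r : ℕ} {u : Var} (hu : u = .r1 ∨ u = .r2) (hV : δ.Valid s) (hρ : RectCtx ρ s)
    (hT : δ.Res ρ T s) (hL : LevCtx i δ s) (hc : s.v .c = c) (hr : s.v u = r)
    (hg : i * δ.NC + c * 2 ^ (δ.L - i) + r < δ.G) :
    Wp z (cellQuery δ.N u) s fun s' =>
      δ.Res ρ (fun p => T p ∨ (p ∈ δ.pts (i * δ.NC + c * 2 ^ (δ.L - i) + r) ∧
        δ.lev (i * δ.NC + c * 2 ^ (δ.L - i) + r) = i ∧
        δ.col (i * δ.NC + c * 2 ^ (δ.L - i) + r) = c ∧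
        δ.row (i * δ.NC + c * 2 ^ (δ.L - i) + r) = r)) s' ∧
      s'.clk ≤ s.clk + 22 + 11 * δ.N := by
  set g := i * δ.NC + c * 2 ^ (δ.L - i) + r with hgdef
  have hG := hz.G
  have hQG := δ.Q_le_G
  have hIW := hz.I_le
  have hoff := hz.off
  have hofg : δ.off (g + 1) ≤ δ.off δ.G := δ.off_mono hg
  rw [off_succ] at hofg
  have hB0 := δ.B_pos g
  have hBQ := δ.B_le_Q g
  have hune : ∀ v, v ≠ .r1 → v ≠ .r2 → u ≠ v := by
    rintro v h₁ h₂ rfl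
    rcases hu with hu | hu
    exacts [h₁ hu, h₂ hu]
  have hsubf : ∀ (w : Var) (t : Ex) (v : Var), v ≠ w → (subProg w t).writesVar v = false := by
    intro w t v hv
    simp [subProg, Cmd.writesVar, hv.symm]
  have hsuba : ∀ (w : Var) (t : Ex) (s₁ s₂ : AS), Frame (subProg w t) s₁ s₂ → s₂.a = s₁.a :=
    fun w t s₁ s₂ hf => funext fun r => hf.2 r rfl
  refine .seq (.asg g (by simp [hL.i, hL.NC, hL.R, hc, hr, hgdef]) ?_)
  refine .seq (.ld g (δ.off g) (by simp) (by omega) (hV.tables.ptr g hg) ?_)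
  refine .seq (.ld (δ.off g) (δ.B g) (by simp) (by omega) (hV.tables.tabB g hg) ?_)
  set a₁ := sub (δ.B g) (ρ.x * (2 ^ i : ℕ) - c) with ha₁
  set a₂ := sub (δ.B g) (ρ.x' * (2 ^ i : ℕ) - c) with ha₂
  set b₁ := sub (δ.B g) (ρ.y * (2 ^ (δ.L - i) : ℕ) - r) with hb₁
  set b₂ := sub (δ.B g) (ρ.y' * (2 ^ (δ.L - i) : ℕ) - r) with hb₂
  have hug := hune .g (by simp) (by simp)
  have huF := hune .F (by simp) (by simp)
  have huB := hune .B (by simp) (by simp)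
  have hua₁ := hune .a1 (by simp) (by simp)
  have hua₂ := hune .a2 (by simp) (by simp)
  have hub₁ := hune .b1 (by simp) (by simp)
  refine .seq (.use (subProg_spec (B := δ.B g) (t := ρ.x * (2 ^ i : ℕ) - c) (by simp) hB0
    (by omega) (by simp) (by simp [hρ.x, hL.A, hc])) ?_)
  rintro s₁ ⟨v₁, t₁⟩ f₁
  have k₁ : ∀ v, v ≠ .a1 → s₁.v v = _ := fun v hv => f₁.1 v (hsubf _ _ _ hv)
  refine .seq (.use (subProg_spec (B := δ.B g) (t := ρ.x' * (2 ^ i : ℕ) - c) (by simp [k₁]) hB0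
    (by omega) (by simp) (by simp [k₁, hρ.x', hL.A, hc])) ?_)
  rintro s₂ ⟨v₂, t₂⟩ f₂
  have k₂ : ∀ v, v ≠ .a2 → s₂.v v = _ := fun v hv => f₂.1 v (hsubf _ _ _ hv)
  refine .seq (.use (subProg_spec (B := δ.B g) (t := ρ.y * (2 ^ (δ.L - i) : ℕ) - r)
    (by simp [k₂, k₁]) hB0 (by omega) (by simp)
    (by simp [k₂, k₁, hρ.y, hL.R, hr, hua₂, hua₁, hug, huF, huB])) ?_)
  rintro s₃ ⟨v₃, t₃⟩ f₃
  have k₃ : ∀ v, v ≠ .b1 → s₃.v v = _ := fun v hv => f₃.1 v (hsubf _ _ _ hv)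
  refine .seq (.use (subProg_spec (B := δ.B g) (t := ρ.y' * (2 ^ (δ.L - i) : ℕ) - r)
    (by simp [k₃, k₂, k₁]) hB0 (by omega) (by simp)
    (by simp [k₃, k₂, k₁, hρ.y', hL.R, hr, hub₁, hua₂, hua₁, hug, huF, huB])) ?_)
  rintro s₄ ⟨v₄, t₄⟩ f₄
  have k₄ : ∀ v, v ≠ .b2 → s₄.v v = _ := fun v hv => f₄.1 v (hsubf _ _ _ hv)
  have w₁ : s₄.v .a1 = a₁ := by rw [k₄ _ (by simp), k₃ _ (by simp), k₂ _ (by simp), v₁]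
  have w₂ : s₄.v .a2 = a₂ := by rw [k₄ _ (by simp), k₃ _ (by simp), v₂]
  have w₃ : s₄.v .b1 = b₁ := by rw [k₄ _ (by simp), v₃]
  have w₄ : s₄.v .b2 = b₂ := v₄
  have w₅ : ∀ v, v ∉ ([.a1, .a2, .b1, .b2, .g, .F, .B] : List Var) → s₄.v v = s.v v := by
    intro v hv
    simp only [List.mem_cons, List.not_mem_nil, or_false, not_or] at hv
    rw [k₄ _ hv.2.2.2.1, k₃ _ hv.2.2.1, k₂ _ hv.2.1, k₁ _ hv.1]
    simp [hv]
  have w₆ : s₄.v .B = δ.B g := by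
    rw [k₄ _ (by simp), k₃ _ (by simp), k₂ _ (by simp), k₁ _ (by simp)]; simp
  have w₇ : s₄.v .F = δ.off g := by
    rw [k₄ _ (by simp), k₃ _ (by simp), k₂ _ (by simp), k₁ _ (by simp)]; simp
  have w₈ : s₄.a = s.a := by
    rw [hsuba _ _ _ _ f₄, hsuba _ _ _ _ f₃, hsuba _ _ _ _ f₂, hsuba _ _ _ _ f₁]; rfl
  simp only [AS.setv_clk] at t₁
  obtain ⟨d₀, d₁, d₂, d₃, d₄⟩ := decode (sub_lt hB0 (ρ.x * (2 ^ i : ℕ) - c))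
    (sub_lt hB0 (ρ.x' * (2 ^ i : ℕ) - c)) (sub_lt hB0 (ρ.y * (2 ^ (δ.L - i) : ℕ) - r))
    (sub_lt hB0 (ρ.y' * (2 ^ (δ.L - i) : ℕ) - r))
  rw [← ha₁, ← ha₂, ← hb₁, ← hb₂] at d₀ d₁ d₂ d₃ d₄
  set e := ((a₁ * δ.B g + a₂) * δ.B g + b₁) * δ.B g + b₂ with he
  have heN : e * δ.N + δ.N ≤ δ.B g ^ 4 * δ.N := by
    rw [← Nat.succ_mul]; exact Nat.mul_le_mul_right _ d₀
  refine .seq (.asg e (by simp [w₁, w₂, w₃, w₄, w₆, he]) (.seq (.asg 0 (by simp) ?_)))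
  refine .wh δ.N (fun k s' => s'.v .t = k ∧
    δ.Res ρ (fun p => T p ∨ ∃ t < k, δ.slot g (δ.B g) a₁ a₂ b₁ b₂ t = p + 1) s' ∧
    s'.clk ≤ s.clk + 21 + 11 * k) ?_ ?_ ?_
  · refine ⟨by simp, ?_, by simp; omega⟩
    refine (hT.congr ?_).mono ?_
    · simp [w₅]
    · rintro - p (hp | ⟨t, ht, -⟩) -
      exacts [hp, by omega]
  · rintro k hk s' hf ⟨h₁, h₂, h₃⟩
    have F' : s'.v .F = δ.off g := by rw [hf.1 _ rfl]; simp [w₇]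
    have e' : s'.v .e = e := by rw [hf.1 _ rfl]; simp
    have a' : s'.a = s.a := by
      rw [show s'.a = _ from funext fun r => hf.2 r rfl]; simp [w₈]
    have ρ' : RectCtx ρ s' := RectCtx.frame (s := (s₄.setv .e e).setv .t 0)
      ⟨by simp [w₅, hρ.x], by simp [w₅, hρ.x'], by simp [w₅, hρ.y], by simp [w₅, hρ.y']⟩ hf rfl
    refine ⟨by simp [h₁]; exact hk, ?_⟩
    have hslot := hV.tables.slot g hg e d₀ k hk
    rw [d₁, d₂, d₃, d₄] at hslot
    refine .seq (.ld (δ.off g + 1 + e * δ.N + k) (δ.slot g (δ.B g) a₁ a₂ b₁ b₂ k)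
      (by simp [F', e', h₁]) (by omega) (by rw [AS.tick_a, a', hslot]) ?_)
    refine .seq (.use (testProg_spec hz hδ (ρ := ρ)
      (a := δ.slot g (δ.B g) a₁ a₂ b₁ b₂ k) ⟨by simp [ρ'.x], by simp [ρ'.x'],
      by simp [ρ'.y], by simp [ρ'.y']⟩ (h₂.congr (by simp)) (by simp) (slot_le hδ hg)) ?_)
    rintro s'' ⟨h₄, h₅⟩ f''
    have t'' : s''.v .t = k := by rw [f''.1 _ rfl]; simp [h₁]
    refine .asg (k + 1 : ℕ) (by simp [t'']) ⟨by simp, (h₄.congr (by simp)).mono ?_, ?_⟩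
    · rintro - p (hp | ⟨t, ht, hp⟩) -
      · exact Or.inl (Or.inl hp)
      · rcases Nat.lt_succ_iff_lt_or_eq.1 ht with h | rfl
        exacts [Or.inl (Or.inr ⟨t, h, hp⟩), Or.inr hp]
    · simp only [AS.setv_clk, AS.tick_clk] at h₅ ⊢
      omega
  · rintro s' hf ⟨h₁, h₂, h₃⟩
    refine ⟨by simp [h₁], ?_, by simp; omega⟩
    rcases h₂ with ⟨h₂, h₂'⟩ | ⟨h₂, h₂'⟩
    · exact Or.inl ⟨h₂, h₂'⟩
    · refine Or.inr ⟨h₂, fun hR p hp hi => ?_⟩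
      rcases hp with hp | ⟨hp, q₁, q₂, q₃⟩
      · exact h₂' hR p (Or.inl hp) hi
      · obtain ⟨t, ht, q, hq, hqi⟩ := exists_slot hδ hg (hR.fine g hg) hB0 hp hi
        have c₁ : δ.cols g = 2 ^ i := by rw [cols, q₁]
        have c₂ : δ.rows g = 2 ^ (δ.L - i) := by rw [rows, q₁]
        rw [c₁, c₂, q₂, q₃] at hq
        exact h₂' hR q (Or.inr ⟨t, ht, hq⟩) hqi

end Dat


/-! ### The cells that meet a rectangle -/

namespace Dat

variable (δ : Dat)

/-- The column of level `i` that contains the point `p`. -/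
noncomputable def colOf (i p : ℕ) : ℕ := ⌊δ.px p * (2 ^ i : ℕ)⌋₊
/-- The row of level `i` that contains the point `p`. -/
noncomputable def rowOf (i p : ℕ) : ℕ := ⌊δ.py p * (2 ^ (δ.L - i) : ℕ)⌋₊

/-- The cells of level `i` that meet the rectangle are those in the columns `c₁, …, c₂` and in the
rows `r₁, …, r₂`. There are at most five columns, and on all levels but the last there are at least
three; the last level has only one row. -/
structure Span (ρ : Rect) (i c₁ c₂ r₁ r₂ : ℕ) : Prop where
  le : i ≤ δ.L
  c₁_eq : c₁ = ⌊ρ.x * (2 ^ i : ℕ)⌋₊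
  c₂_eq : c₂ = ⌊ρ.x' * (2 ^ i : ℕ)⌋₊
  r₁_eq : r₁ = ⌊ρ.y * (2 ^ (δ.L - i) : ℕ)⌋₊
  r₂_eq : r₂ = ⌊ρ.y' * (2 ^ (δ.L - i) : ℕ)⌋₊
  c₁_le : c₁ ≤ c₂
  r₁_le : r₁ ≤ r₂
  c₂_le : c₂ ≤ c₁ + 4
  c₂_le' : c₂ ≤ 2 ^ i
  r₂_le : r₂ ≤ 2 ^ (δ.L - i)
  lt : i = δ.L ∨ c₁ + 2 ≤ c₂

variable {δ} {ρ : Rect} {i c₁ c₂ r₁ r₂ : ℕ}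

theorem lt_of_floor_mul_lt {a b : ℝ} {m : ℕ} (h : ⌊a * m⌋₊ < ⌊b * m⌋₊) : a < b := by
  by_contra hle
  exact absurd (Nat.floor_mono (mul_le_mul_of_nonneg_right (not_lt.1 hle) (Nat.cast_nonneg m)))
    (not_le.2 h)

theorem floor_mul_mono {a b : ℝ} (h : a ≤ b) (m : ℕ) : ⌊a * m⌋₊ ≤ ⌊b * m⌋₊ :=
  Nat.floor_mono (mul_le_mul_of_nonneg_right h (Nat.cast_nonneg m))

theorem cell_eq (i p : ℕ) : δ.cell i p = i * δ.NC + δ.colOf i p * 2 ^ (δ.L - i) + δ.rowOf i p := rfl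

theorem Good.rowOf_lt (hδ : δ.Good) {p : ℕ} (hp : p < δ.n) (i : ℕ) :
    δ.rowOf i p < 2 ^ (δ.L - i) :=
  floor_mul_lt (hδ.pos p hp).2.2.2 (by positivity)

/-- Even for `c = 2 ^ i` and `r = 2 ^ (L - i)` the position within the level is at most `2 * Q`. The
`4 * Q` numbers reserved per level keep such positions valid without case distinctions in the
program. -/
theorem Span.cell_lt (h : δ.Span ρ i c₁ c₂ r₁ r₂) {c r : ℕ} (hc : c ≤ c₂) (hr : r ≤ r₂) :
    i * δ.NC + c * 2 ^ (δ.L - i) + r < δ.G := by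
  have h₁ : δ.Q = 2 ^ i * 2 ^ (δ.L - i) := by rw [Q, ← pow_add, Nat.add_sub_cancel' h.le]
  have h₂ : c * 2 ^ (δ.L - i) ≤ δ.Q := h₁ ▸ Nat.mul_le_mul_right _ (hc.trans h.c₂_le')
  have h₃ : 2 ^ (δ.L - i) ≤ δ.Q := Nat.pow_le_pow_right (by norm_num) (by omega)
  have h₄ : i * δ.NC + δ.NC ≤ δ.G := by
    rw [G, ← Nat.succ_mul]; exact Nat.mul_le_mul_right _ (Nat.succ_le_succ h.le)
  have h₅ := δ.Q_pos
  have h₆ := h.r₂_le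
  rw [NC] at h₄ ⊢
  omega

/-- The points in a run of cells strictly between the rows `r₁` and `r₂`. -/
theorem Span.inCells (h : δ.Span ρ i c₁ c₂ r₁ r₂) (hδ : δ.Good) {c r m p : ℕ} (hc : c ≤ c₂)
    (hm : r + m ≤ r₂) :
    δ.InCells (i * δ.NC + c * 2 ^ (δ.L - i) + r) m p ↔
      p < δ.n ∧ δ.colOf i p = c ∧ r ≤ δ.rowOf i p ∧ δ.rowOf i p < r + m := by
  have hR := h.r₂_le
  constructor
  · rintro ⟨g, h₁, h₂, h₃⟩
    obtain ⟨r', rfl⟩ : ∃ r', g = i * δ.NC + c * 2 ^ (δ.L - i) + r' :=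
      ⟨g - (i * δ.NC + c * 2 ^ (δ.L - i)), by omega⟩
    have hg : i * δ.NC + c * 2 ^ (δ.L - i) + r' < δ.G := h.cell_lt hc (by omega)
    obtain ⟨hp, hcell⟩ := (hδ.mem_pts hg).1 h₃
    have hlev : δ.lev (i * δ.NC + c * 2 ^ (δ.L - i) + r') = i := by
      have h₁ : δ.Q = 2 ^ i * 2 ^ (δ.L - i) := by rw [Q, ← pow_add, Nat.add_sub_cancel' h.le]
      have h₂ : c * 2 ^ (δ.L - i) ≤ δ.Q := h₁ ▸ Nat.mul_le_mul_right _ (hc.trans h.c₂_le')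
      have h₃ : 2 ^ (δ.L - i) ≤ δ.Q := Nat.pow_le_pow_right (by norm_num) (by omega)
      have h₅ := δ.Q_pos
      rw [lev, add_assoc, mul_comm, Nat.mul_add_div δ.NC_pos, Nat.div_eq_of_lt, add_zero]
      rw [NC]; omega
    rw [hlev, cell_eq] at hcell
    have hrow := hδ.rowOf_lt hp i
    -- Since `r' < r₂ ≤ 2 ^ (L - i)`, both sides are divisions with remainder by the number of rows,
    -- so columns and rows agree.
    have e₁ : δ.colOf i p * 2 ^ (δ.L - i) + δ.rowOf i p = c * 2 ^ (δ.L - i) + r' := by omega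
    have hR0 : 0 < 2 ^ (δ.L - i) := by positivity
    have hcol : δ.colOf i p = c := by
      have := congrArg (· / 2 ^ (δ.L - i)) e₁
      simp only [mul_comm _ (2 ^ (δ.L - i)), Nat.mul_add_div hR0, Nat.div_eq_of_lt hrow] at this
      rwa [Nat.div_eq_of_lt (by omega), add_zero, add_zero] at this
    rw [hcol] at e₁
    exact ⟨hp, hcol, by omega, by omega⟩
  · rintro ⟨hp, rfl, h₁, h₂⟩
    refine ⟨δ.cell i p, by rw [cell_eq]; omega, by rw [cell_eq]; omega, ?_⟩
    rw [hδ.mem_pts (hδ.cell_lt h.le hp), hδ.lev_cell h.le hp]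
    exact ⟨hp, rfl⟩

/-- The variables that describe the cells that meet the rectangle. -/
structure SpanCtx (δ : Dat) (ρ : Rect) (i₀ c₁ c₂ r₁ r₂ : ℕ) (s : AS) : Prop where
  rect : RectCtx ρ s
  lev : LevCtx i₀ δ s
  c1 : s.v .c1 = c₁
  c2 : s.v .c2 = c₂
  r1 : s.v .r1 = r₁
  r2 : s.v .r2 = r₂

theorem SpanCtx.frame {c : Cmd} {s s' : AS} (h : SpanCtx δ ρ i c₁ c₂ r₁ r₂ s) (hf : Frame c s s')
    (hc : ([.x, .x', .y, .y'] : List Var).all (fun u => !c.writesVar u) = true)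
    (hc' : ([.i, .A, .R, .NC, .G] : List Var).all (fun u => !c.writesVar u) = true)
    (hc'' : ([.c1, .c2, .r1, .r2] : List Var).all (fun u => !c.writesVar u) = true) :
    SpanCtx δ ρ i c₁ c₂ r₁ r₂ s' := by
  simp only [List.all_cons, List.all_nil, Bool.and_true, Bool.and_eq_true,
    Bool.not_eq_true'] at hc''
  obtain ⟨h₁, h₂, h₃, h₄⟩ := hc''
  exact ⟨h.rect.frame hf hc, h.lev.frame hf hc', by rw [hf.1 _ h₁, h.c1], by rw [hf.1 _ h₂, h.c2],
    by rw [hf.1 _ h₃, h.r1], by rw [hf.1 _ h₄, h.r2]⟩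

/-- Assigning to other variables does not matter. -/
theorem SpanCtx.setv {s s' : AS} (h : SpanCtx δ ρ i c₁ c₂ r₁ r₂ s)
    (hs : ∀ u ∈ ([.x, .x', .y, .y', .i, .A, .R, .NC, .G, .c1, .c2, .r1, .r2] : List Var),
      s'.v u = s.v u) : SpanCtx δ ρ i c₁ c₂ r₁ r₂ s' :=
  ⟨⟨by rw [hs _ (by simp), h.rect.x], by rw [hs _ (by simp), h.rect.x'],
    by rw [hs _ (by simp), h.rect.y], by rw [hs _ (by simp), h.rect.y']⟩,
    ⟨by rw [hs _ (by simp), h.lev.i], by rw [hs _ (by simp), h.lev.A],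
    by rw [hs _ (by simp), h.lev.R], by rw [hs _ (by simp), h.lev.NC],
    by rw [hs _ (by simp), h.lev.G]⟩, by rw [hs _ (by simp), h.c1], by rw [hs _ (by simp), h.c2],
    by rw [hs _ (by simp), h.r1], by rw [hs _ (by simp), h.r2]⟩

/-- Two overlapping runs of `2 ^ d` cells cover the rows strictly between `r₁` and `r₂`, where the
second coordinate of a point is automatically inside the rectangle. The proposition `P` states that
in column `c` one vertical side is no constraint; the point extremal towards that side is then
inside as soon as any point of the run is. -/
theorem midQuery_spec {z : Cfg} (hz : δ.Fits z) (hδ : δ.Good) {s : AS} {T : ℕ → Prop}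
    {q : Arr} {sg : Bool} {c d : ℕ} {P : Prop} (hS : δ.Span ρ i c₁ c₂ r₁ r₂)
    (hq : ∀ d ≤ δ.D, ∀ g, g + 2 ^ d ≤ δ.G →
      IsBest (δ.key sg) (δ.InCells g (2 ^ d)) (s.a q (d * δ.G + g)))
    (hs : SpanCtx δ ρ i c₁ c₂ r₁ r₂ s) (hT : δ.Res ρ T s) (hc : s.v .c = c) (hcc : c ≤ c₂)
    (hd : s.v .d = d) (hw : s.v .w = (2 ^ d : ℕ)) (hdD : d < δ.D) (h₁ : r₁ + 1 + 2 ^ d ≤ r₂)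
    (h₂ : r₂ ≤ r₁ + 1 + 2 ^ d + 2 ^ d)
    (hP : P → ∀ p p', δ.colOf i p' = c → δ.Inside ρ p → δ.key sg p' ≤ δ.key sg p →
      ρ.x < δ.px p' ∧ δ.px p' ≤ ρ.x') :
    Wp z (midQuery q) s fun s' =>
      δ.Res ρ (fun p => T p ∨ (P ∧ p < δ.n ∧ δ.colOf i p = c ∧ r₁ < δ.rowOf i p ∧
        δ.rowOf i p < r₂)) s' ∧ s'.clk ≤ s.clk + 18 := by
  have hDG := hz.DG
  have hdG : d * δ.G + 2 * δ.G ≤ (δ.D + 2) * δ.G := by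
    rw [← Nat.add_mul]; exact Nat.mul_le_mul_right _ (by omega)
  have hlt := hS.cell_lt hcc le_rfl
  have k₁ := hq d hdD.le (i * δ.NC + c * 2 ^ (δ.L - i) + (r₁ + 1)) (by omega)
  have k₂ := hq d hdD.le (i * δ.NC + c * 2 ^ (δ.L - i) + (r₂ - 2 ^ d)) (by omega)
  set a₁ := s.a q (d * δ.G + (i * δ.NC + c * 2 ^ (δ.L - i) + (r₁ + 1))) with ha₁
  set a₂ := s.a q (d * δ.G + (i * δ.NC + c * 2 ^ (δ.L - i) + (r₂ - 2 ^ d))) with ha₂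
  have m₁ := fun p => hS.inCells (p := p) (r := r₁ + 1) (m := 2 ^ d) hδ hcc h₁
  have m₂ := fun p => hS.inCells (p := p) (r := r₂ - 2 ^ d) (m := 2 ^ d) hδ hcc (by omega)
  have l₁ := IsBest_le k₁ fun p hp => ((m₁ p).1 hp).1
  have l₂ := IsBest_le k₂ fun p hp => ((m₂ p).1 hp).1
  have hx := hs.rect
  refine .seq (.ld _ a₁ ?_ ?_ ha₁.symm ?_)
  · simp only [Ex.val_add, Ex.val_mul, Ex.val_var, Ex.val_one, hd, hs.lev.G, hs.lev.i, hs.lev.NC,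
      hs.lev.R, hc, hs.r1]
    push_cast
    ring
  · omega
  refine .seq (.use (testProg_spec hz hδ (ρ := ρ) (a := a₁) (T := T) ⟨by simp [hx.x],
    by simp [hx.x'], by simp [hx.y], by simp [hx.y']⟩ (hT.congr (by simp)) (by simp) l₁) ?_)
  rintro s₁ ⟨q₁, t₁⟩ f₁
  have hs₁ : SpanCtx δ ρ i c₁ c₂ r₁ r₂ s₁ := SpanCtx.frame (hs.setv (by simp)) f₁ rfl rfl rfl
  have hx₁ := hs₁.rect
  have ea : s₁.a q = s.a q := f₁.2 _ rfl
  refine .seq (.ld (d * δ.G + (i * δ.NC + c * 2 ^ (δ.L - i) + (r₂ - 2 ^ d))) a₂ ?_ ?_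
    (by rw [ea]) ?_)
  · have e₁ : s₁.v .c = c := by rw [f₁.1 _ rfl]; simp [hc]
    have e₂ : s₁.v .d = d := by rw [f₁.1 _ rfl]; simp [hd]
    have e₃ : s₁.v .w = (2 ^ d : ℕ) := by rw [f₁.1 _ rfl]; simp [hw]
    simp only [Ex.val_add, Ex.val_mul, Ex.val_var, Ex.val_sub, e₁, e₂, e₃, hs₁.lev.G, hs₁.lev.i,
      hs₁.lev.NC, hs₁.lev.R, hs₁.r2]
    push_cast [Nat.cast_sub (show 2 ^ d ≤ r₂ by omega)]
    ring
  · omega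
  refine .use (testProg_spec hz hδ (ρ := ρ) (a := a₂) ⟨by simp [hx₁.x],
    by simp [hx₁.x'], by simp [hx₁.y], by simp [hx₁.y']⟩ (q₁.congr (by simp)) (by simp) l₂) ?_
  rintro s₂ ⟨q₂, t₂⟩ -
  refine ⟨?_, by simp only [AS.setv_clk] at t₁ t₂; omega⟩
  rcases q₂ with q₂ | ⟨q₂, q₃⟩
  · exact Or.inl q₂
  refine Or.inr ⟨q₂, fun hR p hp hi => ?_⟩
  rcases hp with hp | ⟨hP', hp, hpc, hp₁, hp₂⟩
  · exact q₃ hR p (Or.inl (Or.inl hp)) hi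
  have fin : ∀ p', p' < δ.n → δ.colOf i p' = c → r₁ < δ.rowOf i p' → δ.rowOf i p' < r₂ →
      δ.key sg p' ≤ δ.key sg p → δ.Inside ρ p' := by
    intro p' g₁ g₂ g₃ g₄ g₅
    obtain ⟨g₆, g₇⟩ := hP hP' p p' g₂ hi g₅
    rw [hS.r₁_eq] at g₃
    rw [hS.r₂_eq] at g₄
    exact ⟨g₁, g₆, g₇, lt_of_floor_mul_lt g₃, (lt_of_floor_mul_lt g₄).le⟩
  by_cases hcase : δ.rowOf i p < r₁ + 1 + 2 ^ d
  · rcases k₁ with ⟨-, k₁⟩ | ⟨p', e, g₁, g₂⟩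
    · exact k₁ p ((m₁ p).2 ⟨hp, hpc, hp₁, hcase⟩)
    · have g₃ := (m₁ p').1 g₁
      exact q₃ hR p' (Or.inl (Or.inr e)) (fin p' g₃.1 g₃.2.1 g₃.2.2.1 (by omega)
        (g₂ p ((m₁ p).2 ⟨hp, hpc, hp₁, hcase⟩)))
  · rcases k₂ with ⟨-, k₂⟩ | ⟨p', e, g₁, g₂⟩
    · exact k₂ p ((m₂ p).2 ⟨hp, hpc, by omega, by omega⟩)
    · have g₃ := (m₂ p').1 g₁
      exact q₃ hR p' (Or.inr e) (fin p' g₃.1 g₃.2.1 (by omega) (by omega)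
        (g₂ p ((m₂ p).2 ⟨hp, hpc, by omega, by omega⟩)))

/-- In the columns after `c₁` the left side is no constraint and the leftmost points suffice; in the
columns before `c₂` the same holds for the right side and the rightmost points. Since `c₁ < c₂`
whenever there are rows strictly between `r₁` and `r₂`, this covers every column. -/
theorem colsQuery_spec {z : Cfg} (hz : δ.Fits z) (hδ : δ.Good) {s : AS} {d : ℕ}
    (hS : δ.Span ρ i c₁ c₂ r₁ r₂) (hV : δ.Valid s) (hs : SpanCtx δ ρ i c₁ c₂ r₁ r₂ s)
    (hans : s.v .ans = 1) (hd : s.v .d = d) (hw : s.v .w = (2 ^ d : ℕ)) (hdD : d < δ.D)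
    (hr : r₁ + 1 < r₂ → d = Nat.log 2 (r₂ - r₁ - 1)) :
    Wp z (colsQuery δ.N) s fun s' => δ.Res ρ (fun _ => True) s' ∧
      s'.clk ≤ s.clk + 5 * (83 + 22 * δ.N) + 2 := by
  refine .seq (.asg c₁ (by simp [hs.c1]) ?_)
  have hle := hS.c₁_le
  refine .wh (c₂ + 1 - c₁) (fun k s' => s'.v .c = (c₁ + k : ℕ) ∧
    δ.Res ρ (fun p => p < δ.n ∧ c₁ ≤ δ.colOf i p ∧ δ.colOf i p < c₁ + k ∧ r₁ ≤ δ.rowOf i p ∧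
      δ.rowOf i p ≤ r₂) s' ∧ s'.clk ≤ s.clk + 1 + k * (83 + 22 * δ.N)) ?_ ?_ ?_
  · exact ⟨by simp, Or.inr ⟨by simp [hans], fun _ p hp => by omega⟩, by simp⟩
  · rintro k hk s₀ hf ⟨h₁, h₂, h₃⟩
    have hs₀ : SpanCtx δ ρ i c₁ c₂ r₁ r₂ s₀ := SpanCtx.frame (hs.setv (by simp)) hf rfl rfl rfl
    have hV₀ : δ.Valid s₀ := hV.of_eq (funext fun r => hf.2 r rfl)
    have d₀ : s₀.v .d = d := by rw [hf.1 _ rfl]; simp [hd]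
    have w₀ : s₀.v .w = (2 ^ d : ℕ) := by rw [hf.1 _ rfl]; simp [hw]
    have hcc : c₁ + k ≤ c₂ := by omega
    have g₁ := hS.cell_lt (c := c₁ + k) (r := r₁) hcc hS.r₁_le
    have g₂ := hS.cell_lt (c := c₁ + k) (r := r₂) hcc le_rfl
    refine ⟨?_, ?_⟩
    · simp only [Ex.val_var, Ex.val_add, Ex.val_one, h₁, hs₀.c2]
      exact_mod_cast (show c₁ + k < c₂ + 1 by omega)
    have hs₀' : SpanCtx δ ρ i c₁ c₂ r₁ r₂ s₀.tick := hs₀.setv (by simp)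
    refine .seq (.use (cellQuery_spec hz hδ (Or.inl rfl) (hV₀.of_eq rfl) hs₀'.rect
      (h₂.congr rfl) hs₀'.lev h₁ hs₀'.r1 g₁) ?_)
    rintro s₁ ⟨q₁, t₁⟩ f₁
    have hs₁ : SpanCtx δ ρ i c₁ c₂ r₁ r₂ s₁ := SpanCtx.frame (hs₀.setv (by simp)) f₁ rfl rfl rfl
    have hV₁ : δ.Valid s₁ := hV₀.of_eq (funext fun r => f₁.2 r rfl)
    have c₁' : s₁.v .c = (c₁ + k : ℕ) := by rw [f₁.1 _ rfl]; simpa using h₁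
    refine .seq (.use (cellQuery_spec hz hδ (Or.inr rfl) hV₁ hs₁.rect q₁ hs₁.lev c₁' hs₁.r2
      g₂) ?_)
    rintro s₂ ⟨q₂, t₂⟩ f₂
    have hs₂ : SpanCtx δ ρ i c₁ c₂ r₁ r₂ s₂ := hs₁.frame f₂ rfl rfl rfl
    have hV₂ : δ.Valid s₂ := hV₁.of_eq (funext fun r => f₂.2 r rfl)
    have c₂' : s₂.v .c = (c₁ + k : ℕ) := by rw [f₂.1 _ rfl, c₁']
    have d₂ : s₂.v .d = d := by rw [f₂.1 _ rfl, f₁.1 _ rfl]; simp [d₀]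
    have w₂ : s₂.v .w = (2 ^ d : ℕ) := by rw [f₂.1 _ rfl, f₁.1 _ rfl]; simp [w₀]
    simp only [AS.tick_clk] at t₁
    have q₃ : δ.Res ρ (fun p => p < δ.n ∧ ((c₁ ≤ δ.colOf i p ∧ δ.colOf i p < c₁ + k ∧
        r₁ ≤ δ.rowOf i p ∧ δ.rowOf i p ≤ r₂) ∨ (δ.colOf i p = c₁ + k ∧
        (δ.rowOf i p = r₁ ∨ δ.rowOf i p = r₂)))) s₂ := by
      refine q₂.mono ?_
      have key : ∀ p r, p < δ.n → δ.colOf i p = c₁ + k → δ.rowOf i p = r →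
          p ∈ δ.pts (i * δ.NC + (c₁ + k) * 2 ^ (δ.L - i) + r) ∧
          δ.lev (i * δ.NC + (c₁ + k) * 2 ^ (δ.L - i) + r) = i ∧
          δ.col (i * δ.NC + (c₁ + k) * 2 ^ (δ.L - i) + r) = c₁ + k ∧
          δ.row (i * δ.NC + (c₁ + k) * 2 ^ (δ.L - i) + r) = r := by
        intro p r hp hc hr'
        have e : i * δ.NC + (c₁ + k) * 2 ^ (δ.L - i) + r = δ.cell i p := by
          rw [cell_eq, hc, hr']
        rw [e, hδ.mem_pts (hδ.cell_lt hS.le hp), hδ.lev_cell hS.le hp, hδ.col_cell hS.le hp,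
          hδ.row_cell hS.le hp]
        exact ⟨⟨hp, rfl⟩, rfl, hc, hr'⟩
      rintro - p ⟨hp, ⟨b₁, b₂, b₃, b₄⟩ | ⟨b₁, b₂ | b₂⟩⟩ -
      · exact Or.inl (Or.inl ⟨hp, b₁, b₂, b₃, b₄⟩)
      · exact Or.inl (Or.inr (key p _ hp b₁ b₂))
      · exact Or.inr (key p _ hp b₁ b₂)
    refine .seq (.use (P := fun s' => δ.Res ρ (fun p => p < δ.n ∧ c₁ ≤ δ.colOf i p ∧
      δ.colOf i p < c₁ + (k + 1) ∧ r₁ ≤ δ.rowOf i p ∧ δ.rowOf i p ≤ r₂) s' ∧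
      s'.clk ≤ s₂.clk + 37) ?_ ?_)
    · refine .ite (fun hlt => ?_) fun hlt => .skip ⟨(q₃.congr rfl).mono ?_, by simp⟩
      · simp only [Ex.val_var, Ex.val_add, Ex.val_one, hs₂.r1, hs₂.r2] at hlt
        have hlt' : r₁ + 1 < r₂ := by exact_mod_cast hlt
        have hd' := hr hlt'
        have b₁ : 2 ^ d ≤ r₂ - r₁ - 1 := hd' ▸ Nat.pow_log_le_self 2 (by omega)
        have b₂ : r₂ - r₁ - 1 < 2 ^ (d + 1) := hd' ▸ Nat.lt_pow_succ_log_self (by norm_num) _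
        rw [pow_succ] at b₂
        -- The last level has a single row, hence `r₂ ≤ 1` there and no row strictly in between; on
        -- all other levels `Span.lt` gives the claim.
        have hiL : c₁ + 2 ≤ c₂ := by
          refine hS.lt.resolve_left fun h => ?_
          have := hS.r₂_le
          rw [h] at this
          simp at this
          omega
        refine .seq (.use (midQuery_spec (sg := true) (P := c₁ < c₁ + k) hz hδ hS hV₂.mn
          (hs₂.setv (by simp)) (q₃.congr rfl) c₂' hcc d₂ w₂ hdD (by omega) (by omega) ?_) ?_)
        · intro hlt p p' hp' hi hkey
          simp only [key, if_true] at hkey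
          refine ⟨?_, hkey.trans hi.2.2.1⟩
          have : c₁ < δ.colOf i p' := by omega
          rw [hS.c₁_eq] at this
          exact lt_of_floor_mul_lt this
        rintro s₃ ⟨q₄, t₄⟩ f₃
        have hs₃ : SpanCtx δ ρ i c₁ c₂ r₁ r₂ s₃ := (hs₂.setv (by simp)).frame f₃ rfl rfl rfl
        have hV₃ : δ.Valid s₃ := hV₂.of_eq (funext fun r => f₃.2 r rfl)
        have c₃' : s₃.v .c = (c₁ + k : ℕ) := by rw [f₃.1 _ rfl]; exact c₂'
        have d₃ : s₃.v .d = d := by rw [f₃.1 _ rfl]; exact d₂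
        have w₃ : s₃.v .w = (2 ^ d : ℕ) := by rw [f₃.1 _ rfl]; exact w₂
        refine .use (midQuery_spec (sg := false) (P := c₁ + k < c₂) hz hδ hS hV₃.mx
          hs₃ q₄ c₃' hcc d₃ w₃ hdD (by omega) (by omega) ?_) ?_
        · intro hlt p p' hp' hi hkey
          simp only [key, Bool.false_eq_true, if_false, neg_le_neg_iff] at hkey
          refine ⟨hi.2.1.trans_le hkey, ?_⟩
          have : δ.colOf i p' < c₂ := by omega
          rw [hS.c₂_eq] at this
          exact (lt_of_floor_mul_lt this).le
        rintro s₄ ⟨q₅, t₅⟩ -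
        simp only [AS.tick_clk] at t₄
        refine ⟨q₅.mono ?_, by omega⟩
        rintro - p ⟨hp, b₁, b₂, b₃, b₄⟩ -
        by_cases e : δ.colOf i p < c₁ + k
        · exact Or.inl (Or.inl ⟨hp, Or.inl ⟨b₁, e, b₃, b₄⟩⟩)
        have e' : δ.colOf i p = c₁ + k := by omega
        by_cases e₁ : δ.rowOf i p = r₁
        · exact Or.inl (Or.inl ⟨hp, Or.inr ⟨e', Or.inl e₁⟩⟩)
        by_cases e₂ : δ.rowOf i p = r₂
        · exact Or.inl (Or.inl ⟨hp, Or.inr ⟨e', Or.inr e₂⟩⟩)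
        by_cases e₃ : c₁ < c₁ + k
        · exact Or.inl (Or.inr ⟨e₃, hp, e', by omega, by omega⟩)
        · exact Or.inr ⟨by omega, hp, e', by omega, by omega⟩
      · simp only [Ex.val_var, Ex.val_add, Ex.val_one, hs₂.r1, hs₂.r2] at hlt
        have hlt' : ¬ r₁ + 1 < r₂ := by exact_mod_cast hlt
        rintro - p ⟨hp, b₁, b₂, b₃, b₄⟩ -
        by_cases e : δ.colOf i p < c₁ + k
        · exact ⟨hp, Or.inl ⟨b₁, e, b₃, b₄⟩⟩
        · exact ⟨hp, Or.inr ⟨by omega, by omega⟩⟩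
    rintro s₃ ⟨q₄, t₄⟩ f₃
    have c₃' : s₃.v .c = (c₁ + k : ℕ) := by rw [f₃.1 _ rfl, c₂']
    refine .asg (c₁ + (k + 1) : ℕ) (by simp [c₃']; ring) ⟨by simp, q₄.congr (by simp), ?_⟩
    simp only [AS.setv_clk]
    rw [Nat.add_mul]
    omega
  · rintro s' hf ⟨h₁, h₂, h₃⟩
    have hs' : SpanCtx δ ρ i c₁ c₂ r₁ r₂ s' := SpanCtx.frame (hs.setv (by simp)) hf rfl rfl rfl
    have e : c₁ + (c₂ + 1 - c₁) = c₂ + 1 := by omega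
    rw [e] at h₁ h₂
    refine ⟨by simp [h₁, hs'.c2], (h₂.congr rfl).mono ?_, ?_⟩
    · rintro - p - ⟨hp, b₁, b₂, b₃, b₄⟩
      have a₁ : c₁ ≤ δ.colOf i p := hS.c₁_eq ▸ floor_mul_mono b₁.le _
      have a₂ : δ.colOf i p ≤ c₂ := hS.c₂_eq ▸ floor_mul_mono b₂ _
      have a₃ : r₁ ≤ δ.rowOf i p := hS.r₁_eq ▸ floor_mul_mono b₃.le _
      have a₄ : δ.rowOf i p ≤ r₂ := hS.r₂_eq ▸ floor_mul_mono b₄ _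
      exact ⟨hp, a₁, by omega, a₃, a₄⟩
    · have h5 := hS.c₂_le
      have : (c₂ + 1 - c₁) * (83 + 22 * δ.N) ≤ 5 * (83 + 22 * δ.N) :=
        Nat.mul_le_mul_right _ (by omega)
      simp only [AS.tick_clk]
      omega

end Dat


/-! ### Choice of the level and correctness of the whole query -/

/-- A nonempty rectangle in the unit square. -/
structure Rect.Unit (ρ : Rect) : Prop where
  x : 0 ≤ ρ.x
  lt : ρ.x < ρ.x'
  x' : ρ.x' ≤ 1
  y : 0 ≤ ρ.y
  lt' : ρ.y < ρ.y'
  y' : ρ.y' ≤ 1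

namespace Dat

variable (δ : Dat)

/-- The level that is suitable for a rectangle of a given width. -/
noncomputable def levelOf (t : ℝ) : ℕ :=
  if 1 < Nat.log 2 ⌊(δ.Q : ℝ) * t⌋₊ then δ.L + 1 - Nat.log 2 ⌊(δ.Q : ℝ) * t⌋₊ else δ.L

variable {δ} {ρ : Rect}

theorem floor_le_of_le_one {t : ℝ} (ht : t ≤ 1) (m : ℕ) : ⌊t * m⌋₊ ≤ m := by
  refine (floor_mul_mono ht m).trans ?_
  rw [one_mul, Nat.floor_natCast]

theorem floor_Q_mul_le {t : ℝ} (ht : t ≤ 1) : ⌊(δ.Q : ℝ) * t⌋₊ ≤ δ.Q := by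
  rw [mul_comm]; exact floor_le_of_le_one ht _

/-- Let `m` be the integer part of `Q` times the width and `e` its binary logarithm. On level `L + 1
- e` a column has width `2 ^ (e - 1) / Q`, while `2 ^ e ≤ m < 2 ^ (e + 1)`; so the rectangle is at
least two and less than four columns wide. If `e ≤ 1`, it is less than four columns wide on the last
level. -/
theorem Rect.Unit.span (h : ρ.Unit) : δ.Span ρ (δ.levelOf (ρ.x' - ρ.x))
    ⌊ρ.x * (2 ^ δ.levelOf (ρ.x' - ρ.x) : ℕ)⌋₊ ⌊ρ.x' * (2 ^ δ.levelOf (ρ.x' - ρ.x) : ℕ)⌋₊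
    ⌊ρ.y * (2 ^ (δ.L - δ.levelOf (ρ.x' - ρ.x)) : ℕ)⌋₊
    ⌊ρ.y' * (2 ^ (δ.L - δ.levelOf (ρ.x' - ρ.x)) : ℕ)⌋₊ := by
  obtain ⟨h₁, h₂, h₃, h₄, h₅, h₆⟩ := h
  have hQ : (0 : ℝ) < δ.Q := by exact_mod_cast δ.Q_pos
  set m := ⌊(δ.Q : ℝ) * (ρ.x' - ρ.x)⌋₊ with hm
  have hmQ : m ≤ δ.Q := floor_Q_mul_le (by linarith)
  have hm₁ : (m : ℝ) ≤ δ.Q * (ρ.x' - ρ.x) := Nat.floor_le (by nlinarith)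
  have hm₂ : δ.Q * (ρ.x' - ρ.x) < m + 1 := Nat.lt_floor_add_one _
  set i := δ.levelOf (ρ.x' - ρ.x) with hi
  have hx : (0 : ℝ) ≤ ρ.x * (2 ^ i : ℕ) := by positivity
  have hx' : (0 : ℝ) ≤ ρ.x' * (2 ^ i : ℕ) := mul_nonneg (by linarith) (by positivity)
  have hcase : i ≤ δ.L ∧ (2 ^ i : ℕ) * (ρ.x' - ρ.x) < 4 ∧
      (i = δ.L ∨ 2 ≤ (2 ^ i : ℕ) * (ρ.x' - ρ.x)) := by
    rw [hi, levelOf, ← hm]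
    split_ifs with he
    · set e := Nat.log 2 m with hedef
      have hm0 : m ≠ 0 := by rintro h; simp [hedef, h] at he
      have b₁ : 2 ^ e ≤ m := Nat.pow_log_le_self 2 hm0
      have b₂ : m < 2 ^ (e + 1) := Nat.lt_pow_succ_log_self (by norm_num) _
      have heL : e ≤ δ.L := (Nat.pow_le_pow_iff_right (by norm_num)).1 (b₁.trans hmQ)
      have hA : 2 ^ (δ.L + 1 - e) * 2 ^ (e - 1) = δ.Q := by
        rw [← pow_add, Q]; congr 1; omega
      have hA' : ((2 ^ (δ.L + 1 - e) : ℕ) : ℝ) * (2 ^ (e - 1) : ℕ) = δ.Q := by exact_mod_cast hA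
      have c₁ : ((2 ^ e : ℕ) : ℝ) ≤ m := by exact_mod_cast b₁
      have c₂ : (m : ℝ) + 1 ≤ (2 ^ (e + 1) : ℕ) := by exact_mod_cast b₂
      have d₁ : 2 ^ e = 2 * 2 ^ (e - 1) := by rw [← pow_succ']; congr 1; omega
      have d₂ : 2 ^ (e + 1) = 4 * 2 ^ (e - 1) := by rw [pow_succ, d₁]; ring
      have hp : (0 : ℝ) < (2 ^ (e - 1) : ℕ) := by positivity
      rw [d₁] at c₁
      rw [d₂] at c₂
      rw [← hA'] at hm₁ hm₂
      push_cast at *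
      refine ⟨by omega, ?_, Or.inr ?_⟩
      · by_contra hcon
        rw [not_lt] at hcon
        nlinarith
      · by_contra hcon
        rw [not_le] at hcon
        nlinarith
    · refine ⟨le_rfl, ?_, Or.inl rfl⟩
      have : m < 2 ^ 2 := Nat.lt_pow_of_log_lt (by norm_num) (by omega)
      have c : (m : ℝ) + 1 ≤ 4 := by exact_mod_cast this
      exact hm₂.trans_le c
  obtain ⟨k₁, k₂, k₃⟩ := hcase
  have f₁ := Nat.lt_floor_add_one (ρ.x * (2 ^ i : ℕ))
  have f₂ := Nat.floor_le hx'
  have f₃ := Nat.floor_le hx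
  refine ⟨k₁, rfl, rfl, rfl, rfl, floor_mul_mono h₂.le _, floor_mul_mono h₅.le _, ?_,
    floor_le_of_le_one h₃ _, floor_le_of_le_one h₆ _, k₃.imp_right fun k₃ => ?_⟩
  · have : ((⌊ρ.x' * (2 ^ i : ℕ)⌋₊ : ℕ) : ℝ) < (⌊ρ.x * (2 ^ i : ℕ)⌋₊ + 4 + 1 : ℕ) := by
      push_cast at *
      linarith
    exact Nat.lt_succ_iff.1 (by exact_mod_cast this)
  · refine Nat.le_floor ?_
    push_cast at *
    linarith

theorem levelQuery_spec {z : Cfg} (hz : δ.Fits z) {s : AS} (hV : δ.Valid s) (hρ : RectCtx ρ s)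
    (hu : ρ.Unit) :
    Wp z levelQuery s fun s' => ∃ i c₁ c₂ r₁ r₂ d : ℕ, δ.Span ρ i c₁ c₂ r₁ r₂ ∧
      SpanCtx δ ρ i c₁ c₂ r₁ r₂ s' ∧ s'.v .d = d ∧ s'.v .D = δ.D ∧
      (r₁ + 1 < r₂ → d = Nat.log 2 (r₂ - r₁ - 1)) ∧ (¬ r₁ + 1 < r₂ → d = 0) ∧
      s'.clk ≤ s.clk + 20 := by
  have hS := Rect.Unit.span (δ := δ) hu
  obtain ⟨h₁, h₂, h₃, h₄, h₅, h₆⟩ := hu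
  have hG := hz.G
  have hQG := δ.Q_le_G
  have hQ := δ.Q_pos
  have hIW := hz.I_le
  have hLQ := δ.L_lt_Q
  have hsm := hV.small
  set i := δ.levelOf (ρ.x' - ρ.x) with hi
  set c₁ := ⌊ρ.x * (2 ^ i : ℕ)⌋₊ with hc₁
  set c₂ := ⌊ρ.x' * (2 ^ i : ℕ)⌋₊ with hc₂
  set r₁ := ⌊ρ.y * (2 ^ (δ.L - i) : ℕ)⌋₊ with hr₁
  set r₂ := ⌊ρ.y' * (2 ^ (δ.L - i) : ℕ)⌋₊ with hr₂
  set m := ⌊(δ.Q : ℝ) * (ρ.x' - ρ.x)⌋₊ with hm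
  have hmQ : m ≤ δ.Q := floor_Q_mul_le (by linarith)
  have hlm : Nat.log 2 m ≤ δ.L := by
    calc Nat.log 2 m ≤ Nat.log 2 (2 ^ δ.L) := Nat.log_mono_right hmQ
      _ = δ.L := Nat.log_pow (by norm_num) _
  have hiL := hS.le
  have hA : 2 ^ i ≤ δ.Q := Nat.pow_le_pow_right (by norm_num) hiL
  have hR : 2 ^ (δ.L - i) ≤ δ.Q := Nat.pow_le_pow_right (by norm_num) (by omega)
  have l₁ := hS.c₁_le
  have l₂ := hS.r₁_le
  have l₃ := hS.c₂_le'
  have l₄ := hS.r₂_le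
  refine .seq (.ld 0 δ.Q (by simp) (by omega) hsm.par0 ?_)
  refine .seq (.ld 1 δ.L (by simp) (by omega) hsm.par1 ?_)
  refine .seq (.ld 2 δ.D (by simp) (by omega) hsm.par2 ?_)
  refine .seq (.asg δ.NC (by simp [Dat.NC]) (.seq (.asg δ.G (by simp [Dat.G]) ?_)))
  refine .seq (.flr m ?_ ?_ (by omega) ?_)
  · simp only [Ex.val_mul, Ex.val_sub, Ex.val_var, AS.setv_v, reduceCtorEq, if_false, if_true,
      hρ.x, hρ.x']
    exact mul_nonneg (Nat.cast_nonneg _) (by linarith)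
  · simp [hρ.x, hρ.x', hm]
  refine .seq (.ld m (Nat.log 2 m) (by simp) (by omega) (hsm.lg m hmQ) ?_)
  refine .seq (.use (P := fun s' => s'.v .i = i ∧ s'.clk ≤ s.clk + 9) ?_ ?_)
  · have hiv : i = if 1 < Nat.log 2 m then δ.L + 1 - Nat.log 2 m else δ.L := rfl
    refine .ite (fun h => .asg i ?_ ⟨by simp, by simp⟩) fun h => .asg i ?_ ⟨by simp, by simp⟩
    · simp only [Ex.val_one, Ex.val_var, AS.setv_v, if_true, Nat.one_lt_cast] at h
      rw [hiv, if_pos h, Nat.cast_sub (by omega)]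
      simp
    · simp only [Ex.val_one, Ex.val_var, AS.setv_v, if_true, Nat.one_lt_cast] at h
      rw [hiv, if_neg h]
      simp
  rintro s₁ ⟨i₁, t₁⟩ f₁
  have a₁ : s₁.a = s.a := by rw [show s₁.a = _ from funext fun r => f₁.2 r rfl]; rfl
  have L₁ : s₁.v .L = δ.L := by rw [f₁.1 _ rfl]; simp
  have D₁ : s₁.v .D = δ.D := by rw [f₁.1 _ rfl]; simp
  have NC₁ : s₁.v .NC = δ.NC := by rw [f₁.1 _ rfl]; simp
  have G₁ : s₁.v .G = δ.G := by rw [f₁.1 _ rfl]; simp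
  have x₁ : s₁.v .x = ρ.x := by rw [f₁.1 _ rfl]; simp [hρ.x]
  have x₁' : s₁.v .x' = ρ.x' := by rw [f₁.1 _ rfl]; simp [hρ.x']
  have y₁ : s₁.v .y = ρ.y := by rw [f₁.1 _ rfl]; simp [hρ.y]
  have y₁' : s₁.v .y' = ρ.y' := by rw [f₁.1 _ rfl]; simp [hρ.y']
  refine .seq (.ld i (2 ^ i) (by simp [i₁]) (by omega) (by rw [a₁]; exact hsm.pw i hiL) ?_)
  refine .seq (.ld (δ.L - i) (2 ^ (δ.L - i)) (by simp [i₁, L₁, Nat.cast_sub hiL]) (by omega)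
    (by rw [AS.setv_a, a₁]; exact hsm.pw _ (by omega)) ?_)
  refine .seq (.flr c₁ (by simp [x₁]; positivity) (by simp [x₁, hc₁]) (by omega) ?_)
  refine .seq (.flr c₂ (by simp [x₁']; linarith) (by simp [x₁', hc₂]) (by omega) ?_)
  refine .seq (.flr r₁ (by simp [y₁]; positivity) (by simp [y₁, hr₁]) (by omega) ?_)
  refine .seq (.flr r₂ (by simp [y₁']; linarith) (by simp [y₁', hr₂]) (by omega) ?_)
  refine .seq (.asg 0 (by simp) ?_)
  refine .ite (fun h => ?_) fun h => .skip ?_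
  · have h' : r₁ + 1 < r₂ := by
      simp only [Ex.val_add, Ex.val_one, Ex.val_var, AS.setv_v, reduceCtorEq, if_false,
        if_true] at h
      exact_mod_cast h
    refine .ld (r₂ - r₁ - 1) (Nat.log 2 (r₂ - r₁ - 1)) ?_ (by omega) ?_ ?_
    · simp [Nat.cast_sub (show 1 ≤ r₂ - r₁ by omega), Nat.cast_sub l₂]
    · simp only [AS.tick_a, AS.setv_a, a₁]
      exact hsm.lg _ (by omega)
    · refine ⟨i, c₁, c₂, r₁, r₂, _, hS, ⟨⟨?_, ?_, ?_, ?_⟩, ⟨?_, ?_, ?_, ?_, ?_⟩, ?_, ?_, ?_, ?_⟩,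
        by simp, ?_, fun _ => rfl, fun h => absurd h' h, by simp; omega⟩ <;>
      simp [x₁, x₁', y₁, y₁', i₁, NC₁, G₁, D₁]
  · have h' : ¬ r₁ + 1 < r₂ := by
      simp only [Ex.val_add, Ex.val_one, Ex.val_var, AS.setv_v, reduceCtorEq, if_false,
        if_true] at h
      exact_mod_cast h
    refine ⟨i, c₁, c₂, r₁, r₂, 0, hS, ⟨⟨?_, ?_, ?_, ?_⟩, ⟨?_, ?_, ?_, ?_, ?_⟩, ?_, ?_, ?_, ?_⟩,
        by simp, ?_, fun h => absurd h h', fun _ => rfl, by simp; omega⟩ <;>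
      simp [x₁, x₁', y₁, y₁', i₁, NC₁, G₁, D₁]

/-- If `d ≥ D`, the rows strictly between `r₁` and `r₂` contain a run of `2 ^ D` cells of the column
`c₁ + 1`, and these cells lie inside the rectangle; by `Regular.run` it contains a point. Positivity
of `D` ensures that the default `d = 0`, used when there are no such rows, never triggers this
shortcut. -/
theorem unitQuery_spec {z : Cfg} (hz : δ.Fits z) (hδ : δ.Good) (hD : 0 < δ.D) {s : AS}
    (hV : δ.Valid s) (hρ : RectCtx ρ s) (hu : ρ.Unit) (hans : s.v .ans = 1) :
    Wp z (unitQuery δ.N) s fun s' => δ.Res ρ (fun _ => True) s' ∧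
      s'.clk ≤ s.clk + 5 * (83 + 22 * δ.N) + 24 := by
  have hDI := hz.D
  have hG := hz.G
  have hQG := δ.Q_le_G
  have hLQ := δ.L_lt_Q
  refine .seq (.use (levelQuery_spec hz hV hρ hu) ?_)
  rintro s₁ ⟨i, c₁, c₂, r₁, r₂, d, hS, hs, d₁, D₁, h₁, h₂, t₁⟩ f₁
  have hans₁ : s₁.v .ans = 1 := by rw [f₁.1 _ rfl, hans]
  have hV₁ : δ.Valid s₁ := hV.of_eq (funext fun r => f₁.2 r rfl)
  have hR := hS.r₂_le
  have hpow : r₁ + 1 < r₂ → 2 ^ d ≤ r₂ - r₁ - 1 := fun h => h₁ h ▸ Nat.pow_log_le_self 2 (by omega)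
  refine .ite (fun h => ?_) fun h => .asg 0 (by simp) ⟨Or.inl ⟨by simp, fun hreg => ?_⟩, ?_⟩
  · simp only [Ex.val_var, d₁, D₁, Nat.cast_lt] at h
    have hdL : d ≤ δ.L := by
      by_cases hr : r₁ + 1 < r₂
      · have : 2 ^ d ≤ 2 ^ (δ.L - i) := by have := hpow hr; omega
        exact ((Nat.pow_le_pow_iff_right (by norm_num)).1 this).trans (by omega)
      · rw [h₂ hr]; omega
    refine .seq (.ld d (2 ^ d) (by simp [d₁]) (by omega) (hV₁.small.pw d hdL) ?_)
    refine .use (colsQuery_spec (d := d) hz hδ hS (hV₁.of_eq rfl) (hs.setv (by simp)) (by simp [hans₁])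
      (by simp [d₁]) (by simp) h h₁) ?_
    rintro s₂ ⟨q, t⟩ -
    simp only [AS.setv_clk, AS.tick_clk] at t
    exact ⟨q, by omega⟩
  · simp only [Ex.val_var, d₁, D₁, Nat.cast_lt, not_lt] at h
    have hr : r₁ + 1 < r₂ := by
      by_contra hr
      have := h₂ hr
      omega
    have hc : c₁ + 2 ≤ c₂ := by
      refine hS.lt.resolve_left fun h => ?_
      rw [h] at hR
      simp at hR
      omega
    have hle : 2 ^ δ.D ≤ 2 ^ d := Nat.pow_le_pow_right (by norm_num) h
    have hp := hpow hr
    have hc₂ := hS.c₂_le'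
    obtain ⟨p, hpn, e₁, e₂, e₃⟩ := hreg.run i hS.le (c₁ + 1) (by omega) (r₁ + 1) (by omega)
    have b₁ := hS.c₁_eq
    have b₂ := hS.c₂_eq
    have b₃ := hS.r₁_eq
    have b₄ := hS.r₂_eq
    exact ⟨p, hpn, lt_of_floor_mul_lt (m := 2 ^ i) (by omega),
      (lt_of_floor_mul_lt (m := 2 ^ i) (by omega)).le,
      lt_of_floor_mul_lt (m := 2 ^ (δ.L - i)) (by omega),
      (lt_of_floor_mul_lt (m := 2 ^ (δ.L - i)) (by omega)).le⟩
  · simp only [AS.setv_clk, AS.tick_clk]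
    omega

/-- The points lie in the open unit square, so clipping the rectangle to the closed square loses
none of them. A rectangle that is empty after clipping keeps the initial answer `1`. -/
theorem queryProg_spec {z : Cfg} (hz : δ.Fits z) (hδ : δ.Good) (hD : 0 < δ.D) {s : AS}
    (hV : δ.Valid s) (hρ : RectCtx ρ s) :
    Wp z (queryProg δ.J) s fun s' => (s'.v .ans = 0 ∧ (δ.Regular → ∃ p, δ.Inside ρ p) ∨
      s'.v .ans = 1 ∧ (δ.Regular → ∀ p, ¬ δ.Inside ρ p)) ∧
      s'.clk ≤ s.clk + 5 * (83 + 22 * δ.N) + 40 := by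
  refine .seq (.asg 1 (by simp) ?_)
  refine .seq (.use (P := fun s' => s'.v .x = max ρ.x 0 ∧ s'.clk ≤ s.clk + 3) ?_ ?_)
  · refine .ite (fun h => .asg 0 (by simp) ?_) fun h => .skip ?_ <;>
      simp [hρ.x] at h ⊢ <;> (first | simp [le_of_lt h] | simp [h])
  rintro s₁ ⟨x₁, t₁⟩ f₁
  refine .seq (.use (P := fun s' => s'.v .y = max ρ.y 0 ∧ s'.clk ≤ s.clk + 5) ?_ ?_)
  · have y₁ : s₁.v .y = ρ.y := by rw [f₁.1 _ rfl]; simp [hρ.y]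
    refine .ite (fun h => .asg 0 (by simp) ?_) fun h => .skip ?_ <;>
      simp [y₁] at h ⊢ <;> (first | simp [le_of_lt h] | simp [h]) <;> omega
  rintro s₂ ⟨y₂, t₂⟩ f₂
  refine .seq (.use (P := fun s' => s'.v .x' = min ρ.x' 1 ∧ s'.clk ≤ s.clk + 7) ?_ ?_)
  · have x₂ : s₂.v .x' = ρ.x' := by rw [f₂.1 _ rfl, f₁.1 _ rfl]; simp [hρ.x']
    refine .ite (fun h => .asg 1 (by simp) ?_) fun h => .skip ?_ <;>
      simp [x₂] at h ⊢ <;> (first | simp [le_of_lt h] | simp [h]) <;> omega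
  rintro s₃ ⟨x₃, t₃⟩ f₃
  refine .seq (.use (P := fun s' => s'.v .y' = min ρ.y' 1 ∧ s'.clk ≤ s.clk + 9) ?_ ?_)
  · have y₃ : s₃.v .y' = ρ.y' := by rw [f₃.1 _ rfl, f₂.1 _ rfl, f₁.1 _ rfl]; simp [hρ.y']
    refine .ite (fun h => .asg 1 (by simp) ?_) fun h => .skip ?_ <;>
      simp [y₃] at h ⊢ <;> (first | simp [le_of_lt h] | simp [h]) <;> omega
  rintro s₄ ⟨y₄, t₄⟩ f₄
  set ρ' : Rect := ⟨max ρ.x 0, min ρ.x' 1, max ρ.y 0, min ρ.y' 1⟩ with hρ'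
  have e₁ : s₄.v .x = ρ'.x := by rw [f₄.1 _ rfl, f₃.1 _ rfl, f₂.1 _ rfl, x₁]
  have e₂ : s₄.v .x' = ρ'.x' := by rw [f₄.1 _ rfl, x₃]
  have e₃ : s₄.v .y = ρ'.y := by rw [f₄.1 _ rfl, f₃.1 _ rfl, y₂]
  have e₄ : s₄.v .y' = ρ'.y' := y₄
  have e₅ : s₄.v .ans = 1 := by
    rw [f₄.1 _ rfl, f₃.1 _ rfl, f₂.1 _ rfl, f₁.1 _ rfl]; simp
  have hV₄ : δ.Valid s₄ := hV.of_eq (funext fun r => by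
    rw [f₄.2 _ rfl, f₃.2 _ rfl, f₂.2 _ rfl, f₁.2 _ rfl]; rfl)
  have hin : ∀ p, δ.Inside ρ p ↔ δ.Inside ρ' p := by
    intro p
    unfold Inside
    refine and_congr_right fun hp => ?_
    obtain ⟨b₁, b₂, b₃, b₄⟩ := hδ.pos p hp
    simp only [hρ', max_lt_iff, le_min_iff]
    exact ⟨fun h => ⟨⟨h.1, b₁⟩, ⟨h.2.1, b₂.le⟩, ⟨h.2.2.1, b₃⟩, h.2.2.2, b₄.le⟩,
      fun h => ⟨h.1.1, h.2.1.1, h.2.2.1.1, h.2.2.2.1⟩⟩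
  simp only [hin]
  refine .ite (fun h => .ite (fun h' => ?_) fun h' => .skip ?_) fun h => .skip ?_
  · simp only [Ex.val_var, AS.tick_v, e₁, e₂, e₃, e₄] at h h'
    refine .use (unitQuery_spec (ρ := ρ') hz hδ hD (hV₄.of_eq rfl) ⟨by simp [e₁], by simp [e₂],
      by simp [e₃], by simp [e₄]⟩ ⟨le_max_right _ _, h, min_le_right _ _, le_max_right _ _, h',
      min_le_right _ _⟩ (by simp [e₅])) ?_
    rintro s₅ ⟨q, t⟩ -
    simp only [AS.tick_clk] at t
    refine ⟨q.imp id fun q => ⟨q.1, fun hR p => q.2 hR p trivial⟩, by omega⟩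
  · simp only [Ex.val_var, AS.tick_v, e₁, e₂, e₃, e₄] at h h'
    exact ⟨Or.inr ⟨by simp [e₅], fun _ p hp => h' (hp.2.2.2.1.trans_le hp.2.2.2.2)⟩,
      by simp; omega⟩
  · simp only [Ex.val_var, e₁, e₂] at h
    exact ⟨Or.inr ⟨by simp [e₅], fun _ p hp => h (hp.2.1.trans_le hp.2.2.1)⟩, by simp; omega⟩

end Dat

end RealRAM

/-! ## Uniform points -/

/-- The uniform distribution on the unit square. -/
noncomputable def unitSquare : Measure (ℝ × ℝ) :=
  (volume : Measure (ℝ × ℝ)).restrict (Icc 0 1 ×ˢ Icc 0 1)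

theorem volume_prod_set (s t : Set ℝ) :
    (volume : Measure (ℝ × ℝ)) (s ×ˢ t) = volume s * volume t := by
  rw [Measure.volume_eq_prod, Measure.prod_prod]

instance : IsProbabilityMeasure unitSquare := by
  refine ⟨?_⟩
  rw [unitSquare, Measure.restrict_apply_univ, volume_prod_set]
  simp

theorem uniformPoints_eq (n : ℕ) : uniformPoints n = Measure.pi fun _ => unitSquare := rfl

instance (n : ℕ) : IsProbabilityMeasure (uniformPoints n) := by
  rw [uniformPoints_eq]; infer_instance

theorem uniformPoints_forall_mem {n : ℕ} (A : Finset (Fin n)) (S : Set (ℝ × ℝ)) :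
    uniformPoints n {P | ∀ p ∈ A, P p ∈ S} = unitSquare S ^ A.card := by
  classical
  have : {P : Fin n → ℝ × ℝ | ∀ p ∈ A, P p ∈ S} =
      Set.pi univ fun p => if p ∈ A then S else univ := by
    ext P
    simp only [mem_ofPred_eq, mem_pi, mem_univ, true_imp_iff]
    refine forall_congr' fun p => ?_
    split_ifs with h <;> simp [h]
  rw [this, uniformPoints_eq, Measure.pi_pi]
  have h : ∀ p, unitSquare (if p ∈ A then S else univ) = if p ∈ A then unitSquare S else 1 := by
    intro p; split_ifs <;> simp
  simp [h]

/-- At least `m` points lie in `S`. -/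
def Crowd (n m : ℕ) (S : Set (ℝ × ℝ)) : Set (Fin n → ℝ × ℝ) :=
  ⋃ A ∈ (Finset.univ : Finset (Fin n)).powersetCard m, {P | ∀ p ∈ A, P p ∈ S}

theorem measurableSet_crowd (n m : ℕ) {S : Set (ℝ × ℝ)} (hS : MeasurableSet S) :
    MeasurableSet (Crowd n m S) := by
  refine Finset.measurableSet_biUnion _ fun A _ => ?_
  have : {P : Fin n → ℝ × ℝ | ∀ p ∈ A, P p ∈ S} = ⋂ p ∈ A, (fun P => P p) ⁻¹' S := by
    ext P; simp
  rw [this]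
  exact Finset.measurableSet_biInter _ fun p _ => measurable_pi_apply p hS

/-- Union bound over the sets of `m` points, of which there are at most `n ^ m`. -/
theorem uniformPoints_crowd_le (n m : ℕ) {S : Set (ℝ × ℝ)} {q : ℝ≥0∞} (hS : unitSquare S ≤ q) :
    uniformPoints n (Crowd n m S) ≤ (n * q) ^ m := by
  refine (measure_biUnion_finset_le _ _).trans ?_
  calc _ ≤ ∑ A ∈ (Finset.univ : Finset (Fin n)).powersetCard m, q ^ m := by
        refine Finset.sum_le_sum fun A hA => ?_
        rw [uniformPoints_forall_mem, (Finset.mem_powersetCard.1 hA).2]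
        exact pow_le_pow_left' hS m
    _ = (n.choose m : ℝ≥0∞) * q ^ m := by simp
    _ ≤ (n ^ m : ℕ) * q ^ m := by gcongr; exact Nat.choose_le_pow n m
    _ = _ := by rw [mul_pow]; push_cast; rfl

theorem uniformPoints_forall_notMem (n : ℕ) {S : Set (ℝ × ℝ)} (hS : MeasurableSet S) :
    uniformPoints n {P | ∀ p, P p ∉ S} = (1 - unitSquare S) ^ n := by
  have := uniformPoints_forall_mem (n := n) Finset.univ Sᶜ
  simp only [Finset.mem_univ, true_imp_iff, mem_compl_iff, Finset.card_univ, Fintype.card_fin,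
    prob_compl_eq_one_sub hS] at this
  exact this

/-- The points are almost surely in the open unit square. -/
theorem ae_uniformPoints_pos (n : ℕ) :
    ∀ᵐ P ∂(uniformPoints n), ∀ p, P p ∈ Ioo (0 : ℝ) 1 ×ˢ Ioo (0 : ℝ) 1 := by
  have h : ∀ᵐ z ∂unitSquare, z ∈ Ioo (0 : ℝ) 1 ×ˢ Ioo (0 : ℝ) 1 := by
    have : unitSquare = (volume : Measure (ℝ × ℝ)).restrict (Ioo 0 1 ×ˢ Ioo 0 1) := by
      rw [unitSquare, Measure.volume_eq_prod, ← Measure.prod_restrict, ← Measure.prod_restrict,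
        Measure.restrict_congr_set Ioo_ae_eq_Icc]
    rw [this]
    exact ae_restrict_mem (measurableSet_Ioo.prod measurableSet_Ioo)
  rw [ae_all_iff]
  intro p
  rw [uniformPoints_eq]
  exact (measurePreserving_eval (fun _ : Fin n => unitSquare) p).quasiMeasurePreserving.ae h

/-- The cell in column `a` and in the rows `b, …, b + w - 1` of a grid with `M` columns and `N`
rows. -/
def gridBox (M N a b w : ℕ) : Set (ℝ × ℝ) :=
  Ico ((a : ℝ) / M) ((a + 1 : ℕ) / M) ×ˢ Ico ((b : ℝ) / N) ((b + w : ℕ) / N)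

theorem measurableSet_gridBox (M N a b w : ℕ) : MeasurableSet (gridBox M N a b w) :=
  measurableSet_Ico.prod measurableSet_Ico

theorem volume_gridBox {M N : ℕ} (hM : 0 < M) (hN : 0 < N) (a b w : ℕ) :
    volume (gridBox M N a b w) = (w : ℝ≥0∞) / (M * N : ℕ) := by
  have hM' : (0 : ℝ) < M := by exact_mod_cast hM
  have hN' : (0 : ℝ) < N := by exact_mod_cast hN
  rw [gridBox, volume_prod_set, Real.volume_Ico, Real.volume_Ico,
    ← ENNReal.ofReal_mul (by rw [← sub_div]; push_cast; simp),
    show (((a + 1 : ℕ) : ℝ) / M - a / M) * (((b + w : ℕ) : ℝ) / N - b / N) = w / (M * N : ℕ) by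
      push_cast; field_simp; ring,
    ENNReal.ofReal_div_of_pos (by positivity), ENNReal.ofReal_natCast, ENNReal.ofReal_natCast]

theorem unitSquare_gridBox_le {M N : ℕ} (hM : 0 < M) (hN : 0 < N) (a b w : ℕ) :
    unitSquare (gridBox M N a b w) ≤ (w : ℝ≥0∞) / (M * N : ℕ) :=
  (Measure.restrict_le_self _).trans_eq (volume_gridBox hM hN a b w)

theorem unitSquare_gridBox {M N a b w : ℕ} (ha : a < M) (hb : b + w ≤ N) (hN : 0 < N) :
    unitSquare (gridBox M N a b w) = (w : ℝ≥0∞) / (M * N : ℕ) := by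
  have hM : 0 < M := by omega
  rw [← volume_gridBox hM hN a b w, unitSquare,
    Measure.restrict_apply (measurableSet_gridBox M N a b w), inter_eq_left.2]
  have hM' : (0 : ℝ) < M := by exact_mod_cast hM
  have hN' : (0 : ℝ) < N := by exact_mod_cast hN
  have h₁ : ((a + 1 : ℕ) : ℝ) / M ≤ 1 := by rw [div_le_one hM']; exact_mod_cast ha
  have h₂ : ((b + w : ℕ) : ℝ) / N ≤ 1 := by rw [div_le_one hN']; exact_mod_cast hb
  rintro ⟨x, y⟩ ⟨⟨hx, hx'⟩, hy, hy'⟩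
  exact ⟨⟨(by positivity : (0 : ℝ) ≤ a / M).trans hx, hx'.le.trans h₁⟩,
    (by positivity : (0 : ℝ) ≤ b / N).trans hy, hy'.le.trans h₂⟩

/-- Boxes are closed below and open above so that membership is exactly the floor condition by which
the programs assign points to cells. -/
theorem mem_gridBox {M N a b w : ℕ} (hM : 0 < M) (hN : 0 < N) {x y : ℝ} (hx : 0 ≤ x)
    (hy : 0 ≤ y) : (x, y) ∈ gridBox M N a b w ↔
      ⌊x * M⌋₊ = a ∧ b ≤ ⌊y * N⌋₊ ∧ ⌊y * N⌋₊ < b + w := by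
  have hM' : (0 : ℝ) < M := by exact_mod_cast hM
  have hN' : (0 : ℝ) < N := by exact_mod_cast hN
  rw [gridBox, mem_prod, mem_Ico, mem_Ico, div_le_iff₀ hM', lt_div_iff₀ hM', div_le_iff₀ hN',
    lt_div_iff₀ hN', Nat.floor_eq_iff (by positivity), Nat.le_floor_iff (by positivity),
    Nat.floor_lt (by positivity)]
  push_cast
  rfl

namespace RealRAM

/-! ## The data structure for random points -/

/-- The data structure for the points `P`. -/
noncomputable def dat (J K : ℕ) {n : ℕ} (P : Fin n → ℝ × ℝ) : Dat :=
  ⟨n, Nat.clog 2 n, Nat.clog 2 (K * Nat.clog 2 n), J, (inputMemory P).real⟩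

section Events

variable (J K n : ℕ)

/-- The data structure without points. -/
noncomputable def shape : Dat := dat J K (n := n) 0

/-- The cell `g` has a crowded subcolumn or subrow when divided into `2 ^ t` parts. -/
noncomputable def crowded (g t : ℕ) : Set (Fin n → ℝ × ℝ) :=
  ⋃ a ∈ Finset.range (2 ^ t),
    (Crowd n (J + 1) (gridBox ((shape J K n).cols g * 2 ^ t) ((shape J K n).rows g)
      ((shape J K n).col g * 2 ^ t + a) ((shape J K n).row g) 1) ∪
    Crowd n (J + 1) (gridBox ((shape J K n).cols g) ((shape J K n).rows g * 2 ^ t)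
      ((shape J K n).col g) ((shape J K n).row g * 2 ^ t + a) 1))

/-- The runs of `2 ^ D` cells of a column. -/
noncomputable def runs : Finset (ℕ × ℕ × ℕ) :=
  (Finset.range ((shape J K n).L + 1)).biUnion fun i =>
    ((Finset.range (2 ^ i) ×ˢ Finset.range (2 ^ ((shape J K n).L - i))).image fun q => (i, q)).filter
      fun q => q.2.2 + 2 ^ (shape J K n).D ≤ 2 ^ ((shape J K n).L - i)

/-- The event that excludes wrong answers. -/
noncomputable def badEvent : Set (Fin n → ℝ × ℝ) :=
  (⋃ g ∈ Finset.range (shape J K n).G, crowded J K n g (shape J K n).L) ∪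
  ⋃ q ∈ runs J K n, {P | ∀ p, P p ∉
    gridBox (2 ^ q.1) (2 ^ ((shape J K n).L - q.1)) q.2.1 q.2.2 (2 ^ (shape J K n).D)}

/-- An upper bound for the cost of the data structure. -/
noncomputable def costBound (P : Fin n → ℝ × ℝ) : ℝ≥0∞ :=
  (((shape J K n).D + 2) * (shape J K n).G : ℕ) + ∑ g ∈ Finset.range (shape J K n).G,
    (1 + ∑ t ∈ Finset.range (shape J K n).L,
      32 ^ (t + 1) * (crowded J K n g t).indicator 1 P)

end Events

variable {J K n : ℕ} {P : Fin n → ℝ × ℝ}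

theorem dat_px (p : Fin n) : (dat J K P).px p = (P p).1 := by
  have h : 2 * (p : ℕ) / 2 < n := by omega
  simp only [Dat.px, dat, inputMemory, dif_pos h]
  rw [if_pos (by omega)]
  congr 3
  omega

theorem dat_py (p : Fin n) : (dat J K P).py p = (P p).2 := by
  have h : (2 * (p : ℕ) + 1) / 2 < n := by omega
  simp only [Dat.py, dat, inputMemory, dif_pos h]
  rw [if_neg (by omega)]
  congr 3
  omega

theorem dat_good (hn : 2 ≤ n) (hP : ∀ p, P p ∈ Ioo (0 : ℝ) 1 ×ˢ Ioo (0 : ℝ) 1) :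
    (dat J K P).Good where
  two_le := hn
  le_Q := Nat.le_pow_clog (by norm_num) n
  pos p hp := by
    have h₁ := dat_px (J := J) (K := K) (P := P) ⟨p, hp⟩
    have h₂ := dat_py (J := J) (K := K) (P := P) ⟨p, hp⟩
    simp only at h₁ h₂
    rw [h₁, h₂]
    obtain ⟨⟨a, b⟩, c, d⟩ := hP ⟨p, hp⟩
    exact ⟨a, b, c, d⟩

theorem measurableSet_crowded (g t : ℕ) : MeasurableSet (crowded J K n g t) :=
  Finset.measurableSet_biUnion _ fun _ _ =>
    (measurableSet_crowd _ _ (measurableSet_gridBox _ _ _ _ _)).union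
      (measurableSet_crowd _ _ (measurableSet_gridBox _ _ _ _ _))

/-- The bound is a finite combination of indicators of measurable events. Using it in place of the
true cost makes it unnecessary to know that running time and space are measurable. -/
theorem measurable_costBound : Measurable (costBound J K n) := by
  have h : ∀ g t, Measurable ((crowded J K n g t).indicator (1 : (Fin n → ℝ × ℝ) → ℝ≥0∞)) :=
    fun g t => measurable_one.indicator (measurableSet_crowded g t)
  unfold costBound
  fun_prop

/-- Many points of a list in a set form a crowd. -/
theorem mem_crowd {l : List ℕ} {f : ℕ → Bool} {m : ℕ} {S : Set (ℝ × ℝ)} (hl : l.Nodup)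
    (hlt : ∀ p ∈ l, p < n) (hm : m ≤ l.countP f)
    (hS : ∀ p : Fin n, (p : ℕ) ∈ l → f p = true → P p ∈ S) : P ∈ Crowd n m S := by
  classical
  set F : Finset (Fin n) := Finset.univ.filter fun p => (p : ℕ) ∈ l ∧ f p = true with hF
  have hcard : l.countP f ≤ F.card := by
    rw [List.countP_eq_length_filter, ← List.toFinset_card_of_nodup (hl.filter f)]
    rw [← Finset.card_image_of_injective F Fin.val_injective]
    refine Finset.card_le_card fun p hp => ?_
    rw [List.mem_toFinset, List.mem_filter] at hp
    exact Finset.mem_image.2 ⟨⟨p, hlt p hp.1⟩, by simp [hF, hp.1, hp.2], rfl⟩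
  obtain ⟨A, hA, hA'⟩ := Finset.exists_subset_card_eq (hm.trans hcard)
  simp only [Crowd, mem_iUnion]
  refine ⟨A, Finset.mem_powersetCard.2 ⟨Finset.subset_univ _, hA'⟩, fun p hp => ?_⟩
  have := hA hp
  simp only [hF, Finset.mem_filter, Finset.mem_univ, true_and] at this
  exact hS p this.1 this.2

/-- The floor of `t * (A * B)` if the floor of `t * A` is `c` and `t * A - c` is in part `a`. -/
theorem floor_of_sub {t : ℝ} {A B c a : ℕ} (ht : 0 ≤ t) (hB : 0 < B) (hc : ⌊t * A⌋₊ = c)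
    (ha : Dat.sub B (t * A - c) = a) : ⌊t * (A * B : ℕ)⌋₊ = c * B + a := by
  have hB' : (0 : ℝ) < B := by exact_mod_cast hB
  rw [Nat.floor_eq_iff (by positivity)] at hc
  have h₀ : 0 ≤ (t * A - c) * B := mul_nonneg (by linarith) hB'.le
  have h₁ : ⌊(t * A - c) * B⌋₊ < B := by
    rw [Nat.floor_lt h₀]; nlinarith
  rw [Dat.sub, min_eq_left (by omega), Nat.floor_eq_iff h₀] at ha
  rw [Nat.floor_eq_iff (by positivity)]
  push_cast
  constructor <;> nlinarith

/-- A subcolumn of a cell is itself a box of the grid with `2 ^ t` times as many columns, and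
similarly for subrows. An overfull strip is thus a crowd in one of the boxes in the definition of
`crowded`. -/
theorem mem_crowded (hn : 2 ≤ n) (hP : ∀ p, P p ∈ Ioo (0 : ℝ) 1 ×ˢ Ioo (0 : ℝ) 1) {g t : ℕ}
    (hg : g < (dat J K P).G) (h : ¬ (dat J K P).Fine g (2 ^ t)) : P ∈ crowded J K n g t := by
  have hδ := dat_good (J := J) (K := K) hn hP
  set δ := dat J K P with hδdef
  have hlt : ∀ p ∈ δ.pts g, p < n := fun p hp => ((hδ.mem_pts hg).1 hp).1
  have hpos : ∀ p : Fin n, 0 ≤ δ.px p ∧ 0 ≤ δ.py p := fun p =>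
    ⟨(hδ.pos p p.2).1.le, (hδ.pos p p.2).2.2.1.le⟩
  have hcell : ∀ p : Fin n, (p : ℕ) ∈ δ.pts g → ⌊δ.px p * δ.cols g⌋₊ = δ.col g ∧
      ⌊δ.py p * δ.rows g⌋₊ = δ.row g := by
    intro p hp
    have hc := ((hδ.mem_pts hg).1 hp).2
    have h₁ := hδ.col_cell (Dat.lev_le hg) p.2
    have h₂ := hδ.row_cell (Dat.lev_le hg) p.2
    rw [hc] at h₁ h₂
    exact ⟨h₁.symm, h₂.symm⟩
  have hPp : ∀ p : Fin n, P p = (δ.px p, δ.py p) := fun p => by rw [dat_px, dat_py]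
  have ht : 0 < 2 ^ t := by positivity
  simp only [Dat.Fine, not_forall, not_and_or, not_le] at h
  obtain ⟨a, ha, h⟩ := h
  simp only [crowded, mem_iUnion, Finset.mem_range]
  refine ⟨a, ha, h.imp (fun h => ?_) fun h => ?_⟩
  · refine mem_crowd (hδ.nodup_pts g) hlt h fun p hp hpa => ?_
    simp only [decide_eq_true_eq] at hpa
    obtain ⟨h₁, h₂⟩ := hcell p hp
    rw [hPp]
    refine (mem_gridBox (Nat.mul_pos (δ.cols_pos g) ht) (δ.rows_pos g) (hpos p).1 (hpos p).2).2
      ⟨floor_of_sub (hpos p).1 ht h₁ hpa, ?_⟩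
    exact ⟨h₂.ge, Nat.lt_succ_of_le h₂.le⟩
  · refine mem_crowd (hδ.nodup_pts g) hlt h fun p hp hpa => ?_
    simp only [decide_eq_true_eq] at hpa
    obtain ⟨h₁, h₂⟩ := hcell p hp
    rw [hPp]
    refine (mem_gridBox (δ.cols_pos g) (Nat.mul_pos (δ.rows_pos g) ht) (hpos p).1 (hpos p).2).2
      ⟨h₁, ?_⟩
    have h₃ := floor_of_sub (hpos p).2 ht h₂ hpa
    exact ⟨h₃.ge, Nat.lt_succ_of_le h₃.le⟩

/-- If `B = 2 ^ (j + 1)`, the division into `2 ^ j` parts was rejected, so the event `crowded g j`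
occurred, and its term `32 ^ (j + 1)` alone equals `B ^ 5`. The summand `1` accounts for `B = 1`. -/
theorem cost_le_costBound (hn : 2 ≤ n) (hP : ∀ p, P p ∈ Ioo (0 : ℝ) 1 ×ˢ Ioo (0 : ℝ) 1) :
    ((dat J K P).cost : ℝ≥0∞) ≤ costBound J K n P := by
  classical
  rw [Dat.cost, Nat.cast_add, costBound]
  refine add_le_add le_rfl ?_
  rw [Nat.cast_sum]
  refine Finset.sum_le_sum fun g hg => ?_
  have hg' := Finset.mem_range.1 hg
  rcases h : (dat J K P).ex g with _ | j
  · rw [Dat.B, h]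
    simp
  · have hj : ¬ ((dat J K P).Fine g (2 ^ j) ∨ (dat J K P).L ≤ j) :=
      Nat.find_min ((dat J K P).exists_fine g) (show j < (dat J K P).ex g by omega)
    rw [not_or, not_le] at hj
    have hmem := mem_crowded hn hP hg' hj.1
    calc (((dat J K P).B g ^ 5 : ℕ) : ℝ≥0∞) = 32 ^ (j + 1) * (crowded J K n g j).indicator 1 P := by
          rw [indicator_of_mem hmem, Dat.B, h, ← pow_mul, mul_comm, pow_mul]
          norm_num
      _ ≤ ∑ t ∈ Finset.range (shape J K n).L,
          32 ^ (t + 1) * (crowded J K n g t).indicator 1 P :=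
          Finset.single_le_sum (f := fun t => (32 : ℝ≥0∞) ^ (t + 1) *
            (crowded J K n g t).indicator 1 P) (fun _ _ => zero_le) (Finset.mem_range.2 hj.2)
      _ ≤ _ := le_add_self

theorem regular_of_notMem (hn : 2 ≤ n) (hP : ∀ p, P p ∈ Ioo (0 : ℝ) 1 ×ˢ Ioo (0 : ℝ) 1)
    (h : P ∉ badEvent J K n) : (dat J K P).Regular := by
  simp only [badEvent, mem_union, mem_iUnion, not_or, not_exists, mem_ofPred_eq, not_forall,
    not_not] at h
  obtain ⟨h₁, h₂⟩ := h
  constructor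
  · intro g hg
    refine ((dat J K P).B_spec g).elim id fun hB => ?_
    by_contra hF
    rw [hB] at hF
    exact h₁ g (Finset.mem_range.2 hg) (mem_crowded hn hP hg hF)
  · intro i hi c hc r hr
    obtain ⟨p, hp⟩ := h₂ (i, c, r) (by
      simp only [runs, Finset.mem_biUnion, Finset.mem_filter, Finset.mem_image, Finset.mem_product,
        Finset.mem_range]
      have : 0 < 2 ^ (dat J K P).D := by positivity
      exact ⟨i, Nat.lt_succ_of_le hi, ⟨(c, r), ⟨hc, show r < 2 ^ ((dat J K P).L - i) by omega⟩, rfl⟩,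
        hr⟩)
    have hδ := dat_good (J := J) (K := K) hn hP
    have hpos := hδ.pos p p.2
    have e : P p = ((dat J K P).px p, (dat J K P).py p) := by rw [dat_px, dat_py]
    rw [e, mem_gridBox (by positivity) (by positivity) hpos.1.le hpos.2.2.1.le] at hp
    exact ⟨p, p.2, hp⟩


/-! ### Expected cost and probability of failure -/

variable {J K n : ℕ}

theorem shape_le_Q : n ≤ (shape J K n).Q := Nat.le_pow_clog (by norm_num) n

theorem shape_Q_le (hn : 2 ≤ n) : (shape J K n).Q ≤ 2 * n := by
  have h := Nat.pow_pred_clog_lt_self (b := 2) (by norm_num) (x := n) (by omega)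
  have h₁ : 1 ≤ Nat.clog 2 n := Nat.clog_pos (by norm_num) hn
  have h₂ : (shape J K n).Q = 2 * 2 ^ (Nat.clog 2 n).pred := by
    rw [← pow_succ', Nat.pred_eq_sub_one, Nat.sub_add_cancel h₁]; rfl
  omega

theorem shape_one_le_L (hn : 2 ≤ n) : 1 ≤ (shape J K n).L := Nat.clog_pos (by norm_num) hn

/-- Each of the `2 * 2 ^ t` strips has area `1 / (Q * 2 ^ t)`, so it holds at most `2 ^ (-t)` points
on average and `J + 1` points with probability at most `2 ^ (-t * (J + 1))`. One factor `2 ^ (-t)`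
is spent on the number of strips. -/
theorem uniformPoints_crowded_le {g : ℕ} (hg : g < (shape J K n).G) (t : ℕ) :
    uniformPoints n (crowded J K n g t) ≤ 2 * ((2 ^ t : ℝ≥0∞)⁻¹) ^ J := by
  set δ := shape J K n with hδ
  have ht : 0 < 2 ^ t := by positivity
  have hQ : δ.cols g * δ.rows g = δ.Q := Dat.cols_mul_rows hg
  have hnQ : n ≤ δ.Q := shape_le_Q
  have b0 : (2 ^ t : ℝ≥0∞) ≠ 0 := by positivity
  have bt : (2 ^ t : ℝ≥0∞) ≠ ⊤ := by simp
  have key : ∀ m : ℕ, m = δ.Q * 2 ^ t →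
      (n : ℝ≥0∞) * ((1 : ℕ) / (m : ℕ)) ≤ (2 ^ t : ℝ≥0∞)⁻¹ := by
    rintro m rfl
    have hQ0 : (δ.Q : ℝ≥0∞) ≠ 0 := by exact_mod_cast δ.Q_pos.ne'
    rw [Nat.cast_one, one_div, Nat.cast_mul,
      ENNReal.mul_inv (Or.inl hQ0) (Or.inl (ENNReal.natCast_ne_top _)), ← mul_assoc]
    have h₁ : (n : ℝ≥0∞) * (δ.Q : ℝ≥0∞)⁻¹ ≤ 1 := by
      rw [← div_eq_mul_inv]
      exact ENNReal.div_le_of_le_mul (by rw [one_mul]; exact_mod_cast hnQ)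
    calc _ ≤ 1 * ((2 ^ t : ℕ) : ℝ≥0∞)⁻¹ := by gcongr
      _ = _ := by rw [one_mul]; push_cast; rfl
  have h₁ : ∀ a, uniformPoints n (Crowd n (J + 1) (gridBox (δ.cols g * 2 ^ t) (δ.rows g)
      (δ.col g * 2 ^ t + a) (δ.row g) 1)) ≤ ((2 ^ t : ℝ≥0∞)⁻¹) ^ (J + 1) := fun a =>
    (uniformPoints_crowd_le n _ (unitSquare_gridBox_le (Nat.mul_pos (δ.cols_pos g) ht)
      (δ.rows_pos g) _ _ _)).trans (pow_le_pow_left' (key _ (by rw [← hQ]; ring)) _)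
  have h₂ : ∀ a, uniformPoints n (Crowd n (J + 1) (gridBox (δ.cols g) (δ.rows g * 2 ^ t)
      (δ.col g) (δ.row g * 2 ^ t + a) 1)) ≤ ((2 ^ t : ℝ≥0∞)⁻¹) ^ (J + 1) := fun a =>
    (uniformPoints_crowd_le n _ (unitSquare_gridBox_le (δ.cols_pos g)
      (Nat.mul_pos (δ.rows_pos g) ht) _ _ _)).trans (pow_le_pow_left' (key _ (by rw [← hQ]; ring)) _)
  calc uniformPoints n (crowded J K n g t)
      ≤ ∑ a ∈ Finset.range (2 ^ t), (((2 ^ t : ℝ≥0∞)⁻¹) ^ (J + 1) +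
          ((2 ^ t : ℝ≥0∞)⁻¹) ^ (J + 1)) :=
        (measure_biUnion_finset_le _ _).trans (Finset.sum_le_sum fun a _ =>
          (measure_union_le _ _).trans (add_le_add (h₁ a) (h₂ a)))
    _ = 2 * (2 ^ t * (2 ^ t : ℝ≥0∞)⁻¹) * ((2 ^ t : ℝ≥0∞)⁻¹) ^ J := by
        rw [Finset.sum_const, Finset.card_range, nsmul_eq_mul, pow_succ]; push_cast; ring
    _ = _ := by rw [ENNReal.mul_inv_cancel b0 bt, mul_one]

/-- The expected cost. -/
theorem lintegral_costBound_le (hJ : 6 ≤ J) :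
    ∫⁻ P, costBound J K n P ∂(uniformPoints n) ≤
      (((shape J K n).D + 131) * (shape J K n).G : ℕ) := by
  set δ := shape J K n with hδ
  have hm : ∀ g t, Measurable ((crowded J K n g t).indicator (1 : (Fin n → ℝ × ℝ) → ℝ≥0∞)) :=
    fun g t => measurable_one.indicator (measurableSet_crowded g t)
  -- The weight `32 ^ t` is the fifth power of `2 ^ t`. Hence `J ≥ 6` leaves a factor `2 ^ (-t)`,
  -- and the sum over `t` is at most `128`.
  have hterm : ∀ t : ℕ, (32 : ℝ≥0∞) ^ (t + 1) * (2 * ((2 ^ t : ℝ≥0∞)⁻¹) ^ J) ≤ 64 * 2⁻¹ ^ t := by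
    intro t
    have h₁ : ((2 ^ t : ℝ≥0∞)⁻¹) ^ J ≤ ((2 ^ t : ℝ≥0∞)⁻¹) ^ 6 := by
      refine pow_le_pow_right_of_le_one' ?_ hJ
      rw [ENNReal.inv_le_one]
      exact one_le_pow_of_one_le' (by norm_num) t
    have h₂ : ((2 ^ t : ℝ≥0∞)⁻¹) ^ 6 = ((32 : ℝ≥0∞) ^ t)⁻¹ * 2⁻¹ ^ t := by
      rw [ENNReal.inv_pow, ENNReal.inv_pow, ← pow_mul, mul_comm t 6, pow_mul, ← mul_pow]
      congr 1
      rw [show (32 : ℝ≥0∞) = 2 ^ 5 by norm_num, ENNReal.inv_pow, ← pow_succ]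
    calc (32 : ℝ≥0∞) ^ (t + 1) * (2 * ((2 ^ t : ℝ≥0∞)⁻¹) ^ J)
        ≤ (32 : ℝ≥0∞) ^ (t + 1) * (2 * (((32 : ℝ≥0∞) ^ t)⁻¹ * 2⁻¹ ^ t)) := by
          rw [← h₂]; gcongr
      _ = 64 * (32 ^ t * ((32 : ℝ≥0∞) ^ t)⁻¹) * 2⁻¹ ^ t := by rw [pow_succ]; ring
      _ = _ := by rw [ENNReal.mul_inv_cancel (by positivity) (by simp), mul_one]
  have hgeo : ∑ t ∈ Finset.range δ.L, (64 * 2⁻¹ ^ t : ℝ≥0∞) ≤ 128 := by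
    rw [← Finset.mul_sum]
    calc _ ≤ (64 : ℝ≥0∞) * ∑' t : ℕ, 2⁻¹ ^ t := by gcongr; exact ENNReal.sum_le_tsum _
      _ = 128 := by rw [ENNReal.tsum_geometric, ENNReal.one_sub_inv_two, inv_inv]; norm_num
  unfold costBound
  rw [← hδ, lintegral_add_left measurable_const, lintegral_finsetSum _ (by fun_prop)]
  have hcell : ∀ g ∈ Finset.range δ.G, ∫⁻ P, (1 + ∑ t ∈ Finset.range δ.L,
      32 ^ (t + 1) * (crowded J K n g t).indicator 1 P) ∂(uniformPoints n) ≤ 129 := by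
    intro g hg
    rw [lintegral_add_left measurable_const, lintegral_finsetSum _ (by fun_prop)]
    calc _ ≤ (1 : ℝ≥0∞) + ∑ t ∈ Finset.range δ.L, (64 * 2⁻¹ ^ t : ℝ≥0∞) := by
          refine add_le_add (by simp) (Finset.sum_le_sum fun t _ => ?_)
          rw [lintegral_const_mul _ (hm g t), lintegral_indicator_one (measurableSet_crowded g t)]
          refine le_trans ?_ (hterm t)
          gcongr
          exact uniformPoints_crowded_le (Finset.mem_range.1 hg) t
      _ ≤ 1 + 128 := by gcongr
      _ = 129 := by norm_num
  calc _ ≤ (((δ.D + 2) * δ.G : ℕ) : ℝ≥0∞) + ∑ g ∈ Finset.range δ.G, 129 := by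
        refine add_le_add (by simp) (Finset.sum_le_sum hcell)
    _ = _ := by simp; ring

theorem card_runs_le : (runs J K n).card ≤ ((shape J K n).L + 1) * (shape J K n).Q := by
  set δ := shape J K n with hδ
  refine Finset.card_biUnion_le.trans ?_
  refine (Finset.sum_le_card_nsmul _ _ δ.Q fun i hi => ?_).trans_eq (by simp [hδ])
  refine (Finset.card_filter_le _ _).trans (Finset.card_image_le.trans ?_)
  rw [Finset.card_product, Finset.card_range, Finset.card_range, ← pow_add,
    Nat.add_sub_cancel' (Nat.lt_succ_iff.1 (Finset.mem_range.1 hi)), Dat.Q]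

/-- The probability that a run of cells is empty. -/
theorem one_sub_pow_le {Q L w n m : ℕ} (hQ : Q = 2 ^ L) (hQn : Q ≤ 2 * n) (hw : w ≤ Q)
    (hm : 2 * m * L ≤ w) : (1 - (w : ℝ≥0∞) / Q) ^ n ≤ ((Q : ℝ≥0∞)⁻¹) ^ m := by
  have hQ0 : 0 < Q := by rw [hQ]; positivity
  have hQ' : (0 : ℝ) < Q := by exact_mod_cast hQ0
  have hu : (w : ℝ) / Q ≤ 1 := by rw [div_le_one hQ']; exact_mod_cast hw
  have e₁ : (w : ℝ≥0∞) / Q = ENNReal.ofReal (w / Q) := by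
    rw [ENNReal.ofReal_div_of_pos hQ', ENNReal.ofReal_natCast, ENNReal.ofReal_natCast]
  have e₂ : (Q : ℝ≥0∞)⁻¹ = ENNReal.ofReal (Q : ℝ)⁻¹ := by
    rw [ENNReal.ofReal_inv_of_pos hQ', ENNReal.ofReal_natCast]
  rw [e₁, e₂, ← ENNReal.ofReal_one, ← ENNReal.ofReal_sub _ (by positivity),
    ← ENNReal.ofReal_pow (by linarith), ← ENNReal.ofReal_pow (by positivity)]
  refine ENNReal.ofReal_le_ofReal ?_
  have h₁ : (1 - (w : ℝ) / Q) ≤ Real.exp (-(w / Q)) := Real.one_sub_le_exp_neg _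
  -- From `Q ≤ 2 * n` and `2 * m * L ≤ w`. An empty run then has probability at most `exp (-(m * L))
  -- ≤ 2 ^ (-(m * L)) = Q ^ (-m)`.
  have h₂ : ((m * L : ℕ) : ℝ) ≤ n * (w / Q) := by
    rw [← mul_div_assoc, le_div_iff₀ hQ']
    have : m * L * Q ≤ n * w := by nlinarith
    exact_mod_cast this
  calc (1 - (w : ℝ) / Q) ^ n ≤ Real.exp (-(w / Q)) ^ n := by
        gcongr
    _ = Real.exp (-(n * (w / Q))) := by rw [← Real.exp_nat_mul]; congr 1; ring
    _ ≤ Real.exp (-((m * L : ℕ) : ℝ)) := by gcongr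
    _ = (Real.exp 1 ^ (m * L))⁻¹ := by rw [Real.exp_neg, ← Real.exp_nat_mul, mul_one]
    _ ≤ (2 ^ (m * L))⁻¹ := by
        gcongr
        have := Real.add_one_le_exp 1
        linarith
    _ = ((Q : ℝ)⁻¹) ^ m := by rw [hQ, inv_pow, mul_comm, pow_mul]; push_cast; rfl

/-- The probability of a wrong answer. -/
theorem uniformPoints_badEvent_le {k : ℕ} (hn : 2 ≤ n) :
    uniformPoints n (badEvent (k + 6) (2 * (k + 4)) n) ≤ ENNReal.ofReal (1 / (n : ℝ) ^ k) := by
  set δ := shape (k + 6) (2 * (k + 4)) n with hδ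
  set q := (δ.Q : ℝ≥0∞)⁻¹ with hq
  have hQ0 : (δ.Q : ℝ≥0∞) ≠ 0 := by exact_mod_cast δ.Q_pos.ne'
  have hQq : (δ.Q : ℝ≥0∞) * q = 1 := ENNReal.mul_inv_cancel hQ0 (ENNReal.natCast_ne_top _)
  have hnQ : n ≤ δ.Q := shape_le_Q
  have hL : δ.L + 1 ≤ δ.Q := δ.L_lt_Q
  -- There are at most `4 * Q ^ 2` cells, and each is still crowded at the cap with probability at
  -- most `2 * q ^ (k + 6)`.
  have h₁ : uniformPoints n (⋃ g ∈ Finset.range δ.G, crowded (k + 6) (2 * (k + 4)) n g δ.L) ≤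
      8 * q ^ (k + 4) := by
    refine (measure_biUnion_finset_le _ _).trans ?_
    have hG : δ.G ≤ 4 * δ.Q ^ 2 := by
      rw [Dat.G, Dat.NC]; nlinarith
    have e : ((2 ^ δ.L : ℝ≥0∞)⁻¹) = q := by rw [hq, Dat.Q]; push_cast; rfl
    calc _ ≤ ∑ g ∈ Finset.range δ.G, 2 * q ^ (k + 6) := Finset.sum_le_sum fun g hg => by
            rw [← e]; exact uniformPoints_crowded_le (Finset.mem_range.1 hg) _
      _ = δ.G * (2 * q ^ (k + 6)) := by simp
      _ ≤ (4 * δ.Q ^ 2 : ℕ) * (2 * q ^ (k + 6)) := by gcongr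
      _ = 8 * q ^ (k + 4) * (δ.Q * q) ^ 2 := by push_cast; ring
      _ = _ := by rw [hQq, one_pow, mul_one]
  -- A run has area `2 ^ D / Q` whatever its level, and there are at most `(L + 1) * Q ≤ Q ^ 2`
  -- runs, each empty with probability at most `q ^ (k + 4)`.
  have h₂ : uniformPoints n (⋃ r ∈ runs (k + 6) (2 * (k + 4)) n, {P | ∀ p, P p ∉
      gridBox (2 ^ r.1) (2 ^ (δ.L - r.1)) r.2.1 r.2.2 (2 ^ δ.D)}) ≤ q ^ (k + 2) := by
    refine (measure_biUnion_finset_le _ _).trans ?_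
    calc _ ≤ ∑ r ∈ runs (k + 6) (2 * (k + 4)) n, q ^ (k + 4) := Finset.sum_le_sum fun r hr => by
            simp only [runs, Finset.mem_biUnion, Finset.mem_filter, Finset.mem_image,
              Finset.mem_product, Finset.mem_range] at hr
            obtain ⟨i, hi, ⟨⟨c, r⟩, ⟨hc, hr⟩, rfl⟩, hle⟩ := hr
            have hMN : 2 ^ i * 2 ^ (δ.L - i) = δ.Q := by
              rw [← pow_add, Nat.add_sub_cancel' (Nat.lt_succ_iff.1 hi), Dat.Q]
            have hR : 2 ^ (δ.L - i) ≤ δ.Q := Nat.pow_le_pow_right (by norm_num) (by omega)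
            simp only at hc hr hle ⊢
            rw [← hδ] at hle
            rw [uniformPoints_forall_notMem n (measurableSet_gridBox _ _ _ _ _),
              unitSquare_gridBox hc hle (by positivity), hMN]
            refine one_sub_pow_le rfl (shape_Q_le hn) (by omega) ?_
            -- This is the choice of `D`: the least exponent with `2 * (k + 4) * L ≤ 2 ^ D`.
            exact Nat.le_pow_clog (by norm_num) _
      _ = (runs (k + 6) (2 * (k + 4)) n).card * q ^ (k + 4) := by simp
      _ ≤ (δ.Q ^ 2 : ℕ) * q ^ (k + 4) := by
          gcongr
          refine card_runs_le.trans ?_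
          rw [← hδ]
          nlinarith
      _ = q ^ (k + 2) * (δ.Q * q) ^ 2 := by push_cast; ring
      _ = _ := by rw [hQq, one_pow, mul_one]
  -- Since `Q ≥ n ≥ 2`, the two contributions add up to at most `q ^ k * (8 / 16 + 1 / 4)`.
  have hq2 : q ≤ 2⁻¹ := by
    rw [hq, ENNReal.inv_le_inv]
    exact_mod_cast hn.trans hnQ
  calc _ ≤ 8 * q ^ (k + 4) + q ^ (k + 2) := (measure_union_le _ _).trans (add_le_add h₁ h₂)
    _ = q ^ k * (8 * q ^ 4 + q ^ 2) := by ring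
    _ ≤ q ^ k * (8 * 2⁻¹ ^ 4 + 2⁻¹ ^ 2) := by gcongr
    _ ≤ q ^ k * 1 := by
        gcongr
        have : (2⁻¹ : ℝ≥0∞) = ((2⁻¹ : NNReal) : ℝ≥0∞) := by simp
        rw [this]
        have h : (8 * 2⁻¹ ^ 4 + 2⁻¹ ^ 2 : NNReal) ≤ 1 := by
          rw [← NNReal.coe_le_coe]; push_cast; norm_num
        exact_mod_cast h
    _ ≤ ((n : ℝ≥0∞)⁻¹) ^ k := by
        rw [mul_one]
        gcongr
        rw [hq, ENNReal.inv_le_inv]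
        exact_mod_cast hnQ
    _ = _ := by
        have hn' : (0 : ℝ) < n := by exact_mod_cast (by omega : 0 < n)
        rw [one_div, ← inv_pow, ENNReal.ofReal_pow (by positivity), ENNReal.ofReal_inv_of_pos hn',
          ENNReal.ofReal_natCast]

/-! ## Growth -/

/-- From `2 ^ L ≤ 2 * n ≤ n ^ 2` and `log 2 > 1 / 2`. -/
theorem log_bounds (hn : 2 ≤ n) : ((shape J K n).L : ℝ) ≤ 4 * Real.log n := by
  have hn' : (2 : ℝ) ≤ n := by exact_mod_cast hn
  have h₁ : ((2 : ℝ) ^ (shape J K n).L) ≤ (n : ℝ) ^ 2 := by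
    have : (shape J K n).Q ≤ n ^ 2 := (shape_Q_le hn).trans (by nlinarith)
    exact_mod_cast this
  have h₂ := Real.log_le_log (by positivity) h₁
  rw [Real.log_pow, Real.log_pow] at h₂
  have h₃ := Real.log_two_gt_d9
  have h₄ : (0 : ℝ) ≤ (shape J K n).L := Nat.cast_nonneg _
  push_cast at h₂
  nlinarith

/-- The number `D` of layers is logarithmic in `log n`, while the claim allows a factor `log ^ ε n`.
With `z = (2 ^ D) ^ ε`, the inequality `exp u ≥ 1 + u` gives `D ≤ (2 / ε) * z`, and `2 ^ D ≤ 2 * K *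
L ≤ 8 * K * log n` bounds `z`. The factor `G` is at most `64 * n * log n`. -/
theorem growth {ε : ℝ} (hε : 0 < ε) (hε' : ε < 1) (hK : 2 ≤ K) (hn : 2 ≤ n) :
    (((((shape J K n).D + 131) * (shape J K n).G : ℕ)) : ℝ) ≤
      (2 / ε + 131) * (512 * K) * (n * Real.log n ^ (1 + ε)) := by
  have hL := log_bounds (J := J) (K := K) hn
  have hL1 := shape_one_le_L (J := J) (K := K) hn
  have hQ := shape_Q_le (J := J) (K := K) hn
  set δ := shape J K n with hδ
  have hlog : 0 < Real.log n := Real.log_pos (by exact_mod_cast (by omega : 1 < n))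
  have hG : (δ.G : ℝ) ≤ 64 * (n * Real.log n) := by
    have h₁ : (δ.L : ℝ) + 1 ≤ 8 * Real.log n := by
      have : (1 : ℝ) ≤ δ.L := by exact_mod_cast hL1
      linarith
    have h₂ : (δ.Q : ℝ) ≤ 2 * n := by exact_mod_cast hQ
    calc (δ.G : ℝ) = (δ.L + 1) * (4 * δ.Q) := by rw [Dat.G, Dat.NC]; push_cast; ring
      _ ≤ (8 * Real.log n) * (4 * (2 * n)) := by gcongr
      _ = _ := by ring
  have hD : (2 : ℝ) ^ δ.D ≤ 8 * K * Real.log n := by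
    have hKL : 1 < K * δ.L := by nlinarith
    have h := Nat.pow_pred_clog_lt_self (b := 2) (by norm_num) hKL
    have h₁ : 1 ≤ Nat.clog 2 (K * δ.L) := Nat.clog_pos (by norm_num) hKL
    have h₂ : 2 ^ δ.D = 2 * 2 ^ (Nat.clog 2 (K * δ.L)).pred := by
      rw [← pow_succ', Nat.pred_eq_sub_one, Nat.sub_add_cancel h₁]; rfl
    have h₃ : (2 : ℝ) ^ δ.D ≤ 2 * (K * δ.L) := by
      have : 2 ^ δ.D ≤ 2 * (K * δ.L) := by omega
      exact_mod_cast this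
    have : (K : ℝ) * δ.L ≤ K * (4 * Real.log n) := by gcongr
    linarith
  set z := ((2 : ℝ) ^ δ.D) ^ ε with hz
  have hz1 : 1 ≤ z := Real.one_le_rpow (one_le_pow₀ (by norm_num)) hε.le
  have hDz : (δ.D : ℝ) ≤ 2 / ε * z := by
    have h₁ : z = Real.exp (δ.D * Real.log 2 * ε) := by
      rw [hz, Real.rpow_def_of_pos (by positivity), Real.log_pow]
    have h₂ := Real.add_one_le_exp (δ.D * Real.log 2 * ε)
    rw [← h₁] at h₂
    have h₃ := Real.log_two_gt_d9
    have h₄ : (0 : ℝ) ≤ δ.D := Nat.cast_nonneg _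
    have h₅ : (δ.D : ℝ) * ε * (1 / 2) ≤ δ.D * ε * Real.log 2 := by gcongr; linarith
    rw [div_mul_eq_mul_div, le_div_iff₀ hε]
    nlinarith
  have hzle : z ≤ 8 * K * Real.log n ^ ε := by
    have hK' : (1 : ℝ) ≤ 8 * K := by exact_mod_cast (by omega : 1 ≤ 8 * K)
    calc z ≤ (8 * K * Real.log n) ^ ε := Real.rpow_le_rpow (by positivity) hD hε.le
      _ = (8 * K : ℝ) ^ ε * Real.log n ^ ε := Real.mul_rpow (by positivity) hlog.le
      _ ≤ (8 * K : ℝ) ^ (1 : ℝ) * Real.log n ^ ε := by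
          gcongr
      _ = _ := by rw [Real.rpow_one]
  calc (((δ.D + 131) * δ.G : ℕ) : ℝ) = (δ.D + 131) * δ.G := by push_cast; ring
    _ ≤ ((2 / ε + 131) * z) * (64 * (n * Real.log n)) := by
        gcongr
        nlinarith
    _ ≤ ((2 / ε + 131) * (8 * K * Real.log n ^ ε)) * (64 * (n * Real.log n)) := by gcongr
    _ = _ := by rw [Real.rpow_add hlog, Real.rpow_one]; ring

/-- A worst-case polynomial bound, valid for every input. It is what keeps all addresses and words
below `n ^ κ`, even on the bad event. -/
theorem cost_le {P : Fin n → ℝ × ℝ} (hn : 2 ≤ n) (hK : 2 ≤ K) :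
    (dat J K P).cost ≤ (8 * K + 12) * n ^ 14 := by
  set δ := dat J K P with hδ
  have hQ : δ.Q ≤ n ^ 2 := (shape_Q_le (J := J) (K := K) hn).trans (by nlinarith)
  have hL1 : 1 ≤ δ.L := shape_one_le_L (J := J) (K := K) hn
  have hLQ : δ.L + 1 ≤ δ.Q := δ.L_lt_Q
  have hD : δ.D ≤ 2 * K * δ.Q := by
    have hKL : 1 < K * δ.L := by nlinarith
    have h := Nat.pow_pred_clog_lt_self (b := 2) (by norm_num) hKL
    have h₁ : 1 ≤ Nat.clog 2 (K * δ.L) := Nat.clog_pos (by norm_num) hKL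
    have h₂ : 2 ^ δ.D = 2 * 2 ^ (Nat.clog 2 (K * δ.L)).pred := by
      rw [← pow_succ', Nat.pred_eq_sub_one, Nat.sub_add_cancel h₁]; rfl
    have h₃ : δ.D < 2 ^ δ.D := Nat.lt_two_pow_self
    have h₄ : K * δ.L ≤ K * δ.Q := Nat.mul_le_mul_left _ (by omega)
    rw [mul_assoc]
    omega
  have hG : δ.G ≤ 4 * δ.Q ^ 2 := by rw [Dat.G, Dat.NC]; nlinarith
  have hQ1 : 1 ≤ δ.Q := δ.Q_pos
  have hsum : ∑ g ∈ Finset.range δ.G, δ.B g ^ 5 ≤ δ.G * δ.Q ^ 5 := by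
    refine (Finset.sum_le_card_nsmul _ _ (δ.Q ^ 5) fun g _ =>
      Nat.pow_le_pow_left (δ.B_le_Q g) 5).trans ?_
    simp
  have hQ5 : δ.Q ≤ δ.Q ^ 5 := Nat.le_self_pow (by norm_num) _
  calc δ.cost ≤ (δ.D + 2) * δ.G + δ.G * δ.Q ^ 5 := Nat.add_le_add_left hsum _
    _ = (δ.D + 2 + δ.Q ^ 5) * δ.G := by ring
    _ ≤ (2 * K * δ.Q ^ 5 + 2 * δ.Q ^ 5 + δ.Q ^ 5) * (4 * δ.Q ^ 2) := by
        refine Nat.mul_le_mul ?_ hG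
        have : 2 * K * δ.Q ≤ 2 * K * δ.Q ^ 5 := Nat.mul_le_mul_left _ hQ5
        omega
    _ = (8 * K + 12) * δ.Q ^ 7 := by ring
    _ ≤ (8 * K + 12) * (n ^ 2) ^ 7 := by gcongr
    _ = _ := by ring


/-! ## The programs -/

/-- The preprocessing program. -/
def buildCode (J K : ℕ) : Prog :=
  .seq (.instr (.cast (2 * Var.n.idx) 0)) (buildProg K J).code

/-- The query program. -/
def queryCode (J : ℕ) : Prog :=
  -- The variables `x`, `x'`, `y`, `y'` live in the registers `0`, `2`, `4`, `6`, while the input is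
  -- in `0`, `1`, `2`, `3`. Moving the last one first overwrites nothing that is still needed.
  .seq (.instr (.moveR 6 3)) (.seq (.instr (.moveR 4 2)) (.seq (.instr (.moveR 2 1))
    (.seq (queryProg J).code (.instr (.floor 0 (2 * Var.ans.idx))))))

/-- An upper bound for the time of a query. -/
def queryTime (J : ℕ) : ℕ := 4 + (queryProg J).unit * (5 * (83 + 22 * (4 * J + 1)) + 40)

/-- An upper bound for the time of the preprocessing per unit of cost. -/
def buildFactor (J K : ℕ) : ℕ := 1 + (buildProg K J).unit * (200 * (J + 1))

variable {J K n W : ℕ} {P : Fin n → ℝ × ℝ}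

theorem one_le_cost (δ : Dat) : 1 ≤ δ.cost := by
  have h₁ := δ.le_cost
  have h₂ := δ.Q_le_G
  have h₃ := δ.Q_pos
  nlinarith

theorem exists_builds (hδ : (dat J K P).Good)
    (hI : 9 * (((dat J K P).N + 1) * (dat J K P).cost) ≤ W) (hW : 9 < W)
    (hc : (buildProg K J).maxLit < W) :
    ∃ (t : ℕ) (s : AS) (τ : State), Builds W (9 * (((dat J K P).N + 1) * (dat J K P).cost))
      (buildCode J K) P t τ.mem ∧ Rep W (dat J K P).X s τ ∧ (dat J K P).Valid s ∧
      t ≤ buildFactor J K * (dat J K P).cost := by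
  set δ := dat J K P with hδdef
  set z : Cfg := ⟨W, (δ.N + 1) * δ.cost, δ.X⟩ with hz
  have hF : δ.Fits z := ⟨rfl, le_rfl, hI⟩
  set s₀ : AS := ⟨fun u => if u = .n then n else 0, fun _ _ => 0, 0⟩ with hs₀
  obtain ⟨s, hr, hV, ht⟩ := Dat.buildProg_spec (K := K) (s := s₀) hF hδ rfl rfl (by simp [hs₀]; rfl)
    (fun _ _ => rfl)
  set τ₀ : State := (inputState P).setR (2 * Var.n.idx) n with hτ₀
  have hrep : Rep W δ.X s₀ τ₀ := by
    refine ⟨fun u => ?_, rfl, fun _ _ => rfl, fun _ => ?_⟩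
    · by_cases hu : u = .n
      · subst hu
        simp [hτ₀, hs₀, State.setR]
      · have : 2 * u.idx ≠ 2 * Var.n.idx := fun h => hu (Var.idx_injective (by omega))
        simp [hτ₀, hs₀, State.setR, Function.update_of_ne this, hu, inputState]
    · exact Nat.zero_lt_of_lt hW
  obtain ⟨t, τ, he, hrep', ht'⟩ := hr.exec hI hW hc le_rfl τ₀ hrep
  refine ⟨1 + t, s, τ, ⟨τ, .seq (.instr ?_) he, rfl⟩, hrep', hV, ?_⟩
  · simp [Instr.exec, hτ₀, inputState]
  · rw [show δ.J = J from rfl] at ht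
    have h₁ := one_le_cost δ
    have h₂ : s₀.clk = 0 := rfl
    have h₃ : (buildProg K J).unit * s.clk ≤
        (buildProg K J).unit * (200 * (J + 1) * δ.cost) :=
      Nat.mul_le_mul_left _ (by simpa [h₂] using ht)
    rw [h₂, mul_zero, add_zero, show δ.J = J from rfl] at ht'
    calc 1 + t ≤ δ.cost + (buildProg K J).unit * (200 * (J + 1) * δ.cost) := by omega
      _ = _ := by rw [buildFactor]; ring

theorem exists_answers (hδ : (dat J K P).Good) (hD : 0 < (dat J K P).D)
    (hI : 9 * (((dat J K P).N + 1) * (dat J K P).cost) ≤ W) (hW : 9 < W)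
    (hc : (queryProg J).maxLit < W) {s : AS} {τ : State} (hrep : Rep W (dat J K P).X s τ)
    (hV : (dat J K P).Valid s) (x x' y y' : ℝ) :
    ∃ (t : ℕ) (b : Bool), Answers W (9 * (((dat J K P).N + 1) * (dat J K P).cost))
      (queryCode J) τ.mem x x' y y' t b ∧ t ≤ queryTime J ∧
      ((dat J K P).Regular → (b = true ↔ rectangle x x' y y' ∩ Set.range P = ∅)) := by
  set δ := dat J K P with hδdef
  set z : Cfg := ⟨W, (δ.N + 1) * δ.cost, δ.X⟩ with hz
  have hF : δ.Fits z := ⟨rfl, le_rfl, hI⟩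
  set τ₁ := (queryState τ.mem x x' y y').setR 6 y' with hτ₁
  set τ₂ := τ₁.setR 4 y with hτ₂
  set τ₃ := τ₂.setR 2 x' with hτ₃
  set s₀ : AS := ⟨fun u => τ₃.rreg (2 * u.idx), s.a, 0⟩ with hs₀
  have hrep₀ : Rep W δ.X s₀ τ₃ := ⟨fun _ => rfl, hrep.real, hrep.arr, hrep.lt⟩
  have hρ : Dat.RectCtx ⟨x, x', y, y'⟩ s₀ := by
    refine ⟨?_, ?_, ?_, ?_⟩ <;>
      simp [hs₀, hτ₃, hτ₂, hτ₁, State.setR, Var.idx, Var.ctorIdx, queryState]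
  obtain ⟨s', hr, ⟨hres, ht⟩, hf⟩ := (Dat.queryProg_spec hF hδ hD (hV.of_eq (s' := s₀) rfl) hρ).frame
  obtain ⟨t, τ', he, hrep', ht'⟩ := hr.exec hI hW hc le_rfl τ₃ hrep₀
  -- The query writes to no array, and the arrays determine the memory.
  have hmem : τ'.mem = τ.mem := hrep₀.mem_eq hrep' (funext fun r => hf.2 r rfl)
  have hins : (∃ p, δ.Inside ⟨x, x', y, y'⟩ p) ↔ (rectangle x x' y y' ∩ Set.range P).Nonempty := by
    constructor
    · rintro ⟨p, hp, h₁, h₂, h₃, h₄⟩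
      have e₁ : δ.px p = (P ⟨p, hp⟩).1 := dat_px ⟨p, hp⟩
      have e₂ : δ.py p = (P ⟨p, hp⟩).2 := dat_py ⟨p, hp⟩
      rw [e₁] at h₁ h₂
      rw [e₂] at h₃ h₄
      exact ⟨P ⟨p, hp⟩, ⟨⟨h₁, h₂⟩, h₃, h₄⟩, _, rfl⟩
    · rintro ⟨_, ⟨⟨h₁, h₂⟩, h₃, h₄⟩, p, rfl⟩
      refine ⟨p, p.2, ?_⟩
      rw [show δ.px p = (P p).1 from dat_px p, show δ.py p = (P p).2 from dat_py p]
      exact ⟨h₁, h₂, h₃, h₄⟩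
  have htime : 1 + (1 + (1 + (t + 1))) ≤ queryTime J := by
    have h₂ : s₀.clk = 0 := rfl
    have h₃ : (queryProg J).unit * s'.clk ≤
        (queryProg J).unit * (5 * (83 + 22 * (4 * J + 1)) + 40) := by
      refine Nat.mul_le_mul_left _ ?_
      rw [h₂, zero_add] at ht
      exact ht
    rw [h₂, mul_zero, add_zero, show δ.J = J from rfl] at ht'
    rw [queryTime]
    omega
  have main : ∀ b : Bool, s'.v .ans = (b.toNat : ℝ) → Answers W (9 * ((δ.N + 1) * δ.cost))
      (queryCode J) τ.mem x x' y y' (1 + (1 + (1 + (t + 1)))) b := by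
    intro b hb
    have hreg : τ'.rreg (2 * Var.ans.idx) = b.toNat := by rw [hrep'.var, hb]
    have hbW : b.toNat < W := lt_of_le_of_lt (Bool.toNat_le b) (by omega)
    refine ⟨{ τ' with wreg := Function.update τ'.wreg 0 b.toNat },
      .seq (.instr (σ' := τ₁) ?_) (.seq (.instr (σ' := τ₂) ?_) (.seq (.instr (σ' := τ₃) ?_)
        (.seq he (.instr ?_)))), by simp, hmem⟩
    · simp [Instr.exec, hτ₁, queryState]
    · simp [Instr.exec, hτ₂, hτ₁, queryState, State.setR]
    · simp [Instr.exec, hτ₃, hτ₂, hτ₁, queryState, State.setR]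
    · simp [Instr.exec, hreg, State.setW, hbW]
  rcases hres with ⟨ha, hR⟩ | ⟨ha, hR⟩
  · refine ⟨_, false, main false (by simpa using ha), htime, fun h => ?_⟩
    have := hins.1 (hR h)
    simp [this.ne_empty]
  · refine ⟨_, true, main true (by simpa using ha), htime, fun h => ?_⟩
    simp only [true_iff]
    rw [← Set.not_nonempty_iff_eq_empty, ← hins, not_exists]
    exact hR h

end RealRAM

open RealRAM in
theorem mainTheorem2 (k : ℕ) :
    ∃ K : ℝ, ∀ ε : ℝ, 0 < ε → ε < 1 →
      ∃ (build query : RealRAM.Prog) (κ : ℕ) (C : ℝ), ∀ n : ℕ, 2 ≤ n →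
        ∃ (T S : (Fin n → ℝ × ℝ) → ℝ≥0∞) (bad : Set (Fin n → ℝ × ℝ)),
          Measurable T ∧ Measurable S ∧
          ∫⁻ P, T P ∂(uniformPoints n) ≤
            ENNReal.ofReal (C * ((n : ℝ) * Real.log (n : ℝ) ^ (1 + ε))) ∧
          ∫⁻ P, S P ∂(uniformPoints n) ≤
            ENNReal.ofReal (C * ((n : ℝ) * Real.log (n : ℝ) ^ (1 + ε))) ∧
          uniformPoints n bad ≤ ENNReal.ofReal (1 / (n : ℝ) ^ k) ∧
          ∀ᵐ P ∂(uniformPoints n), ∃ (t s : ℕ) (M : RealRAM.Memory),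
            RealRAM.Builds (n ^ κ) s build P t M ∧
            (t : ℝ≥0∞) ≤ T P ∧ (s : ℝ≥0∞) ≤ S P ∧
            ∀ x x' y y' : ℝ, ∃ (t' : ℕ) (b : Bool),
              RealRAM.Answers (n ^ κ) s query M x x' y y' t' b ∧
              (t' : ℝ) ≤ K / ε ∧
              (P ∉ bad → (b = true ↔ rectangle x x' y y' ∩ Set.range P = ∅)) := by
  -- The summand `6` makes the expected table size bounded; the summand `k`, here and in `K`, yields
  -- the failure probability `n ^ (-k)`.
  set J := k + 6 with hJ
  set K := 2 * (k + 4) with hK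
  set m := 9 * (4 * J + 2) with hm
  -- The exponent `14` and the factor `8 * K + 12` come from `cost_le`. Constants are absorbed into
  -- the exponent by `a < n ^ a`, which also makes room for the literals of both programs.
  set κ := 14 + m * (8 * K + 12) + (buildProg K J).maxLit + (queryProg J).maxLit + 4 with hκ
  set F := buildFactor J K + m with hF
  refine ⟨queryTime J, fun ε hε hε' => ⟨buildCode J K, queryCode J, κ,
    F * ((2 / ε + 131) * (512 * K)), fun n hn => ?_⟩⟩
  have hexp : ∀ f : ℕ, f ≤ F → ∫⁻ P, f * costBound J K n P ∂(uniformPoints n) ≤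
      ENNReal.ofReal (F * ((2 / ε + 131) * (512 * K)) * (n * Real.log n ^ (1 + ε))) := by
    intro f hf
    have hg := growth (J := J) (K := K) hε hε' (by omega) hn
    calc ∫⁻ P, f * costBound J K n P ∂(uniformPoints n)
        = f * ∫⁻ P, costBound J K n P ∂(uniformPoints n) :=
          lintegral_const_mul _ measurable_costBound
      _ ≤ F * (((shape J K n).D + 131) * (shape J K n).G : ℕ) := by
          gcongr
          exact lintegral_costBound_le (by omega)
      _ = ENNReal.ofReal (F * (((shape J K n).D + 131) * (shape J K n).G : ℕ)) := by
          rw [ENNReal.ofReal_mul (Nat.cast_nonneg _), ENNReal.ofReal_natCast,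
            ENNReal.ofReal_natCast]
      _ ≤ _ := by
          refine ENNReal.ofReal_le_ofReal ?_
          rw [mul_assoc]
          exact mul_le_mul_of_nonneg_left hg (Nat.cast_nonneg _)
  have hpow : ∀ {a b : ℕ}, a ≤ b → n ^ a ≤ n ^ b := fun h => Nat.pow_le_pow_right (by omega) h
  have hself : ∀ a : ℕ, a < n ^ a := fun a => Nat.lt_pow_self (by omega)
  have hW : 9 < n ^ κ := by
    have h₁ : n ^ 4 ≤ n ^ κ := hpow (by omega)
    have h₂ : 2 ^ 4 ≤ n ^ 4 := Nat.pow_le_pow_left hn 4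
    omega
  refine ⟨fun P => buildFactor J K * costBound J K n P, fun P => m * costBound J K n P,
    badEvent J K n, measurable_costBound.const_mul _, measurable_costBound.const_mul _,
    hexp _ (by omega), hexp _ (by omega), uniformPoints_badEvent_le hn, ?_⟩
  filter_upwards [ae_uniformPoints_pos n] with P hP
  have hδ := dat_good (J := J) (K := K) hn hP
  have hcost := cost_le_costBound (J := J) (K := K) hn hP
  have hI : 9 * (((dat J K P).N + 1) * (dat J K P).cost) ≤ n ^ κ := by
    calc 9 * (((dat J K P).N + 1) * (dat J K P).cost) = m * (dat J K P).cost := by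
          rw [hm, Dat.N]; change 9 * ((4 * J + 1 + 1) * _) = _; ring
      _ ≤ m * ((8 * K + 12) * n ^ 14) := Nat.mul_le_mul_left _ (cost_le hn (by omega))
      _ = m * (8 * K + 12) * n ^ 14 := by ring
      _ ≤ n ^ (m * (8 * K + 12)) * n ^ 14 := Nat.mul_le_mul_right _ (hself _).le
      _ = n ^ (m * (8 * K + 12) + 14) := by rw [pow_add]
      _ ≤ n ^ κ := hpow (by omega)
  have hD : 0 < (dat J K P).D := by
    refine Nat.clog_pos (by norm_num) ?_
    have := shape_one_le_L (J := J) (K := K) hn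
    change 2 ≤ K * (shape J K n).L
    nlinarith
  obtain ⟨t, s, τ, h₁, h₂, h₃, h₄⟩ := exists_builds hδ hI hW
    ((hself _).trans_le (hpow (by omega)))
  refine ⟨t, _, τ.mem, h₁, ?_, ?_, fun x x' y y' => ?_⟩
  · calc (t : ℝ≥0∞) ≤ (buildFactor J K * (dat J K P).cost : ℕ) := by exact_mod_cast h₄
      _ ≤ _ := by push_cast; gcongr
  · calc ((9 * (((dat J K P).N + 1) * (dat J K P).cost) : ℕ) : ℝ≥0∞)
        = (m * (dat J K P).cost : ℕ) := by
          congr 1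
          rw [hm, Dat.N]; change 9 * ((4 * J + 1 + 1) * _) = _; ring
      _ ≤ _ := by push_cast; gcongr
  · obtain ⟨t', b, h₅, h₆, h₇⟩ := exists_answers hδ hD hI hW ((hself _).trans_le (hpow (by omega)))
      h₂ h₃ x x' y y'
    refine ⟨t', b, h₅, ?_, fun hbad => h₇ (regular_of_notMem hn hP hbad)⟩
    have : (t' : ℝ) ≤ queryTime J := by exact_mod_cast h₆
    -- The query time does not depend on `ε`; dividing by `ε < 1` only weakens the bound.
    exact this.trans (le_div_self (Nat.cast_nonneg _) hε hε'.le)
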